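/- Let $b>0$. For $i=1,2$ let $\xi_i(t)=\sum_{j=1}^{N_i(t)}\xi^i_j-a_it$ be a compound Poisson process, where $a_i>0$, $N_i$ is a Poisson process of rate $\lambda_i>0$, and the jumps $\xi^i_j>0$ are i.i.d. with law $F_i$ and independent of $N_i$. Put $$k_i(z)=a_iz+\lambda_i\int_0^\infty(e^{-xz}-1)\,dF_i(x),\qquad \operatorname{Re}z\ge 0 .$$ Let $\xi(x,\cdot)$, $x\in\mathbb R$, be the oscillating process with $\xi(x,0)=x$. When it is at or below $b$, it moves with the increments of a fresh independent copy of $\xi_1$ until it first exceeds $b$. From a position above $b$ it moves with the increments of a fresh independent copy of $\xi_2$ until it first reaches $b$. These phases alternate. For $r\le\min\{x,b\}$ let $\underline\tau_r^x=\inf\{t:\xi(x,t)\le r\}$. For $k\ge\max\{x,b\}$ let $\overline\tau_x^k=\inf\{t:\xi(x,t)>k\}$ and $\overline T_x^k=\xi(x,\overline\tau_x^k)-k$ (with $\inf\emptyset=\infty$). Define $$\underline f_r^x(s)=\mathbf E[e^{-s\underline\tau_r^x};\underline\tau_r^x<\infty],\quad \overline f_x^k(s)=\mathbf E[e^{-s\overline\tau_x^k};\overline\tau_x^k<\infty],\quad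 \overline f_x^k(z,s)=\mathbf E[e^{-s\overline\tau_x^k-z\overline T_x^k};\overline\tau_x^k<\infty].$$ For $s>0$ let $c_i(s)>0$ be the unique root of $k_i(z)=s$ in $\operatorname{Re}z>0$, and let $c_i(0)=\lim_{s\downarrow0}c_i(s)$, which is the largest nonnegative root of $k_i(z)=0$. For $s\ge0$ there are unique right-continuous functions $R_i^s$, $K_x^s$ ($x\in\mathbb R$), $F_s$ on $[0,\infty)$, extended by $0$ to $(-\infty,0)$, with absolutely convergent Laplace transforms $$\int_0^\infty e^{-uz}R_i^s(u)\,du=\frac1{k_i(z)-s},\quad \operatorname{Re}z>c_i(s),$$ $$\mathbb K_x^s(z)=\int_0^\infty e^{-uz}K_x^s(u)\,du=\frac{k_1(z)-s}{k_2(z)-s}\int_0^\infty e^{-uz}R_1^s(x+u)\,du,\quad \operatorname{Re}z>\max\{c_1(s),c_2(s)\},$$ $$\mathbb F_s(z)=\int_0^\infty e^{-uz}F_s(u)\,du=\frac1{z-c_1(s)}\,\frac{k_1(z)-s}{k_2(z)-s},\quad \operatorname{Re}z>c_2(s),\ z\ne c_1(s).$$ Put $C_i^x(z,s)=e^{zx}$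 for $x<0$ and $C_i^x(z,s)=e^{zx}\bigl(1-(k_i(z)-s)\int_0^xe^{-uz}R_i^s(u)\,du\bigr)$ for $x\ge0$. Then for every $s\ge0$ the denominators $C_1^{b-r}(c_2(s),s)$ and $F_s(k-b)$ below do not vanish, and with $d_2=k-b$ the following hold. 1. For all $r\le\min\{x,b\}$, $$\underline f_r^x(s)=\frac{C_1^{b-x}(c_2(s),s)}{C_1^{b-r}(c_2(s),s)}.$$ 2. For all $k\ge\max\{x,b\}$, $$\overline f_x^k(s)=1+s\int_0^{b-x}R_1^s(u)\,du+s\int_0^{d_2}K_{b-x}^s(u)\,du-\frac{K_{b-x}^s(d_2)}{F_s(d_2)}\Bigl(\frac s{c_1(s)}+s\int_0^{d_2}F_s(u)\,du\Bigr),$$ where for $s=0$ the term $s/c_1(s)$ is read as $\lim_{t\downarrow0}t/c_1(t)$, which exists. 3. For all $k\ge\max\{x,b\}$ and all complex $z$ with $\operatorname{Re}z\ge0$, $$\overline f_x^k(z,s)=e^{zd_2}(k_2(z)-s)\Bigl(\mathbb K_{b-x}^s(z)-\int_0^{d_2}e^{-uz}K_{b-x}^s(u)\,du\Bigr)-\frac{K_{b-x}^s(d_2)}{F_s(d_2)}\,e^{zd_2}(k_2(z)-s)\Bigl(\mathbb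 F_s(z)-\int_0^{d_2}e^{-uz}F_s(u)\,du\Bigr),$$ where $(k_2(z)-s)\mathbb K_{b-x}^s(z)$ and $(k_2(z)-s)\mathbb F_s(z)$ denote the unique extensions of these products from the half-planes of convergence above to functions that are continuous on $\operatorname{Re}z\ge0$ and holomorphic on $\operatorname{Re}z>0$. -/

import Mathlib

open MeasureTheory ProbabilityTheory Set Filter Topology
open scoped NNReal ENNReal

noncomputable section

namespace Oscillating

/-- The data of a compound Poisson process with negative drift and positive jumps:
drift coefficient `a`, jump intensity `lam`, and the law `jump` of a single jump. -/
structure CompoundPoisson where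
  a : ℝ
  lam : ℝ
  jump : Measure ℝ
  a_pos : 0 < a
  lam_pos : 0 < lam
  isProb : IsProbabilityMeasure jump
  jump_pos : jump (Iic 0) = 0

/-! ### Exponent, root, and functions given by their Laplace transforms -/

/-- `k(z) = a z + λ ∫ (e^{-xz} - 1) dF(x)`. -/
def CompoundPoisson.k (p : CompoundPoisson) (z : ℂ) : ℂ :=
  p.a * z + p.lam * ∫ x, (Complex.exp (-(x * z)) - 1) ∂p.jump

/-- The largest nonnegative real root `c(s)` of `k(z) = s`. For `s > 0` it is the only root
in `Re z > 0`; at `s = 0` it is the limit of `c(s)` as `s ↓ 0`. -/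
def CompoundPoisson.c (p : CompoundPoisson) (s : ℝ) : ℝ :=
  sSup {z : ℝ | 0 ≤ z ∧ p.k z = s}

/-- `∫₀^∞ e^{-uz} f(u) du`. -/
def laplace (f : ℝ → ℝ) (z : ℂ) : ℂ :=
  ∫ u in Ioi (0 : ℝ), Complex.exp (-(u * z)) * f u

/-- `f` is the right-continuous function on `[0, ∞)` (extended by `0` to the left) whose
Laplace transform converges absolutely on `D` and is equal to `Φ` there. -/
def IsOriginal (D : Set ℂ) (Φ : ℂ → ℂ) (f : ℝ → ℝ) : Prop :=
  (∀ u, u < 0 → f u = 0) ∧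
  (∀ u, 0 ≤ u → ContinuousWithinAt f (Ici u) u) ∧
  ∀ z ∈ D, IntegrableOn (fun u : ℝ => Complex.exp (-(u * z)) * f u) (Ioi 0) ∧
    laplace f z = Φ z

/-- The function with a given Laplace transform. -/
def original (D : Set ℂ) (Φ : ℂ → ℂ) : ℝ → ℝ :=
  Classical.epsilon (IsOriginal D Φ)

/-- `f` has the defining property of the resolvent `R^s`. -/
def IsResolvent (p : CompoundPoisson) (s : ℝ) (f : ℝ → ℝ) : Prop :=
  IsOriginal {z | p.c s < z.re} (fun z => (p.k z - s)⁻¹) f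

/-- The resolvent (scale function) `R^s`. -/
def R (p : CompoundPoisson) (s : ℝ) : ℝ → ℝ :=
  original {z | p.c s < z.re} (fun z => (p.k z - s)⁻¹)

/-- The transform that defines `K_x^s`. -/
def KTransform (p : Fin 2 → CompoundPoisson) (s x : ℝ) (z : ℂ) : ℂ :=
  ((p 0).k z - s) / ((p 1).k z - s) * laplace (fun u => R (p 0) s (x + u)) z

/-- `f` has the defining property of `K_x^s`. -/
def IsK (p : Fin 2 → CompoundPoisson) (s x : ℝ) (f : ℝ → ℝ) : Prop :=
  IsOriginal {z | max ((p 0).c s) ((p 1).c s) < z.re} (KTransform p s x) f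

/-- The function `u ↦ K_x^s(u)`. -/
def K (p : Fin 2 → CompoundPoisson) (s x : ℝ) : ℝ → ℝ :=
  original {z | max ((p 0).c s) ((p 1).c s) < z.re} (KTransform p s x)

/-- The transform that defines `F_s`; the point `z = c₁(s)` is a removable singularity. -/
def FTransform (p : Fin 2 → CompoundPoisson) (s : ℝ) (z : ℂ) : ℂ :=
  1 / (z - (p 0).c s) * (((p 0).k z - s) / ((p 1).k z - s))

/-- `f` has the defining property of `F_s`. -/
def IsF (p : Fin 2 → CompoundPoisson) (s : ℝ) (f : ℝ → ℝ) : Prop :=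
  IsOriginal {z | (p 1).c s < z.re ∧ z ≠ ((p 0).c s : ℂ)} (FTransform p s) f

/-- The function `u ↦ F_s(u)`. -/
def F (p : Fin 2 → CompoundPoisson) (s : ℝ) : ℝ → ℝ :=
  original {z | (p 1).c s < z.re ∧ z ≠ ((p 0).c s : ℂ)} (FTransform p s)

/-- `C^x(z,s)`. -/
def C (p : CompoundPoisson) (x : ℝ) (z : ℂ) (s : ℝ) : ℂ :=
  if x < 0 then Complex.exp (z * x)
  else Complex.exp (z * x) *
    (1 - (p.k z - s) * ∫ u in (0 : ℝ)..x, Complex.exp (-(u * z)) * R p s u)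

/-- `G` is the (unique) function on `Re z ≥ 0`, continuous there and holomorphic on `Re z > 0`,
that agrees with `Φ` on the half-plane `Re z > σ`. -/
def IsContinuation (σ : ℝ) (Φ G : ℂ → ℂ) : Prop :=
  ContinuousOn G {z | 0 ≤ z.re} ∧ DifferentiableOn ℂ G {z | 0 < z.re} ∧
  ∀ z : ℂ, σ < z.re → G z = Φ z

/-! ### Sample paths -/

/-- The number of arrivals in `[0, t]` for the interarrival times `e 0, e 1, …`. -/
def count (e : ℕ → ℝ) (t : ℝ≥0) : ℕ :=
  Set.ncard {m : ℕ | ∑ j ∈ Finset.range (m + 1), e j ≤ t}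

/-- The path `t ↦ ∑_{j < N(t)} y j - a t`, where `N` counts the arrivals. -/
def path (p : CompoundPoisson) (e y : ℕ → ℝ) (t : ℝ≥0) : ℝ :=
  ∑ j ∈ Finset.range (count e t), y j - p.a * t

/-- The infimum of a set of times, with `inf ∅ = ∞`. -/
def firstTime (A : Set ℝ≥0) : ℝ≥0∞ := ⨅ t ∈ A, (t : ℝ≥0∞)

/-- First time that the path `w` is above the level `y`. -/
def upTime (w : ℝ≥0 → ℝ) (y : ℝ) : ℝ≥0∞ := firstTime {t | y < w t}

/-- First time that the path `w` is at or below the level `y`. -/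
def downTime (w : ℝ≥0 → ℝ) (y : ℝ) : ℝ≥0∞ := firstTime {t | w t ≤ y}

/-- The overshoot over the level `y` (meaningful if `upTime w y < ∞`). -/
def overshoot (w : ℝ≥0 → ℝ) (y : ℝ) : ℝ := w (upTime w y).toNNReal - y

/-- Starting time and starting position of the `n`-th phase of the oscillating path with
switching level `b` and starting point `x`. `w 0 n` and `w 1 n` are the `n`-th copies of the
processes `ξ₁` and `ξ₂`; the `n`-th phase uses the copy of `ξ₁` if it starts at or below `b`
and lasts until `b` is exceeded; otherwise it uses the copy of `ξ₂` and lasts until `b` is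
reached. -/
def phase (b x : ℝ) (w : Fin 2 → ℕ → ℝ≥0 → ℝ) : ℕ → ℝ≥0∞ × ℝ
  | 0 => (0, x)
  | n + 1 =>
    let T := (phase b x w n).1
    let y := (phase b x w n).2
    if y ≤ b then (T + upTime (w 0 n) (b - y), b + overshoot (w 0 n) (b - y))
    else (T + downTime (w 1 n) (-(y - b)), b)

open Classical in
/-- The oscillating path: `phase` glued together. (The value `x` in the last line is used only
if the phases accumulate before `t`, which has probability zero.) -/
def oscPath (b x : ℝ) (w : Fin 2 → ℕ → ℝ≥0 → ℝ) (t : ℝ≥0) : ℝ :=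
  if h : ∃ n, (phase b x w n).1 ≤ t ∧ (t : ℝ≥0∞) < (phase b x w (n + 1)).1 then
    let n := Nat.find h
    let T := (phase b x w n).1.toNNReal
    let y := (phase b x w n).2
    if y ≤ b then y + w 0 n (t - T) else y + w 1 n (t - T)
  else x

/-! ### The random process and its functionals -/

variable {Ω : Type*} [MeasurableSpace Ω]

/-- `e (i, n, j)` and `y (i, n, j)` are the `j`-th interarrival time and the `j`-th jump of the
`n`-th copy of the process number `i`: all of them are independent, the former exponential with
parameter `λ_i`, the latter with the jump law of the process number `i`. -/
structure IsDriver (μ : Measure Ω) (p : Fin 2 → CompoundPoisson)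
    (e y : Fin 2 × ℕ × ℕ → Ω → ℝ) : Prop where
  indep : iIndepFun (Sum.elim e y) μ
  law_e : ∀ i n j, HasLaw (e (i, n, j)) (expMeasure (p i).lam) μ
  law_y : ∀ i n j, HasLaw (y (i, n, j)) (p i).jump μ

/-- The oscillating process `ξ(x, t)`. -/
def xi (p : Fin 2 → CompoundPoisson) (b : ℝ) (e y : Fin 2 × ℕ × ℕ → Ω → ℝ)
    (x : ℝ) (ω : Ω) : ℝ≥0 → ℝ :=
  oscPath b x fun i n => path (p i) (fun j => e (i, n, j) ω) (fun j => y (i, n, j) ω)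

/-- `E[e^{-sτ}; τ < ∞]`. -/
def timeTransform (μ : Measure Ω) (τ : Ω → ℝ≥0∞) (s : ℝ) : ℝ :=
  ∫ ω, {ω | τ ω < ∞}.indicator (fun ω => Real.exp (-(s * (τ ω).toReal))) ω ∂μ

/-- `E[e^{-sτ - zT}; τ < ∞]`. -/
def jointTransform (μ : Measure Ω) (τ : Ω → ℝ≥0∞) (T : Ω → ℝ) (z : ℂ) (s : ℝ) : ℂ :=
  ∫ ω, {ω | τ ω < ∞}.indicator
    (fun ω => Complex.exp (-(s * (τ ω).toReal) - z * T ω)) ω ∂μ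

end Oscillating

end

noncomputable section
namespace Oscillating

/-! ### Laplace transforms on the line -/

/-! Measure positions by `y = b - x`. The drift carries `y` upwards at speed `a` and a jump `W`
moves it to `y - W`, so a discounted expectation `f` satisfies `a f' = (λ + s) f - λ E f(· - W)`,
with the first process for `y ≥ 0` and the second one for `y ≤ 0`. For a single process, data on
`(-∞, 0]` determine the solution on `[0, ∞)`: it is `a f(0) R - λ (src f * R)`, where `src f`
collects the jumps that land below `0` (`vol`, `vol_eq`, `IsHarmonic.first_step`). In this sense `C`
extends the exponential `e^{zy}` (`C_eq`), and `R` extends the data that vanish on `(-∞, 0)` and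
equal `1/a` at `0`.

Passage downwards. Since `k₂(c₂(s)) = s`, the exponential `e^{c₂ y}` is harmonic for the second
process. Its extension across `0` by the first process is `C₁^y(c₂, s)`, which therefore solves both
equations (`down_solves`). It is bounded on `y ≤ b - r`; dividing by its nonzero value at `b - r`
(`down_pos`) gives the answer.

Passage upwards. Put `d = k - b`. The payoff above `k` is `e^{z(d + y)}`, and `C₂^{d+y} - κ R₂(d +
y)` continues it harmonically to `y ≤ 0` for every constant `κ`; the first process then extends this
across `0`. The constant is fixed by boundedness as `y → ∞`. Here the factorization `k(z) - s = (z -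
c)(a - λ ψ̂(z))` enters (`k_sub`): it exhibits `R` as an exponential convolved with the renewal
measure of the ladder law, so that `R` is positive and monotone. It also leads to the sufficient
condition `a (g(0) - ∫ g(-t) lad(dt)) = 0` on the data `g` (`IsHarmonic.bounded`, `integral_lad`).

Evaluating an extension at `y ≥ 0` and testing the ladder condition are both functionals of the form
`func A κ m`. Applied to the shifts of `R₂`, such a functional gives a function whose transform is
the functional of `e^{tz}` divided by `k₂(z) - s` (`lt_tfun`); this is how `K` and `F` arise.
Applied to `C₂^{d+·}` it gives the brackets in the formulas (`func_C`). Solving the ladder condition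
for `κ` yields the claim (`upSol_eq_ext`, `upSol_spec`); it is solvable because `F` is positive
(`F_pos`).

Solutions become expectations through an embedded walk, whose steps end at the next arrival or when
the drift reaches `b` (or `r`). The payoff factorizes along a step (`hitVal_step`), the driver after
the step is fresh and independent of it (`step_preserving`), and the analytic equation is the
one-step equation of the walk (`integral_pairLaw_step`). A weight contracted by the discounted step
(`exists_weight`) forces bounded solutions to be the expectation (`integral_eq_of_step`). This uses
`s > 0`; the case `s = 0` follows by letting `s ↓ 0` on both sides (`tendsto_upSol`, `tendsto_down`,
`integral_hitVal_zero`). -/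

/-- The Laplace transform `∫ e^{-uz} f(u) du` over the whole line. -/
def lt (f : ℝ → ℂ) (z : ℂ) : ℂ := ∫ u : ℝ, Complex.exp (-(u * z)) * f u

lemma norm_cexp_neg_mul (u : ℝ) (z : ℂ) :
    ‖Complex.exp (-(u * z))‖ = Real.exp (-(u * z.re)) := by
  rw [Complex.norm_exp]; simp

/-- A causal, right-continuous, locally bounded function whose Laplace transform converges
absolutely for `Re z > σ`. -/
structure IsOrig (σ : ℝ) (f : ℝ → ℂ) : Prop where
  meas : Measurable f
  zero : ∀ u, u < 0 → f u = 0
  rc : ∀ u, ContinuousWithinAt f (Ici u) u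
  bdd : ∀ U, ∃ B, ∀ u ≤ U, ‖f u‖ ≤ B
  int : ∀ z : ℂ, σ < z.re → Integrable fun u : ℝ => Complex.exp (-(u * z)) * f u

/-- A causal weight `g` with respect to a measure `m`, whose transform converges absolutely
for `Re z > σ`. -/
structure IsWeight (σ : ℝ) (m : Measure ℝ) (g : ℝ → ℂ) : Prop where
  meas : Measurable g
  zero : ∀ᵐ v ∂m, v < 0 → g v = 0
  int : ∀ z : ℂ, σ < z.re → Integrable (fun v : ℝ => Complex.exp (-(v * z)) * g v) m

/-- Convolution of `f` with the weight `g` with respect to `m`. -/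
def cv (m : Measure ℝ) (g f : ℝ → ℂ) (u : ℝ) : ℂ := ∫ v, g v * f (u - v) ∂m

lemma IsOrig.mono {σ σ' : ℝ} {f : ℝ → ℂ} (hf : IsOrig σ f) (h : σ ≤ σ') : IsOrig σ' f :=
  ⟨hf.meas, hf.zero, hf.rc, hf.bdd, fun z hz => hf.int z (h.trans_lt hz)⟩

lemma IsWeight.mono {σ σ' : ℝ} {m : Measure ℝ} {f : ℝ → ℂ} (hf : IsWeight σ m f) (h : σ ≤ σ') :
    IsWeight σ' m f :=
  ⟨hf.meas, hf.zero, fun z hz => hf.int z (h.trans_lt hz)⟩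

lemma IsOrig.weight {σ : ℝ} {f : ℝ → ℂ} (hf : IsOrig σ f) : IsWeight σ volume f :=
  ⟨hf.meas, Eventually.of_forall hf.zero, hf.int⟩

lemma IsOrig.add {σ : ℝ} {f g : ℝ → ℂ} (hf : IsOrig σ f) (hg : IsOrig σ g) :
    IsOrig σ (fun u => f u + g u) where
  meas := hf.meas.add hg.meas
  zero u hu := by simp [hf.zero u hu, hg.zero u hu]
  rc u := (hf.rc u).add (hg.rc u)
  bdd U := by
    obtain ⟨B, hB⟩ := hf.bdd U
    obtain ⟨B', hB'⟩ := hg.bdd U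
    exact ⟨B + B', fun u hu => (norm_add_le _ _).trans (add_le_add (hB u hu) (hB' u hu))⟩
  int z hz := by
    have := (hf.int z hz).add (hg.int z hz)
    refine this.congr (Eventually.of_forall fun u => ?_)
    simp [mul_add]

lemma IsOrig.smul {σ : ℝ} {f : ℝ → ℂ} (hf : IsOrig σ f) (a : ℂ) :
    IsOrig σ (fun u => a * f u) where
  meas := hf.meas.const_mul a
  zero u hu := by simp [hf.zero u hu]
  rc u := continuousWithinAt_const.mul (hf.rc u)
  bdd U := by
    obtain ⟨B, hB⟩ := hf.bdd U
    refine ⟨‖a‖ * B, fun u hu => ?_⟩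
    rw [norm_mul]
    exact mul_le_mul_of_nonneg_left (hB u hu) (norm_nonneg _)
  int z hz := by
    simpa [mul_left_comm] using (hf.int z hz).const_mul a

lemma lt_add {σ : ℝ} {f g : ℝ → ℂ} (hf : IsOrig σ f) (hg : IsOrig σ g) {z : ℂ} (hz : σ < z.re) :
    lt (fun u => f u + g u) z = lt f z + lt g z := by
  simp only [lt, mul_add]
  exact integral_add (hf.int z hz) (hg.int z hz)

lemma lt_smul (a : ℂ) (f : ℝ → ℂ) (z : ℂ) : lt (fun u => a * f u) z = a * lt f z := by
  simp only [lt, mul_left_comm _ a]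
  exact integral_const_mul _ _

lemma IsOrig.sub {σ : ℝ} {f g : ℝ → ℂ} (hf : IsOrig σ f) (hg : IsOrig σ g) :
    IsOrig σ (fun u => f u - g u) := by
  simpa [sub_eq_add_neg] using hf.add (hg.smul (-1))

lemma lt_sub {σ : ℝ} {f g : ℝ → ℂ} (hf : IsOrig σ f) (hg : IsOrig σ g) {z : ℂ} (hz : σ < z.re) :
    lt (fun u => f u - g u) z = lt f z - lt g z := by
  simp only [lt, mul_sub]
  exact integral_sub (hf.int z hz) (hg.int z hz)

/-- The integrand of a convolution is dominated uniformly on half-lines. -/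
lemma cv_bound {σ : ℝ} {m : Measure ℝ} {f g : ℝ → ℂ} (hf : IsOrig σ f) (hg : IsWeight σ m g)
    (U : ℝ) : ∃ bound : ℝ → ℝ, Integrable bound m ∧
      ∀ᵐ v ∂m, ∀ u ≤ U, ‖g v * f (u - v)‖ ≤ bound v := by
  obtain ⟨B, hB⟩ := hf.bdd U
  have hB0 : 0 ≤ B := (norm_nonneg _).trans (hB U le_rfl)
  -- This exponent exceeds `σ` and is positive, so `e^{θU} e^{-θv} ≥ 1` for all `v ≤ U`.
  set θ : ℝ := |σ| + 1
  have hθ : σ < θ := by have := le_abs_self σ; simp only [θ]; linarith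
  have hθ0 : 0 ≤ θ := by positivity
  refine ⟨fun v => B * Real.exp (θ * U) * ‖Complex.exp (-(v * (θ : ℂ))) * g v‖,
    ((hg.int θ (by simpa using hθ)).norm).const_mul _, ?_⟩
  filter_upwards [hg.zero] with v hv u hu
  rw [norm_mul, norm_mul, norm_cexp_neg_mul]
  by_cases h0 : v < 0
  · simp [hv h0]
  by_cases hvU : u < v
  · rw [hf.zero (u - v) (by linarith)]
    simp only [norm_zero, mul_zero]
    positivity
  push Not at h0 hvU
  have h1 : (1 : ℝ) ≤ Real.exp (θ * U) * Real.exp (-(v * θ)) := by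
    rw [← Real.exp_add]
    refine Real.one_le_exp ?_
    nlinarith
  have h2 := hB (u - v) (by linarith)
  simp only [Complex.ofReal_re]
  calc ‖g v‖ * ‖f (u - v)‖ ≤ ‖g v‖ * B := by gcongr
    _ = 1 * (B * ‖g v‖) := by ring
    _ ≤ (Real.exp (θ * U) * Real.exp (-(v * θ))) * (B * ‖g v‖) := by gcongr
    _ = _ := by ring

lemma measurable_cv {m : Measure ℝ} [SFinite m] {f g : ℝ → ℂ} (hf : Measurable f)
    (hg : Measurable g) : Measurable (cv m g f) := by
  refine (StronglyMeasurable.integral_prod_right (f := fun u v => g v * f (u - v)) ?_).measurable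
  apply Measurable.stronglyMeasurable
  simp only [Function.uncurry_def]
  fun_prop

lemma cv_integrable {σ : ℝ} {m : Measure ℝ} {f g : ℝ → ℂ} (hf : IsOrig σ f)
    (hg : IsWeight σ m g) (u : ℝ) : Integrable (fun v => g v * f (u - v)) m := by
  obtain ⟨bound, hb, hle⟩ := cv_bound hf hg u
  have h1 := hf.meas
  have h2 := hg.meas
  refine hb.mono' (by fun_prop) ?_
  filter_upwards [hle] with v hv using hv u le_rfl

/-- The factor `e^{-uz}` is multiplicative in `u`, hence it distributes over a convolution. This
reduces integrability and transforms of `cv` to the general theory of convolutions. -/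
lemma cv_twist (m : Measure ℝ) (g f : ℝ → ℂ) (z : ℂ) :
    (fun u : ℝ => Complex.exp (-(u * z)) * cv m g f u) =
    convolution (fun v : ℝ => Complex.exp (-(v * z)) * g v)
      (fun u : ℝ => Complex.exp (-(u * z)) * f u) (ContinuousLinearMap.mul ℝ ℂ) m := by
  ext u
  simp only [cv, convolution_def, ContinuousLinearMap.mul_apply']
  rw [← integral_const_mul]
  congr 1
  ext v
  have : Complex.exp (-(u * z)) = Complex.exp (-(v * z)) * Complex.exp (-(((u - v : ℝ) : ℂ) * z)) := by
    rw [← Complex.exp_add]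
    congr 1
    push_cast
    ring
  rw [this]
  ring

/-- The domination in `cv_bound` is uniform on half-lines, which gives local boundedness and, by
dominated convergence, right-continuity. The measure is general so that jump laws, renewal measures
and Lebesgue densities are treated alike. -/
lemma IsOrig.cv {σ : ℝ} {m : Measure ℝ} [SFinite m] {f g : ℝ → ℂ} (hf : IsOrig σ f)
    (hg : IsWeight σ m g) : IsOrig σ (cv m g f) where
  meas := measurable_cv hf.meas hg.meas
  zero u hu := by
    have : ∀ᵐ v ∂m, g v * f (u - v) = 0 := by
      filter_upwards [hg.zero] with v hv
      by_cases h : v < 0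
      · simp [hv h]
      · rw [hf.zero _ (by push Not at h; linarith), mul_zero]
    rw [Oscillating.cv, integral_congr_ae this, integral_zero]
  rc u := by
    obtain ⟨bound, hb, hle⟩ := cv_bound hf hg (u + 1)
    have h1 := hf.meas
    have h2 := hg.meas
    refine continuousWithinAt_of_dominated (bound := bound) ?_ ?_ hb ?_
    · exact Eventually.of_forall fun x => by fun_prop
    · have : ∀ᶠ x in 𝓝[≥] u, x ≤ u + 1 :=
        mem_nhdsWithin_of_mem_nhds (Iic_mem_nhds (by linarith))
      filter_upwards [this] with x hx
      filter_upwards [hle] with v hv using hv x hx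
    · refine Eventually.of_forall fun v => ?_
      refine continuousWithinAt_const.mul ?_
      refine (hf.rc (u - v)).comp (f := fun x => x - v) (by fun_prop) ?_
      intro x hx
      simp only [mem_Ici] at hx ⊢
      linarith
  bdd U := by
    obtain ⟨bound, hb, hle⟩ := cv_bound hf hg U
    refine ⟨∫ v, bound v ∂m, fun u hu => norm_integral_le_of_norm_le hb ?_⟩
    filter_upwards [hle] with v hv using hv u hu
  int z hz := by
    rw [cv_twist]
    exact ((hg.int z hz).convolution_integrand (ContinuousLinearMap.mul ℝ ℂ)
      (hf.int z hz)).integral_prod_left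

lemma lt_cv {σ : ℝ} {m : Measure ℝ} [SFinite m] {f g : ℝ → ℂ} (hf : IsOrig σ f)
    (hg : IsWeight σ m g) {z : ℂ} (hz : σ < z.re) :
    lt (cv m g f) z = (∫ v, Complex.exp (-(v * z)) * g v ∂m) * lt f z := by
  rw [lt, cv_twist, integral_convolution _ (hg.int z hz) (hf.int z hz)]
  rfl

/-! ### Uniqueness -/

/-- The positive and negative parts of `D` are densities of finite measures with the same
characteristic function, so these measures coincide. -/
lemma ae_zero_of_fourier_zero_real {D : ℝ → ℝ} (hD : Integrable D)
    (h : ∀ t : ℝ, ∫ u : ℝ, Complex.exp (t * u * Complex.I) * D u = 0) : D =ᵐ[volume] 0 := by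
  have f1 := isFiniteMeasure_withDensity_ofReal hD.2
  have f2 := isFiniteMeasure_withDensity_ofReal hD.neg.2
  have m1 : AEMeasurable (fun u => ENNReal.ofReal (D u)) volume := hD.1.aemeasurable.ennreal_ofReal
  have m2 : AEMeasurable (fun u => ENNReal.ofReal ((-D) u)) volume :=
    hD.neg.1.aemeasurable.ennreal_ofReal
  have key : volume.withDensity (fun u => ENNReal.ofReal (D u)) =
      volume.withDensity (fun u => ENNReal.ofReal ((-D) u)) := by
    apply Measure.ext_of_charFun
    ext t
    rw [charFun_apply_real, charFun_apply_real,
      integral_withDensity_eq_integral_toReal_smul₀ m1 (by simp),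
      integral_withDensity_eq_integral_toReal_smul₀ m2 (by simp), ← sub_eq_zero, ← integral_sub]
    · rw [← h t]
      congr 1
      ext u
      simp only [ENNReal.toReal_ofReal', Pi.neg_apply, Complex.real_smul]
      rw [← sub_mul, ← Complex.ofReal_sub, mul_comm]
      congr 2
      rcases le_total 0 (D u) with h0 | h0
      · rw [max_eq_left h0, max_eq_right (by linarith)]; ring
      · rw [max_eq_right h0, max_eq_left (by linarith)]; ring
    · refine Integrable.smul_bdd (C := 1) ?_ ?_ ?_
      · simp only [ENNReal.toReal_ofReal']
        exact hD.pos_part.ofReal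
      · fun_prop
      · refine Eventually.of_forall fun u => ?_
        rw [← Complex.ofReal_mul, Complex.norm_exp_ofReal_mul_I]
    · refine Integrable.smul_bdd (C := 1) ?_ ?_ ?_
      · simp only [ENNReal.toReal_ofReal']
        exact hD.neg.pos_part.ofReal
      · fun_prop
      · refine Eventually.of_forall fun u => ?_
        rw [← Complex.ofReal_mul, Complex.norm_exp_ofReal_mul_I]
  have hne : ∫⁻ u, ENNReal.ofReal (D u) ≠ ∞ := by
    have := measure_lt_top (volume.withDensity (fun u => ENNReal.ofReal (D u))) univ
    rw [withDensity_apply _ MeasurableSet.univ, Measure.restrict_univ] at this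
    exact this.ne
  filter_upwards [(withDensity_eq_iff m1 m2 hne).1 key] with u hu
  rcases le_total 0 (D u) with h0 | h0
  · rw [Pi.neg_apply, ENNReal.ofReal_of_nonpos (by linarith : -D u ≤ 0),
      ENNReal.ofReal_eq_zero] at hu
    exact le_antisymm hu h0
  · rw [ENNReal.ofReal_of_nonpos h0, eq_comm, ENNReal.ofReal_eq_zero, Pi.neg_apply] at hu
    exact le_antisymm h0 (by simpa using hu)

/-- Conjugating the hypothesis at `-t` shows that the conjugate of `D` has zero transform too; hence
so do the real and imaginary parts. -/
lemma ae_zero_of_fourier_zero {D : ℝ → ℂ} (hD : Integrable D)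
    (h : ∀ t : ℝ, ∫ u : ℝ, Complex.exp (t * u * Complex.I) * D u = 0) : D =ᵐ[volume] 0 := by
  have hint : ∀ t : ℝ, Integrable fun u : ℝ => Complex.exp (t * u * Complex.I) * D u := by
    intro t
    refine hD.bdd_mul (c := 1) (by fun_prop) (Eventually.of_forall fun u => ?_)
    rw [← Complex.ofReal_mul, Complex.norm_exp_ofReal_mul_I]
  have hconj : ∀ t : ℝ, ∫ u : ℝ, Complex.exp (t * u * Complex.I) * (starRingEnd ℂ) (D u) = 0 := by
    intro t
    have := congrArg (starRingEnd ℂ) (h (-t))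
    rw [← integral_conj, map_zero] at this
    rw [← this]
    congr 1
    ext u
    rw [map_mul, ← Complex.exp_conj]
    simp
  have hDc : Integrable fun u => (starRingEnd ℂ) (D u) :=
    (Complex.conjCLE : ℂ →L[ℝ] ℂ).integrable_comp hD
  have hintc : ∀ t : ℝ, Integrable fun u : ℝ =>
      Complex.exp (t * u * Complex.I) * (starRingEnd ℂ) (D u) := by
    intro t
    refine hDc.bdd_mul (c := 1) (by fun_prop) (Eventually.of_forall fun u => ?_)
    rw [← Complex.ofReal_mul, Complex.norm_exp_ofReal_mul_I]
  have hre : (fun u => (D u).re) =ᵐ[volume] 0 := by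
    refine ae_zero_of_fourier_zero_real hD.re fun t => ?_
    have : (∫ u : ℝ, (Complex.exp (t * u * Complex.I) * D u +
        Complex.exp (t * u * Complex.I) * (starRingEnd ℂ) (D u)) / 2) = 0 := by
      rw [integral_div, integral_add (hint t) (hintc t), h t, hconj t]; simp
    rw [← this]
    congr 1
    ext u
    rw [← mul_add, Complex.add_conj]
    push_cast
    ring
  have him : (fun u => (D u).im) =ᵐ[volume] 0 := by
    refine ae_zero_of_fourier_zero_real hD.im fun t => ?_
    have : (∫ u : ℝ, (Complex.exp (t * u * Complex.I) * D u -
        Complex.exp (t * u * Complex.I) * (starRingEnd ℂ) (D u)) / (2 * Complex.I)) = 0 := by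
      rw [integral_div, integral_sub (hint t) (hintc t), h t, hconj t]; simp
    rw [← this]
    congr 1
    ext u
    rw [← mul_sub, Complex.sub_conj]
    push_cast
    field_simp
  filter_upwards [hre, him] with u h1 h2
  exact Complex.ext h1 h2

/-- On the vertical line `Re z = θ` the Laplace transform is the Fourier transform of the function
damped by `e^{-θu}`, so a single line suffices. -/
lemma ae_eq_of_lt_eq {f g : ℝ → ℂ} {θ : ℝ}
    (hf : ∀ z : ℂ, z.re = θ → Integrable fun u : ℝ => Complex.exp (-(u * z)) * f u)
    (hg : ∀ z : ℂ, z.re = θ → Integrable fun u : ℝ => Complex.exp (-(u * z)) * g u)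
    (h : ∀ z : ℂ, z.re = θ → lt f z = lt g z) : f =ᵐ[volume] g := by
  have hθ : ((θ : ℂ)).re = θ := Complex.ofReal_re θ
  have key : (fun u : ℝ => Complex.exp (-(u * (θ : ℂ))) * f u -
      Complex.exp (-(u * (θ : ℂ))) * g u) =ᵐ[volume] 0 := by
    refine ae_zero_of_fourier_zero ((hf θ hθ).sub (hg θ hθ)) fun t => ?_
    have hz : ((θ : ℂ) - t * Complex.I).re = θ := by simp
    have h1 := h _ hz
    rw [lt, lt, ← sub_eq_zero, ← integral_sub (hf _ hz) (hg _ hz)] at h1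
    rw [← h1]
    congr 1
    ext u
    have : Complex.exp (-(u * ((θ : ℂ) - t * Complex.I))) =
        Complex.exp (t * u * Complex.I) * Complex.exp (-(u * (θ : ℂ))) := by
      rw [← Complex.exp_add]; congr 1; ring
    rw [this]
    ring
  filter_upwards [key] with u hu
  simp only [Pi.zero_apply] at hu
  rw [← mul_sub] at hu
  exact sub_eq_zero.1 ((mul_eq_zero.1 hu).resolve_left (Complex.exp_ne_zero _))

/-- If the values differed at `u`, right-continuity would make the functions differ on an interval
`(u, v)` of positive length. -/
lemma eq_of_ae_eq_of_rc {E : Type*} [TopologicalSpace E] [T2Space E] {f g : ℝ → E}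
    (h : f =ᵐ[volume] g) {u : ℝ} (hf : ContinuousWithinAt f (Ici u) u)
    (hg : ContinuousWithinAt g (Ici u) u) : f u = g u := by
  by_contra hne
  have h1 : Tendsto f (𝓝[>] u) (𝓝 (f u)) := hf.mono_left (nhdsWithin_mono _ Ioi_subset_Ici_self)
  have h2 : Tendsto g (𝓝[>] u) (𝓝 (g u)) := hg.mono_left (nhdsWithin_mono _ Ioi_subset_Ici_self)
  have h3 : ∀ᶠ x in 𝓝[>] u, f x ≠ g x := by
    obtain ⟨A, B, hA, hB, hfA, hgB, hd⟩ := t2_separation hne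
    filter_upwards [h1 (hA.mem_nhds hfA), h2 (hB.mem_nhds hgB)] with x hx1 hx2 he
    exact Set.disjoint_left.1 hd hx1 (he ▸ hx2)
  obtain ⟨v, hv, hsub⟩ := mem_nhdsGT_iff_exists_Ioo_subset.1 h3
  have h4 : volume (Ioo u v) = 0 := measure_mono_null hsub h
  rw [Real.volume_Ioo, ENNReal.ofReal_eq_zero] at h4
  exact absurd hv (by simp only [mem_Ioi]; linarith)

/-- This is the tool behind the convolution identities below: each is checked as an algebraic
identity between transforms. -/
lemma IsOrig.ext {σ : ℝ} {f g : ℝ → ℂ} (hf : IsOrig σ f) (hg : IsOrig σ g)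
    (h : ∀ z : ℂ, σ < z.re → lt f z = lt g z) : f = g := by
  have hθ : σ < σ + 1 := by linarith
  have := ae_eq_of_lt_eq (f := f) (g := g) (θ := σ + 1)
    (fun z hz => hf.int z (hz ▸ hθ)) (fun z hz => hg.int z (hz ▸ hθ))
    (fun z hz => h z (hz ▸ hθ))
  ext u
  exact eq_of_ae_eq_of_rc this (hf.rc u) (hg.rc u)

end Oscillating
end

noncomputable section
namespace Oscillating

/-! ### The exponent and its largest root -/

namespace CompoundPoisson

instance (p : CompoundPoisson) : IsProbabilityMeasure p.jump := p.isProb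

variable (p : CompoundPoisson)

lemma ae_jump_pos : ∀ᵐ x ∂p.jump, 0 < x := by
  rw [ae_iff]
  convert p.jump_pos using 2
  ext x
  simp

/-- The Laplace transform of a jump. -/
def phi (z : ℂ) : ℂ := ∫ x, Complex.exp (-(x * z)) ∂p.jump

lemma norm_exp_jump_le {z : ℂ} (hz : 0 ≤ z.re) :
    ∀ᵐ x ∂p.jump, ‖Complex.exp (-((x : ℝ) * z))‖ ≤ 1 := by
  filter_upwards [p.ae_jump_pos] with x hx
  rw [norm_cexp_neg_mul, Real.exp_le_one_iff]
  nlinarith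

lemma integrable_exp_jump {z : ℂ} (hz : 0 ≤ z.re) :
    Integrable (fun x : ℝ => Complex.exp (-(x * z))) p.jump :=
  Integrable.of_bound (by fun_prop) 1 (p.norm_exp_jump_le hz)

lemma k_eq {z : ℂ} (hz : 0 ≤ z.re) : p.k z = p.a * z + p.lam * (p.phi z - 1) := by
  rw [k, phi, integral_sub (p.integrable_exp_jump hz) (integrable_const _)]
  simp

/-- The exponent on the real half-line. -/
def kR (θ : ℝ) : ℝ := p.a * θ + p.lam * ((∫ x, Real.exp (-(x * θ)) ∂p.jump) - 1)

lemma phi_ofReal (θ : ℝ) : p.phi θ = ((∫ x, Real.exp (-(x * θ)) ∂p.jump : ℝ) : ℂ) := by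
  rw [phi, ← integral_complex_ofReal]
  congr 1
  ext x
  push_cast
  rfl

lemma k_ofReal {θ : ℝ} (hθ : 0 ≤ θ) : p.k θ = (p.kR θ : ℂ) := by
  rw [p.k_eq (by simpa using hθ), phi_ofReal, kR]
  push_cast
  ring

lemma kR_zero : p.kR 0 = 0 := by simp [kR]

lemma continuousOn_phi : ContinuousOn p.phi {z | 0 ≤ z.re} := by
  intro z hz
  refine continuousWithinAt_of_dominated (bound := fun _ => 1) ?_ ?_ (integrable_const _) ?_
  · exact Eventually.of_forall fun w => by fun_prop
  · filter_upwards [self_mem_nhdsWithin] with w hw using p.norm_exp_jump_le hw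
  · refine Eventually.of_forall fun x => ?_
    fun_prop

lemma continuousOn_k : ContinuousOn p.k {z | 0 ≤ z.re} := by
  have : ContinuousOn (fun z => p.a * z + p.lam * (p.phi z - 1)) {z : ℂ | 0 ≤ z.re} :=
    (continuous_const.mul continuous_id).continuousOn.add
      (continuousOn_const.mul (p.continuousOn_phi.sub continuousOn_const))
  exact this.congr fun z hz => p.k_eq hz

lemma continuousOn_kR : ContinuousOn p.kR (Ici 0) := by
  have h1 : ContinuousOn (fun θ : ℝ => p.k θ) (Ici 0) :=
    p.continuousOn_k.comp Complex.continuous_ofReal.continuousOn (fun θ hθ => by simpa using hθ)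
  have h2 : ContinuousOn (fun θ : ℝ => (p.k θ).re) (Ici 0) :=
    Complex.continuous_re.comp_continuousOn h1
  exact h2.congr fun θ hθ => by simp only [p.k_ofReal hθ, Complex.ofReal_re]

lemma le_kR (θ : ℝ) : p.a * θ - p.lam ≤ p.kR θ := by
  have : 0 ≤ ∫ x, Real.exp (-(x * θ)) ∂p.jump := integral_nonneg fun x => (Real.exp_pos _).le
  have h2 := p.lam_pos
  rw [kR]
  nlinarith

lemma rootSet_eq (s : ℝ) : {z : ℝ | 0 ≤ z ∧ p.k z = s} = Ici 0 ∩ p.kR ⁻¹' {s} := by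
  ext z
  simp only [mem_ofPred_eq, mem_inter_iff, mem_Ici, mem_preimage, mem_singleton_iff]
  refine and_congr_right fun hz => ?_
  rw [p.k_ofReal hz, Complex.ofReal_inj]

/-- The exponent grows at least linearly by `le_kR`, so the intermediate value theorem applies to
the right of `θ`. -/
lemma exists_root {s θ : ℝ} (hθ : 0 ≤ θ) (h : p.kR θ ≤ s) : ∃ η, θ ≤ η ∧ p.kR η = s := by
  set M := max θ ((s + p.lam) / p.a)
  have hM : s ≤ p.kR M := by
    have h1 := p.le_kR M
    have h2 : (s + p.lam) / p.a ≤ M := le_max_right _ _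
    rw [div_le_iff₀ p.a_pos] at h2
    linarith
  have := intermediate_value_Icc (le_max_left θ ((s + p.lam) / p.a))
    (p.continuousOn_kR.mono (fun x hx => hθ.trans hx.1)) ⟨h, hM⟩
  obtain ⟨η, hη, he⟩ := this
  exact ⟨η, hη.1, he⟩

lemma bddAbove_rootSet (s : ℝ) : BddAbove {z : ℝ | 0 ≤ z ∧ p.k z = s} := by
  rw [rootSet_eq]
  refine ⟨(s + p.lam) / p.a, fun z hz => ?_⟩
  have := p.le_kR z
  have h2 : p.kR z = s := hz.2
  rw [le_div_iff₀ p.a_pos]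
  linarith

lemma c_mem {s : ℝ} (hs : 0 ≤ s) : p.c s ∈ Ici 0 ∩ p.kR ⁻¹' {s} := by
  have hbdd := p.bddAbove_rootSet s
  rw [c]
  rw [rootSet_eq] at hbdd ⊢
  refine IsClosed.csSup_mem ?_ ?_ hbdd
  · exact p.continuousOn_kR.preimage_isClosed_of_isClosed isClosed_Ici isClosed_singleton
  · obtain ⟨η, h1, h2⟩ := p.exists_root le_rfl (p.kR_zero.le.trans hs)
    exact ⟨η, h1, h2⟩

lemma c_nonneg {s : ℝ} (hs : 0 ≤ s) : 0 ≤ p.c s := (p.c_mem hs).1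

lemma kR_c {s : ℝ} (hs : 0 ≤ s) : p.kR (p.c s) = s := (p.c_mem hs).2

lemma k_c {s : ℝ} (hs : 0 ≤ s) : p.k (p.c s) = s := by
  rw [p.k_ofReal (p.c_nonneg hs), p.kR_c hs]

/-- If the exponent were at most `s` beyond `c(s)`, then `exists_root` would produce a root larger
than the largest one. No convexity is needed. -/
lemma lt_kR {s θ : ℝ} (hs : 0 ≤ s) (h : p.c s < θ) : s < p.kR θ := by
  by_contra! hle
  have h0 := p.c_nonneg hs
  obtain ⟨η, h1, h2⟩ := p.exists_root (h0.trans h.le) hle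
  have h3 : η ≤ p.c s := le_csSup (p.bddAbove_rootSet s)
    ⟨(h0.trans h.le).trans h1, by rw [p.k_ofReal ((h0.trans h.le).trans h1), h2]⟩
  linarith

lemma c_pos {s : ℝ} (hs : 0 < s) : 0 < p.c s := by
  refine lt_of_le_of_ne (p.c_nonneg hs.le) fun h => ?_
  have := p.kR_c hs.le
  rw [← h, kR_zero] at this
  exact hs.ne this

/-! ### Contributions of jumps that overshoot -/

/-- `v ↦ E[f(v - W); W > v]` on `v ≥ 0`, for a jump `W`. -/
def src (f : ℝ → ℂ) (v : ℝ) : ℂ :=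
  if 0 ≤ v then ∫ x, (if v < x then f (v - x) else 0) ∂p.jump else 0

variable {p} in
-- Only the values of `f` on the negative half-line enter. The strict inequality `v < x` in `src` is
-- what suits right-continuity: a jump with `x ≤ v` still contributes nothing for larger `v`.
lemma src_isOrig {f : ℝ → ℂ} {B : ℝ} (hf : Measurable f) (hB : ∀ t < 0, ‖f t‖ ≤ B)
    (hrc : ∀ t < 0, ContinuousWithinAt f (Ici t) t) :
    IsOrig 0 (p.src f) ∧ ∀ v, ‖p.src f v‖ ≤ B := by
  have hB0 : 0 ≤ B := (norm_nonneg _).trans (hB (-1) (by norm_num))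
  have hle : ∀ v x, ‖(if v < x then f (v - x) else 0)‖ ≤ B := by
    intro v x
    split_ifs with h
    · exact hB _ (by linarith)
    · simpa using hB0
  have hbd : ∀ v, ‖p.src f v‖ ≤ B := by
    intro v
    rw [src]
    split_ifs
    · simpa using norm_integral_le_of_norm_le (μ := p.jump) (integrable_const B)
        (Eventually.of_forall fun x => hle v x)
    · simpa using hB0
  have hm2 : Measurable (fun q : ℝ × ℝ => if q.1 < q.2 then f (q.1 - q.2) else 0) :=
    Measurable.ite (measurableSet_lt measurable_fst measurable_snd) (by fun_prop) measurable_const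
  have hmeas : Measurable (p.src f) := by
    refine Measurable.ite measurableSet_Ici ?_ measurable_const
    exact (StronglyMeasurable.integral_prod_right
      (f := fun v x => if v < x then f (v - x) else 0) hm2.stronglyMeasurable).measurable
  refine ⟨⟨hmeas, ?_, ?_, fun U => ⟨B, fun u _ => hbd u⟩, ?_⟩, hbd⟩
  · intro u hu
    simp [src, not_le.2 hu]
  · intro v
    rcases lt_or_ge v 0 with hv | hv
    · refine ContinuousAt.continuousWithinAt ?_
      have : p.src f =ᶠ[𝓝 v] fun _ => 0 := by
        filter_upwards [Iio_mem_nhds hv] with u hu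
        simp [src, not_le.2 (mem_Iio.1 hu)]
      exact this.continuousAt
    · have key : ContinuousWithinAt
          (fun v => ∫ x, (if v < x then f (v - x) else 0) ∂p.jump) (Ici v) v := by
        refine continuousWithinAt_of_dominated (bound := fun _ => B) ?_ ?_ (integrable_const _) ?_
        · exact Eventually.of_forall fun w =>
            (hm2.comp (measurable_const.prodMk measurable_id)).aestronglyMeasurable
        · exact Eventually.of_forall fun w => Eventually.of_forall fun x => hle w x
        · refine Eventually.of_forall fun x => ?_
          rcases lt_or_ge v x with h | h
          · have h1 : ContinuousWithinAt (fun w => f (w - x)) (Ici v) v := by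
              refine (hrc (v - x) (by linarith)).comp (f := fun w => w - x) (by fun_prop) ?_
              intro w hw
              simp only [mem_Ici] at hw ⊢
              linarith
            refine h1.congr_of_eventuallyEq ?_ (by simp [h])
            filter_upwards [mem_nhdsWithin_of_mem_nhds (Iio_mem_nhds h)] with w hw
            simp [mem_Iio.1 hw]
          · refine (continuousWithinAt_const (b := (0 : ℂ))).congr (fun w hw => ?_) ?_
            · have : ¬ w < x := not_lt.2 (h.trans hw)
              simp [this]
            · simp [not_lt.2 h]
      refine key.congr (fun w hw => ?_) ?_
      · simp [src, hv.trans hw]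
      · simp [src, hv]
  · intro z hz
    have h1 : Integrable (fun u : ℝ => B * (Ioi (0 : ℝ)).indicator (fun u => Real.exp (-z.re * u)) u) :=
      ((integrable_indicator_iff measurableSet_Ioi).2
        (integrableOn_exp_mul_Ioi (by linarith) 0)).const_mul B
    have h2 : ∀ᵐ u : ℝ, u ≠ 0 := by
      simp [ae_iff]
    refine h1.mono' (by fun_prop) ?_
    filter_upwards [h2] with u hu
    rw [norm_mul, norm_cexp_neg_mul]
    rcases lt_or_gt_of_ne hu with h | h
    · simp [src, not_le.2 h, indicator, not_lt.2 h.le]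
    · rw [indicator_of_mem (mem_Ioi.2 h), mul_comm]
      have : -(u * z.re) = -z.re * u := by ring
      rw [this]
      exact mul_le_mul_of_nonneg_right (hbd u) (Real.exp_pos _).le

/-- `psi z v = E[e^{z(v - W)}; W > v]`. -/
def psi (z : ℂ) : ℝ → ℂ := p.src fun t => Complex.exp (t * z)

variable {p} in
lemma psi_isOrig {z : ℂ} (hz : 0 ≤ z.re) : IsOrig 0 (p.psi z) ∧ ∀ v, ‖p.psi z v‖ ≤ 1 := by
  refine src_isOrig (by fun_prop) (fun t ht => ?_) (fun t _ => by fun_prop)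
  rw [Complex.norm_exp, Real.exp_le_one_iff]
  simp
  nlinarith

/-- The antiderivative is explicit. Multiplying by `w - z` avoids a separate case `w = z`. -/
lemma integral_exp_window (x : ℝ) (z w : ℂ) :
    (w - z) * ∫ u in (0 : ℝ)..x, Complex.exp (-(u * w)) * Complex.exp ((u - x : ℝ) * z) =
      Complex.exp (-(x * z)) - Complex.exp (-(x * w)) := by
  have hd : ∀ u : ℝ, HasDerivAt
      (fun u : ℝ => -(Complex.exp (-(u * w)) * Complex.exp ((u - x : ℝ) * z)))
      ((w - z) * (Complex.exp (-(u * w)) * Complex.exp ((u - x : ℝ) * z))) u := by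
    intro u
    have h0 : HasDerivAt (fun u : ℝ => (u : ℂ)) 1 u := Complex.ofRealCLM.hasDerivAt
    have h1 := (h0.mul_const w).neg.cexp
    have h2 : HasDerivAt (fun u : ℝ => Complex.exp ((u - x : ℝ) * z))
        (Complex.exp ((u - x : ℝ) * z) * z) u := by
      have := ((h0.sub_const (x : ℂ)).mul_const z).cexp
      simpa using this
    have h3 := (h1.mul h2).neg
    refine HasDerivAt.congr_deriv h3 ?_
    simp only [Pi.neg_apply]
    ring
  rw [← intervalIntegral.integral_const_mul,
    intervalIntegral.integral_eq_sub_of_hasDerivAt (fun u _ => hd u)]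
  · simp
    ring
  · exact Continuous.intervalIntegrable (by fun_prop) _ _

/-- The kernel `1_{0 ≤ u < x} e^{-uw} e^{z(u - x)}`. -/
def window (z w : ℂ) (q : ℝ × ℝ) : ℂ := if 0 ≤ q.1 ∧ q.1 < q.2 then
    Complex.exp (-(q.1 * w)) * Complex.exp ((q.1 - q.2 : ℝ) * z) else 0

lemma measurable_window (z w : ℂ) : Measurable (window z w) := by
  refine Measurable.ite ?_ (by fun_prop) measurable_const
  exact (measurableSet_le measurable_const measurable_fst).inter
    (measurableSet_lt measurable_fst measurable_snd)

lemma window_slice (z w : ℂ) (x : ℝ) : (fun u => window z w (u, x)) = (Ico 0 x).indicator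
    (fun u : ℝ => Complex.exp (-(u * w)) * Complex.exp ((u - x : ℝ) * z)) := by
  ext u
  simp only [window, indicator, mem_Ico]

/-- The inner integral in `u` of the absolute value is at most `1 / Re z` or `1 / Re w`, uniformly
in the jump size. Allowing either one to be positive covers the transform at `w = 0`, which is
needed for the mass of the ladder law. -/
lemma integrable_window {z w : ℂ} (hz : 0 ≤ z.re) (hw : 0 ≤ w.re) (h : 0 < z.re ∨ 0 < w.re) :
    Integrable (window z w) (volume.prod p.jump) := by
  set g := window z w with hg'
  have hg : ∀ q, g q = if 0 ≤ q.1 ∧ q.1 < q.2 then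
    Complex.exp (-(q.1 * w)) * Complex.exp ((q.1 - q.2 : ℝ) * z) else 0 := fun q => rfl
  have hgm : Measurable g := measurable_window z w
  have hgx := window_slice z w
  have hgi : ∀ x : ℝ, Integrable fun u => g (u, x) := by
    intro x
    rw [hgx, integrable_indicator_iff measurableSet_Ico]
    refine (Continuous.integrableOn_Icc ?_).mono_set Ico_subset_Icc_self
    fun_prop
  have hnorm : ∀ u x : ℝ, 0 ≤ u → u < x → ‖g (u, x)‖ =
      Real.exp (-(u * w.re)) * Real.exp ((u - x) * z.re) := by
    intro u x h1 h2
    simp only [hg, h1, h2, and_self, if_true]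
    rw [norm_mul, norm_cexp_neg_mul, Complex.norm_exp]
    simp
  have hbound : ∃ K, ∀ x : ℝ, ∫ u, ‖g (u, x)‖ ≤ K := by
    rcases h with h | h
    · refine ⟨1 / z.re, fun x => ?_⟩
      have hi : Integrable (fun u : ℝ => (Iic x).indicator (fun u => Real.exp (z.re * u)) u) :=
        (integrable_indicator_iff measurableSet_Iic).2 (integrableOn_exp_mul_Iic h x)
      have hle : ∀ u, ‖g (u, x)‖ ≤ Real.exp (-x * z.re) *
          (Iic x).indicator (fun u => Real.exp (z.re * u)) u := by
        intro u
        by_cases hu : 0 ≤ u ∧ u < x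
        · rw [hnorm u x hu.1 hu.2, indicator_of_mem (mem_Iic.2 hu.2.le), ← Real.exp_add,
            ← Real.exp_add]
          refine Real.exp_le_exp.2 ?_
          nlinarith
        · simp only [hg, hu, if_false, norm_zero]
          refine mul_nonneg (Real.exp_pos _).le (indicator_nonneg (fun _ _ => (Real.exp_pos _).le) _)
      refine (integral_mono (hgi x).norm (hi.const_mul _) hle).trans ?_
      rw [integral_const_mul, integral_indicator measurableSet_Iic, integral_exp_mul_Iic h,
        mul_div_assoc', ← Real.exp_add]
      ring_nf
      simp
    · refine ⟨1 / w.re, fun x => ?_⟩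
      have hi : Integrable (fun u : ℝ => (Ici 0).indicator (fun u => Real.exp (-w.re * u)) u) :=
        (integrable_indicator_iff measurableSet_Ici).2
          ((integrableOn_exp_mul_Ioi (by linarith) 0).congr_set_ae Ioi_ae_eq_Ici.symm)
      have hle : ∀ u, ‖g (u, x)‖ ≤ (Ici 0).indicator (fun u => Real.exp (-w.re * u)) u := by
        intro u
        by_cases hu : 0 ≤ u ∧ u < x
        · rw [hnorm u x hu.1 hu.2, indicator_of_mem (mem_Ici.2 hu.1), ← Real.exp_add]
          refine Real.exp_le_exp.2 ?_
          nlinarith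
        · simp only [hg, hu, if_false, norm_zero]
          exact indicator_nonneg (fun _ _ => (Real.exp_pos _).le) _
      refine (integral_mono (hgi x).norm hi hle).trans ?_
      rw [integral_indicator measurableSet_Ici, integral_Ici_eq_integral_Ioi,
        integral_exp_mul_Ioi (by linarith)]
      simp
  obtain ⟨K, hK⟩ := hbound
  rw [integrable_prod_iff' hgm.aestronglyMeasurable]
  refine ⟨Eventually.of_forall hgi, ?_⟩
  refine Integrable.of_bound (C := K) ?_ (Eventually.of_forall fun x => ?_)
  · exact (hgm.norm.stronglyMeasurable.integral_prod_left').aestronglyMeasurable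
  · rw [Real.norm_of_nonneg (integral_nonneg fun _ => norm_nonneg _)]
    exact hK x

/-- The transform of `psi z`. -/
lemma lt_psi_aux {z w : ℂ} (hz : 0 ≤ z.re) (hw : 0 ≤ w.re) (h : 0 < z.re ∨ 0 < w.re) :
    Integrable (fun u : ℝ => Complex.exp (-(u * w)) * p.psi z u) ∧
      (w - z) * lt (p.psi z) w = p.phi z - p.phi w := by
  set g := window z w with hg'
  have hg : ∀ q, g q = if 0 ≤ q.1 ∧ q.1 < q.2 then
    Complex.exp (-(q.1 * w)) * Complex.exp ((q.1 - q.2 : ℝ) * z) else 0 := fun q => rfl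
  have hint := p.integrable_window hz hw h
  have hgx := window_slice z w
  have hpsi : ∀ u : ℝ, ∫ x, g (u, x) ∂p.jump = Complex.exp (-(u * w)) * p.psi z u := by
    intro u
    rw [psi, src]
    split_ifs with hu
    · rw [← integral_const_mul]
      congr 1
      ext x
      simp only [hg, hu, true_and]
      split_ifs <;> simp
    · simp [hg, hu]
  refine ⟨?_, ?_⟩
  · have := hint.integral_prod_left
    exact this.congr (Eventually.of_forall hpsi)
  · rw [lt]
    simp only [← hpsi]
    -- After the exchange the integral in `u` is elementary, and it leaves a difference of two
    -- exponentials of the jump.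
    rw [integral_integral_swap (f := fun u x => g (u, x)) hint, ← integral_const_mul, phi, phi,
      ← integral_sub (p.integrable_exp_jump hz) (p.integrable_exp_jump hw)]
    refine integral_congr_ae ?_
    filter_upwards [p.ae_jump_pos] with x hx
    rw [hgx, integral_indicator measurableSet_Ico, integral_Ico_eq_integral_Ioo,
      ← integral_Ioc_eq_integral_Ioo, ← intervalIntegral.integral_of_le hx.le,
      integral_exp_window]

lemma lt_psi {z w : ℂ} (hz : 0 ≤ z.re) (hw : 0 < w.re) :
    (w - z) * lt (p.psi z) w = p.phi z - p.phi w :=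
  (p.lt_psi_aux hz hw.le (Or.inr hw)).2

/-! ### The density of the ladder jumps -/

/-- `h c u = E[e^{c(u - W)}; W > u]`. -/
def h (c u : ℝ) : ℝ := (p.psi c u).re

lemma psi_ofReal (c u : ℝ) : p.psi c u = (p.h c u : ℂ) := by
  rw [h]
  apply Complex.ext
  · simp
  · rw [psi, src]
    split_ifs with hu
    · have : (fun x : ℝ => if u < x then Complex.exp ((u - x : ℝ) * (c : ℂ)) else 0) =
          fun x => ((if u < x then Real.exp ((u - x) * c) else 0 : ℝ) : ℂ) := by
        ext x
        split_ifs <;> simp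
      rw [this, integral_complex_ofReal]
      simp
    · simp

lemma h_eq (c u : ℝ) (hu : 0 ≤ u) :
    p.h c u = ∫ x, (if u < x then Real.exp ((u - x) * c) else 0) ∂p.jump := by
  have : (fun x : ℝ => if u < x then Complex.exp ((u - x : ℝ) * (c : ℂ)) else 0) =
      fun x => ((if u < x then Real.exp ((u - x) * c) else 0 : ℝ) : ℂ) := by
    ext x
    split_ifs <;> simp
  rw [h, psi, src, if_pos hu, this, integral_complex_ofReal, Complex.ofReal_re]

lemma h_neg (c u : ℝ) (hu : u < 0) : p.h c u = 0 := by
  simp [h, psi, src, not_le.2 hu]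

lemma h_nonneg (c u : ℝ) : 0 ≤ p.h c u := by
  rcases lt_or_ge u 0 with hu | hu
  · rw [p.h_neg c u hu]
  · rw [p.h_eq c u hu]
    refine integral_nonneg fun x => ?_
    dsimp only
    split_ifs
    · exact (Real.exp_pos _).le
    · exact le_rfl

lemma measurable_h {c : ℝ} (hc : 0 ≤ c) : Measurable (p.h c) :=
  Complex.measurable_re.comp (psi_isOrig (p := p) (z := (c : ℂ)) (by simpa using hc)).1.meas

lemma norm_exp_mul_h (c : ℝ) (z : ℂ) (u : ℝ) :
    ‖Complex.exp (-(u * z)) * p.psi c u‖ = Real.exp (-(u * z.re)) * p.h c u := by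
  rw [norm_mul, norm_cexp_neg_mul, psi_ofReal, Complex.norm_real,
    Real.norm_of_nonneg (p.h_nonneg c u)]

lemma lt_h_ofReal (c θ : ℝ) :
    lt (p.psi c) θ = ((∫ u, Real.exp (-(u * θ)) * p.h c u : ℝ) : ℂ) := by
  rw [lt, ← integral_complex_ofReal]
  congr 1
  ext u
  rw [psi_ofReal]
  push_cast
  rfl

lemma norm_lt_h_le (c : ℝ) (z : ℂ) :
    ‖lt (p.psi c) z‖ ≤ ∫ u, Real.exp (-(u * z.re)) * p.h c u := by
  rw [lt]
  refine (norm_integral_le_integral_norm _).trans (le_of_eq ?_)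
  simp only [norm_exp_mul_h]

/-- Factorization of the exponent. -/
lemma k_sub {s : ℝ} (hs : 0 ≤ s) {z : ℂ} (hz : 0 ≤ z.re) (h : 0 < p.c s ∨ 0 < z.re) :
    p.k z - s = (z - p.c s) * (p.a - p.lam * lt (p.psi (p.c s)) z) := by
  have hc : 0 ≤ ((p.c s : ℂ)).re := by simpa using p.c_nonneg hs
  have h1 := (p.lt_psi_aux hc hz (by simpa using h)).2
  rw [← p.k_c hs, p.k_eq hz, p.k_eq hc]
  linear_combination p.lam * h1

lemma kR_sub {s θ : ℝ} (hs : 0 ≤ s) (hθ : 0 < θ) :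
    p.kR θ - s = (θ - p.c s) * (p.a - p.lam * ∫ u, Real.exp (-(u * θ)) * p.h (p.c s) u) := by
  have := p.k_sub hs (z := θ) (by simpa using hθ.le) (Or.inr (by simpa using hθ))
  rw [p.k_ofReal hθ.le, lt_h_ofReal] at this
  exact_mod_cast this

/-- To the right of the root, `k - s` and the first factor in `kR_sub` are positive, so the second
factor is positive as well. -/
lemma lam_lt_h_lt {s θ : ℝ} (hs : 0 ≤ s) (hθ : p.c s < θ) :
    p.lam * ∫ u, Real.exp (-(u * θ)) * p.h (p.c s) u < p.a := by
  have h1 := p.kR_sub hs ((p.c_nonneg hs).trans_lt hθ)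
  have h2 := p.lt_kR hs hθ
  have h3 : 0 < (θ - p.c s) * (p.a - p.lam * ∫ u, Real.exp (-(u * θ)) * p.h (p.c s) u) := by
    linarith
  have := (pos_iff_pos_of_mul_pos h3).1 (by linarith)
  linarith

/-- If `c(s) > 0`, the kernel decays exponentially and the transform converges at `0`. If `c(s) =
0`, Fatou's lemma along `θ = 1/(n+1)` transports the bound `a/λ` from `lam_lt_h_lt` to `θ = 0`. -/
lemma lintegral_h_le {s : ℝ} (hs : 0 ≤ s) :
    ∫⁻ u, ENNReal.ofReal (p.h (p.c s) u) ≠ ∞ := by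
  have hc := p.c_nonneg hs
  rcases hc.eq_or_lt with h0 | hpos
  · have hfat := lintegral_liminf_le' (μ := volume) (u := atTop) (f := fun (n : ℕ) u =>
      ENNReal.ofReal (Real.exp (-(u * (1 / ((n : ℝ) + 1)))) * p.h (p.c s) u)) (fun n => by
        have := p.measurable_h hc
        fun_prop)
    have hpt : ∀ u : ℝ, liminf (fun n : ℕ => ENNReal.ofReal
        (Real.exp (-(u * (1 / ((n : ℝ) + 1)))) * p.h (p.c s) u)) atTop =
        ENNReal.ofReal (p.h (p.c s) u) := by
      intro u
      refine Tendsto.liminf_eq (ENNReal.tendsto_ofReal ?_)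
      have h1 : Tendsto (fun n : ℕ => Real.exp (-(u * (1 / ((n : ℝ) + 1)))) * p.h (p.c s) u) atTop
          (𝓝 (Real.exp (-(u * 0)) * p.h (p.c s) u)) :=
        ((Real.continuous_exp.tendsto _).comp
          ((tendsto_one_div_add_atTop_nhds_zero_nat.const_mul u).neg)).mul_const _
      simpa using h1
    simp only [hpt] at hfat
    refine (hfat.trans_lt ?_).ne
    refine lt_of_le_of_lt (b := ENNReal.ofReal (p.a / p.lam)) ?_ ENNReal.ofReal_lt_top
    refine liminf_le_of_le (by isBoundedDefault) fun b hb => ?_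
    obtain ⟨n, hn⟩ := hb.exists
    refine hn.trans ?_
    have hθ : (0 : ℝ) < 1 / ((n : ℝ) + 1) := by positivity
    rw [← ofReal_integral_eq_lintegral_ofReal]
    · refine ENNReal.ofReal_le_ofReal ?_
      rw [le_div_iff₀ p.lam_pos, mul_comm]
      exact (p.lam_lt_h_lt hs (h0 ▸ hθ)).le
    · have := (p.lt_psi_aux (z := p.c s) (w := ((1 / ((n : ℝ) + 1) : ℝ) : ℂ)) (by simpa using hc)
        (by rw [Complex.ofReal_re]; exact hθ.le) (Or.inr (by rw [Complex.ofReal_re]; exact hθ))).1.norm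
      simpa only [norm_exp_mul_h, Complex.ofReal_re] using this
    · exact Eventually.of_forall fun u => mul_nonneg (Real.exp_pos _).le (p.h_nonneg _ _)
  · have := (p.lt_psi_aux (z := p.c s) (w := 0) (by simpa using hc) (by simp)
        (Or.inl (by simpa using hpos))).1.norm
    simp only [norm_exp_mul_h] at this
    simp at this
    rw [← lt_top_iff_ne_top]
    exact (hasFiniteIntegral_iff_ofReal (Eventually.of_forall fun u => p.h_nonneg _ u)).1 this.2

lemma integrable_h {s : ℝ} (hs : 0 ≤ s) : Integrable (p.h (p.c s)) :=
  ⟨(p.measurable_h (p.c_nonneg hs)).aestronglyMeasurable,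
    (hasFiniteIntegral_iff_ofReal (Eventually.of_forall fun u => p.h_nonneg _ u)).2
      (p.lintegral_h_le hs).lt_top⟩

lemma integrable_exp_mul_h {s : ℝ} (hs : 0 ≤ s) {z : ℂ} (hz : 0 ≤ z.re) :
    Integrable (fun u : ℝ => Complex.exp (-(u * z)) * p.psi (p.c s) u) := by
  have hm := (psi_isOrig (p := p) (z := p.c s) (by simpa using p.c_nonneg hs)).1.meas
  refine (p.integrable_h hs).mono' (by fun_prop) (Eventually.of_forall fun u => ?_)
  rw [norm_exp_mul_h]
  rcases lt_or_ge u 0 with hu | hu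
  · simp [p.h_neg _ u hu]
  · refine mul_le_of_le_one_left (p.h_nonneg _ _) (Real.exp_le_one_iff.2 ?_)
    nlinarith

/-- The killing rate of the ladder process: `s / c(s)` if `s > 0`. -/
def q (s : ℝ) : ℝ := p.a - p.lam * ∫ u, p.h (p.c s) u

lemma integral_exp_h_le {s θ : ℝ} (hs : 0 ≤ s) (hθ : 0 ≤ θ) :
    ∫ u, Real.exp (-(u * θ)) * p.h (p.c s) u ≤ ∫ u, p.h (p.c s) u := by
  have := (p.integrable_exp_mul_h hs (z := θ) (by simpa using hθ)).norm
  simp only [norm_exp_mul_h, Complex.ofReal_re] at this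
  refine integral_mono this (p.integrable_h hs) fun u => ?_
  rcases lt_or_ge u 0 with hu | hu
  · simp [p.h_neg _ u hu]
  · refine mul_le_of_le_one_left (p.h_nonneg _ _) (Real.exp_le_one_iff.2 ?_)
    nlinarith

/-- If `c(s) = 0`, this is the limit at `0` of the strict inequality `lam_lt_h_lt`. If `c(s) > 0`,
the factorization at `z = 0` reads `q c = s`. -/
lemma q_nonneg {s : ℝ} (hs : 0 ≤ s) : 0 ≤ p.q s := by
  rw [q, sub_nonneg]
  have hlim : Tendsto (fun n : ℕ => p.lam * ∫ u, Real.exp (-(u * (1 / ((n : ℝ) + 1)))) *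
      p.h (p.c s) u) atTop (𝓝 (p.lam * ∫ u, Real.exp (-(u * 0)) * p.h (p.c s) u)) := by
    refine Tendsto.const_mul _ ?_
    refine tendsto_integral_of_dominated_convergence (p.h (p.c s)) (fun n => ?_)
      (p.integrable_h hs) (fun n => ?_) ?_
    · have := p.measurable_h (p.c_nonneg hs)
      fun_prop
    · refine Eventually.of_forall fun u => ?_
      rw [Real.norm_of_nonneg (mul_nonneg (Real.exp_pos _).le (p.h_nonneg _ _))]
      rcases lt_or_ge u 0 with hu | hu
      · simp [p.h_neg _ u hu]
      · refine mul_le_of_le_one_left (p.h_nonneg _ _) (Real.exp_le_one_iff.2 ?_)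
        have : (0 : ℝ) ≤ 1 / ((n : ℝ) + 1) := by positivity
        nlinarith
    · refine Eventually.of_forall fun u => ?_
      exact ((Real.continuous_exp.tendsto _).comp
          ((tendsto_one_div_add_atTop_nhds_zero_nat.const_mul u).neg)).mul_const _
  simp only [mul_zero, neg_zero, Real.exp_zero, one_mul] at hlim
  rcases (p.c_nonneg hs).eq_or_lt with h0 | hpos
  · refine le_of_tendsto' hlim fun n => ?_
    exact (p.lam_lt_h_lt hs (h0 ▸ (by positivity))).le
  · have h1 := p.k_sub hs (z := ((0 : ℝ) : ℂ)) (by simp) (Or.inl hpos)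
    rw [p.k_ofReal le_rfl, lt_h_ofReal, kR_zero] at h1
    norm_cast at h1
    simp only [mul_zero, neg_zero, Real.exp_zero, one_mul] at h1
    by_contra! hneg
    nlinarith

lemma q_mul_c {s : ℝ} (hs : 0 < s) : p.q s * p.c s = s := by
  have h1 := p.k_sub hs.le (z := ((0 : ℝ) : ℂ)) (by simp) (Or.inl (p.c_pos hs))
  rw [p.k_ofReal le_rfl, lt_h_ofReal, kR_zero] at h1
  norm_cast at h1
  simp only [mul_zero, neg_zero, Real.exp_zero, one_mul] at h1
  rw [q]
  linarith

lemma q_eq {s : ℝ} (hs : 0 < s) : p.q s = s / p.c s := by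
  rw [eq_div_iff (p.c_pos hs).ne', p.q_mul_c hs]

lemma q_pos {s : ℝ} (hs : 0 < s) : 0 < p.q s := by
  rw [p.q_eq hs]
  exact div_pos hs (p.c_pos hs)

/-- The second factor of `kR_sub` is at least `q(s) ≥ 0`, while `θ - c(s)` is not positive. This
takes the place of a convexity argument. -/
lemma kR_le {s θ : ℝ} (hs : 0 ≤ s) (hθ : 0 ≤ θ) (h : θ ≤ p.c s) : p.kR θ ≤ s := by
  rcases hθ.eq_or_lt with h0 | hpos
  · rw [← h0, kR_zero]; exact hs
  · have h1 := p.kR_sub hs hpos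
    have h2 := p.integral_exp_h_le hs hpos.le
    have h3 := p.q_nonneg hs
    have h4 := mul_le_mul_of_nonneg_left h2 p.lam_pos.le
    rw [q] at h3
    nlinarith

/-- The term `λ ψ̂(z)` is bounded in absolute value by its value at `Re z`, which is less than `a`.
-/
lemma factor_ne_zero {s : ℝ} (hs : 0 ≤ s) {z : ℂ} (hz : p.c s < z.re) :
    (p.a : ℂ) - p.lam * lt (p.psi (p.c s)) z ≠ 0 := by
  intro h0
  have h1 := p.norm_lt_h_le (p.c s) z
  have h2 := p.lam_lt_h_lt hs hz
  have h3 : (p.a : ℂ) = p.lam * lt (p.psi (p.c s)) z := sub_eq_zero.1 h0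
  have h4 := congrArg norm h3
  rw [norm_mul, Complex.norm_real, Complex.norm_real, Real.norm_of_nonneg p.a_pos.le,
    Real.norm_of_nonneg p.lam_pos.le] at h4
  have := p.lam_pos
  nlinarith

lemma k_sub_ne_zero {s : ℝ} (hs : 0 ≤ s) {z : ℂ} (hz : p.c s < z.re) : p.k z - s ≠ 0 := by
  have h0 : 0 < z.re := (p.c_nonneg hs).trans_lt hz
  rw [p.k_sub hs h0.le (Or.inr h0)]
  refine mul_ne_zero (fun h => ?_) (p.factor_ne_zero hs hz)
  have := congrArg Complex.re h
  simp at this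
  linarith

/-- By the factorization a root other than `c(s)` would make the second factor vanish, but its
modulus is at least `q(s) > 0` for `s > 0`. -/
lemma root_iff {s : ℝ} (hs : 0 < s) {z : ℂ} (hz : 0 < z.re) : p.k z = s ↔ z = p.c s := by
  refine ⟨fun h => ?_, fun h => by rw [h, p.k_c hs.le]⟩
  have h1 := p.k_sub hs.le hz.le (Or.inr hz)
  rw [h, sub_self, eq_comm, mul_eq_zero] at h1
  rcases h1 with h1 | h1
  · exact sub_eq_zero.1 h1
  · exfalso
    have h2 := p.norm_lt_h_le (p.c s) z
    have h3 := p.integral_exp_h_le hs.le hz.le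
    have h4 := p.q_pos hs
    rw [q] at h4
    have h5 := congrArg norm (sub_eq_zero.1 h1)
    rw [norm_mul, Complex.norm_real, Complex.norm_real, Real.norm_of_nonneg p.a_pos.le,
      Real.norm_of_nonneg p.lam_pos.le] at h5
    have := p.lam_pos
    nlinarith

lemma c_mono {s t : ℝ} (hs : 0 ≤ s) (hst : s ≤ t) : p.c s ≤ p.c t := by
  by_contra! h
  have h1 := p.kR_le hs (p.c_nonneg (hs.trans hst)) h.le
  rw [p.kR_c (hs.trans hst)] at h1
  have : s = t := le_antisymm hst h1
  rw [this] at h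
  exact lt_irrefl _ h

/-- Monotonicity of `c` bounds it from below by `c(0)`. From above, any `a' > c(0)` has exponent
strictly positive, hence larger than `s` for small `s`, which places `c(s)` to its left. -/
lemma tendsto_c : Tendsto p.c (𝓝[>] 0) (𝓝 (p.c 0)) := by
  rw [tendsto_order]
  constructor
  · intro a' ha
    filter_upwards [self_mem_nhdsWithin] with s hs
    exact ha.trans_le (p.c_mono le_rfl (mem_Ioi.1 hs).le)
  · intro a' ha
    have h1 := p.lt_kR le_rfl ha
    filter_upwards [self_mem_nhdsWithin, mem_nhdsWithin_of_mem_nhds (Iio_mem_nhds h1)] with s hs hs'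
    by_contra! hle
    have := p.kR_le (mem_Ioi.1 hs).le ((p.c_nonneg le_rfl).trans ha.le) hle
    exact absurd hs' (by simp only [mem_Iio]; linarith)

lemma h_antitone {c c' : ℝ} (hc : 0 ≤ c) (hcc : c ≤ c') (u : ℝ) : p.h c' u ≤ p.h c u := by
  rcases lt_or_ge u 0 with hu | hu
  · rw [p.h_neg _ u hu, p.h_neg _ u hu]
  · rw [p.h_eq _ u hu, p.h_eq _ u hu]
    have hi : ∀ c : ℝ, 0 ≤ c →
        Integrable (fun x => if u < x then Real.exp ((u - x) * c) else 0) p.jump := by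
      intro c hc
      refine Integrable.of_bound (C := 1) ?_ (Eventually.of_forall fun x => ?_)
      · exact (Measurable.ite measurableSet_Ioi (by fun_prop) measurable_const).aestronglyMeasurable
      · split_ifs with hx
        · rw [Real.norm_of_nonneg (Real.exp_pos _).le, Real.exp_le_one_iff]
          nlinarith
        · simp
    refine integral_mono (hi _ (hc.trans hcc)) (hi _ hc) fun x => ?_
    dsimp only
    split_ifs with hx
    · refine Real.exp_le_exp.2 ?_
      nlinarith
    · exact le_rfl

lemma tendsto_psi_c (u : ℝ) :
    Tendsto (fun s => p.psi (p.c s) u) (𝓝[>] 0) (𝓝 (p.psi (p.c 0) u)) := by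
  simp only [psi, src]
  split_ifs with hu
  · refine tendsto_integral_filter_of_dominated_convergence (fun _ => 1) ?_ ?_
      (integrable_const _) ?_
    · refine Eventually.of_forall fun s => Measurable.aestronglyMeasurable ?_
      exact Measurable.ite measurableSet_Ioi (by fun_prop) measurable_const
    · filter_upwards [self_mem_nhdsWithin] with s hs
      refine Eventually.of_forall fun x => ?_
      have := p.c_nonneg (mem_Ioi.1 hs).le
      split_ifs with hx
      · rw [Complex.norm_exp, Real.exp_le_one_iff]
        simp
        nlinarith
      · simp
    · refine Eventually.of_forall fun x => ?_
      split_ifs with hx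
      · refine (Complex.continuous_exp.tendsto _).comp (Tendsto.const_mul _ ?_)
        exact (Complex.continuous_ofReal.tendsto _).comp p.tendsto_c
      · exact tendsto_const_nhds
  · exact tendsto_const_nhds

/-- The kernel decreases in `c`, and `c` increases in `s`, so the integrable kernel for `s = 0`
dominates all others. -/
lemma tendsto_lt_psi_c {z : ℂ} (hz : 0 ≤ z.re) :
    Tendsto (fun s => lt (p.psi (p.c s)) z) (𝓝[>] 0) (𝓝 (lt (p.psi (p.c 0)) z)) := by
  refine tendsto_integral_filter_of_dominated_convergence (p.h (p.c 0)) ?_ ?_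
    (p.integrable_h le_rfl) ?_
  · filter_upwards [self_mem_nhdsWithin] with s hs
    exact (p.integrable_exp_mul_h (mem_Ioi.1 hs).le hz).1
  · filter_upwards [self_mem_nhdsWithin] with s hs
    refine Eventually.of_forall fun u => ?_
    rw [norm_exp_mul_h]
    rcases lt_or_ge u 0 with hu | hu
    · simp [p.h_neg _ u hu]
    · refine (mul_le_of_le_one_left (p.h_nonneg _ _) (Real.exp_le_one_iff.2 ?_)).trans
        (p.h_antitone (p.c_nonneg le_rfl) (p.c_mono le_rfl (mem_Ioi.1 hs).le) u)
      nlinarith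
  · exact Eventually.of_forall fun u => (p.tendsto_psi_c u).const_mul _

lemma q_eq_lt (s : ℝ) : (p.q s : ℂ) = p.a - p.lam * lt (p.psi (p.c s)) 0 := by
  have := p.lt_h_ofReal (p.c s) 0
  simp only [mul_zero, neg_zero, Real.exp_zero, one_mul, Complex.ofReal_zero] at this
  rw [this, q]
  push_cast
  ring

/-- Together with `q_eq` this shows that `s / c(s)` has the limit `q 0`. -/
lemma tendsto_q : Tendsto p.q (𝓝[>] 0) (𝓝 (p.q 0)) := by
  have h1 : Tendsto (fun s => (p.q s : ℂ)) (𝓝[>] 0) (𝓝 (p.q 0 : ℂ)) := by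
    simp only [q_eq_lt]
    exact tendsto_const_nhds.sub ((p.tendsto_lt_psi_c (by simp)).const_mul _)
  exact_mod_cast (Complex.continuous_re.tendsto _).comp h1

end CompoundPoisson
end Oscillating
end

noncomputable section
namespace Oscillating

/-! ### Originals -/

lemma laplace_eq_lt {f : ℝ → ℝ} (hf : ∀ u, u < 0 → f u = 0) (z : ℂ) :
    laplace f z = lt (fun u => (f u : ℂ)) z := by
  rw [laplace, lt, ← integral_Ici_eq_integral_Ioi]
  refine setIntegral_eq_integral_of_forall_compl_eq_zero fun u hu => ?_
  rw [hf u (by simpa using hu)]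
  simp

lemma integrable_iff_Ioi {f : ℝ → ℝ} (hf : ∀ u, u < 0 → f u = 0) (z : ℂ) :
    IntegrableOn (fun u : ℝ => Complex.exp (-(u * z)) * f u) (Ioi 0) ↔
      Integrable fun u : ℝ => Complex.exp (-(u * z)) * f u := by
  rw [← integrableOn_Ici_iff_integrableOn_Ioi]
  refine integrableOn_iff_integrable_of_support_subset fun u hu => ?_
  by_contra hlt
  rw [Function.mem_support, hf u (by simpa using hlt)] at hu
  simp at hu

lemma IsOrig.isOriginal {σ : ℝ} {f : ℝ → ℝ} {D : Set ℂ} {Φ : ℂ → ℂ}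
    (hf : IsOrig σ fun u => (f u : ℂ)) (hD : ∀ z ∈ D, σ < z.re)
    (hΦ : ∀ z ∈ D, lt (fun u => (f u : ℂ)) z = Φ z) : IsOriginal D Φ f := by
  have h0 : ∀ u, u < 0 → f u = 0 := fun u hu => by exact_mod_cast hf.zero u hu
  refine ⟨h0, fun u _ => ?_, fun z hz => ⟨?_, ?_⟩⟩
  · have := Complex.continuous_re.continuousAt.comp_continuousWithinAt (hf.rc u)
    exact this
  · rw [integrable_iff_Ioi h0]
    exact hf.int z (hD z hz)
  · rw [laplace_eq_lt h0, hΦ z hz]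

/-- The domain is only required to contain some half-plane, since that of `F` omits the removable
point `c₁(s)`. -/
lemma IsOriginal.unique {D : Set ℂ} {Φ : ℂ → ℂ} {θ : ℝ} (hD : ∀ z : ℂ, θ < z.re → z ∈ D)
    {f g : ℝ → ℝ} (hf : IsOriginal D Φ f) (hg : IsOriginal D Φ g) : f = g := by
  have hθ : θ < θ + 1 := by linarith
  have hz : ∀ z : ℂ, z.re = θ + 1 → z ∈ D := fun z h => hD z (h ▸ hθ)
  have key := ae_eq_of_lt_eq (f := fun u => (f u : ℂ)) (g := fun u => (g u : ℂ)) (θ := θ + 1)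
    (fun z h => (integrable_iff_Ioi hf.1 z).1 (hf.2.2 z (hz z h)).1)
    (fun z h => (integrable_iff_Ioi hg.1 z).1 (hg.2.2 z (hz z h)).1)
    (fun z h => by
      rw [← laplace_eq_lt hf.1, ← laplace_eq_lt hg.1, (hf.2.2 z (hz z h)).2,
        (hg.2.2 z (hz z h)).2])
  have key' : f =ᵐ[volume] g := by
    filter_upwards [key] with u hu using by exact_mod_cast hu
  ext u
  rcases lt_or_ge u 0 with hu | hu
  · rw [hf.1 u hu, hg.1 u hu]
  · exact eq_of_ae_eq_of_rc key' (hf.2.1 u hu) (hg.2.1 u hu)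

lemma IsOriginal.existsUnique {D : Set ℂ} {Φ : ℂ → ℂ} {θ : ℝ} (hD : ∀ z : ℂ, θ < z.re → z ∈ D)
    {f : ℝ → ℝ} (hf : IsOriginal D Φ f) : ∃! f, IsOriginal D Φ f :=
  ⟨f, hf, fun _ hg => hg.unique hD hf⟩

lemma IsOriginal.original_eq {D : Set ℂ} {Φ : ℂ → ℂ} {θ : ℝ} (hD : ∀ z : ℂ, θ < z.re → z ∈ D)
    {f : ℝ → ℝ} (hf : IsOriginal D Φ f) : original D Φ = f :=
  (Classical.epsilon_spec (p := IsOriginal D Φ) ⟨f, hf⟩).unique hD hf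

/-! ### Causal exponentials -/

/-- `u ↦ e^{zu}` on `u ≥ 0`. -/
def ez (z : ℂ) (u : ℝ) : ℂ := if 0 ≤ u then Complex.exp (z * u) else 0

lemma ez_isOrig (z : ℂ) : IsOrig z.re (ez z) where
  meas := Measurable.ite measurableSet_Ici (by fun_prop) measurable_const
  zero u hu := by simp [ez, not_le.2 hu]
  rc u := by
    rcases lt_or_ge u 0 with hu | hu
    · have : ez z =ᶠ[𝓝 u] fun _ => 0 := by
        filter_upwards [Iio_mem_nhds hu] with v hv
        simp [ez, not_le.2 (mem_Iio.1 hv)]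
      exact this.continuousAt.continuousWithinAt
    · have : ContinuousWithinAt (fun v : ℝ => Complex.exp (z * v)) (Ici u) u := by fun_prop
      exact this.congr (fun v hv => by simp [ez, hu.trans hv]) (by simp [ez, hu])
  bdd U := by
    refine ⟨Real.exp (|z.re| * |U|), fun u hu => ?_⟩
    rw [ez]
    split_ifs with h
    · rw [Complex.norm_exp]
      refine Real.exp_le_exp.2 ?_
      simp only [Complex.mul_re, Complex.ofReal_re, Complex.ofReal_im, mul_zero, sub_zero]
      calc z.re * u ≤ |z.re| * u := by gcongr; exact le_abs_self _
        _ ≤ |z.re| * |U| := by gcongr; exact hu.trans (le_abs_self _)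
    · simpa using (Real.exp_pos _).le
  int w hw := by
    have h1 : IntegrableOn (fun u : ℝ => Complex.exp (-(w - z) * u)) (Ici 0) :=
      (integrableOn_exp_mul_complex_Ioi (by simpa using hw) 0).congr_set_ae Ioi_ae_eq_Ici.symm
    refine ((integrable_indicator_iff measurableSet_Ici).2 h1).congr
      (Eventually.of_forall fun u => ?_)
    simp only [ez, indicator, mem_Ici]
    split_ifs
    · rw [← Complex.exp_add]
      congr 1
      ring
    · simp

lemma lt_ez {z w : ℂ} (h : z.re < w.re) : lt (ez z) w = 1 / (w - z) := by
  have : (fun u : ℝ => Complex.exp (-(u * w)) * ez z u) =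
      (Ici (0 : ℝ)).indicator fun u : ℝ => Complex.exp (-(w - z) * u) := by
    ext u
    simp only [ez, indicator, mem_Ici]
    split_ifs
    · rw [← Complex.exp_add]
      congr 1
      ring
    · simp
  rw [lt, this, integral_indicator measurableSet_Ici, integral_Ici_eq_integral_Ioi,
    integral_exp_mul_complex_Ioi (by simpa using h)]
  have hne : w - z ≠ 0 := fun h0 => by
    have := congrArg Complex.re h0
    simp at this
    linarith
  simp only [Complex.ofReal_zero, mul_zero, Complex.exp_zero, neg_sub]
  rw [← neg_sub w z, neg_div_neg_eq]

/-- The convolution of two causal functions is an integral over a compact interval. -/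
lemma cv_volume_eq {f g : ℝ → ℂ} (hf : ∀ u, u < 0 → f u = 0) (hg : ∀ u, u < 0 → g u = 0)
    {y : ℝ} (hy : 0 ≤ y) : cv volume g f y = ∫ v in (0 : ℝ)..y, g v * f (y - v) := by
  rw [cv, intervalIntegral.integral_of_le hy, ← integral_Icc_eq_integral_Ioc]
  refine (setIntegral_eq_integral_of_forall_compl_eq_zero fun v hv => ?_).symm
  rw [mem_Icc, not_and_or, not_le, not_le] at hv
  rcases hv with hv | hv
  · simp [hg v hv]
  · simp [hf (y - v) (by linarith)]

lemma cv_step {f : ℝ → ℂ} (hf : ∀ u, u < 0 → f u = 0) {y : ℝ} (hy : 0 ≤ y) :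
    cv volume f (ez 0) y = ∫ v in (0 : ℝ)..y, f v := by
  rw [cv_volume_eq (ez_isOrig 0).zero hf hy]
  refine intervalIntegral.integral_congr fun v hv => ?_
  rw [uIcc_of_le hy] at hv
  simp [ez, hv.2]

namespace CompoundPoisson
variable (p : CompoundPoisson)

/-! ### The ladder renewal measure -/

/-- The (defective) law of the ladder jumps. -/
def lad (s : ℝ) : Measure ℝ :=
  volume.withDensity fun u => ENNReal.ofReal (p.lam / p.a * p.h (p.c s) u)

/-- Convolution powers of the ladder law. -/
def lpow (s : ℝ) : ℕ → Measure ℝ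
  | 0 => Measure.dirac 0
  | n + 1 => (lpow s n).conv (p.lad s)

/-- The renewal measure of the ladder process. -/
def ren (s : ℝ) : Measure ℝ := Measure.sum (p.lpow s)

variable {p} {s : ℝ}

lemma finite_lad (hs : 0 ≤ s) : IsFiniteMeasure (p.lad s) :=
  isFiniteMeasure_withDensity_ofReal ((p.integrable_h hs).const_mul _).2

lemma finite_lpow (hs : 0 ≤ s) (n : ℕ) : IsFiniteMeasure (p.lpow s n) := by
  have := finite_lad (p := p) hs
  induction n with
  | zero => rw [lpow]; infer_instance
  | succ n ih => rw [lpow]; infer_instance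

lemma sfinite_ren (hs : 0 ≤ s) : SFinite (p.ren s) := by
  have := finite_lpow (p := p) hs
  rw [ren]
  infer_instance

lemma ae_lad_nonneg (hs : 0 ≤ s) : ∀ᵐ v ∂(p.lad s), 0 ≤ v := by
  have hm := p.measurable_h (p.c_nonneg hs)
  rw [lad, ae_withDensity_iff (by fun_prop)]
  refine Eventually.of_forall fun u hu => ?_
  by_contra hlt
  rw [p.h_neg _ u (not_le.1 hlt)] at hu
  simp at hu

lemma ae_lpow_nonneg (hs : 0 ≤ s) (n : ℕ) : ∀ᵐ v ∂(p.lpow s n), 0 ≤ v := by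
  have h1 := finite_lad (p := p) hs
  have h2 := finite_lpow (p := p) hs
  induction n with
  | zero =>
    rw [lpow, ae_dirac_iff measurableSet_Ici]
  | succ n ih =>
    rw [lpow, Measure.conv, ae_map_iff (by fun_prop) measurableSet_Ici]
    filter_upwards [Measure.quasiMeasurePreserving_fst.ae ih,
      Measure.quasiMeasurePreserving_snd.ae (ae_lad_nonneg hs)] with x hx1 hx2
    exact add_nonneg hx1 hx2

lemma ae_ren_nonneg (hs : 0 ≤ s) : ∀ᵐ v ∂(p.ren s), 0 ≤ v := by
  rw [ren, Measure.ae_sum_iff' measurableSet_Ici]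
  exact ae_lpow_nonneg hs

lemma integrable_exp_lpow (hs : 0 ≤ s) {z : ℂ} (hz : 0 ≤ z.re) (n : ℕ) :
    Integrable (fun v : ℝ => Complex.exp (-(v * z))) (p.lpow s n) := by
  have h2 := finite_lpow (p := p) hs n
  refine Integrable.of_bound (C := 1) (by fun_prop) ?_
  filter_upwards [ae_lpow_nonneg hs n] with v hv
  rw [norm_cexp_neg_mul, Real.exp_le_one_iff]
  nlinarith

lemma integral_exp_lad (hs : 0 ≤ s) (z : ℂ) :
    ∫ v : ℝ, Complex.exp (-(v * z)) ∂(p.lad s) = p.lam / p.a * lt (p.psi (p.c s)) z := by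
  have hm := p.measurable_h (p.c_nonneg hs)
  rw [lad, integral_withDensity_eq_integral_toReal_smul (by fun_prop)
    (Eventually.of_forall fun _ => ENNReal.ofReal_lt_top), lt, ← integral_const_mul]
  congr 1
  ext u
  rw [ENNReal.toReal_ofReal (mul_nonneg (div_pos p.lam_pos p.a_pos).le (p.h_nonneg _ _)),
    psi_ofReal, Complex.real_smul]
  push_cast
  ring

lemma integral_exp_lpow (hs : 0 ≤ s) {z : ℂ} (hz : 0 ≤ z.re) (n : ℕ) :
    ∫ v : ℝ, Complex.exp (-(v * z)) ∂(p.lpow s n) =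
      (p.lam / p.a * lt (p.psi (p.c s)) z) ^ n := by
  have h1 := finite_lad (p := p) hs
  have h2 := finite_lpow (p := p) hs
  induction n with
  | zero => simp [lpow]
  | succ n ih =>
    have hi := integrable_exp_lpow (p := p) hs hz (n + 1)
    rw [lpow] at hi ⊢
    rw [integral_conv hi, pow_succ, ← ih, ← integral_exp_lad hs, ← integral_mul_const]
    congr 1
    ext x
    rw [← integral_const_mul]
    congr 1
    ext y
    rw [← Complex.exp_add]
    congr 1
    push_cast
    ring

lemma integral_norm_exp_lpow (hs : 0 ≤ s) {z : ℂ} (hz : 0 ≤ z.re) (n : ℕ) :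
    ∫ v : ℝ, ‖Complex.exp (-(v * z))‖ ∂(p.lpow s n) =
      (p.lam / p.a * ∫ u, Real.exp (-(u * z.re)) * p.h (p.c s) u) ^ n := by
  have h1 := integral_exp_lpow (p := p) hs (z := ((z.re : ℝ) : ℂ)) (by simpa using hz) n
  rw [lt_h_ofReal] at h1
  have h2 : ∀ v : ℝ, Complex.exp (-(v * ((z.re : ℝ) : ℂ))) = ((‖Complex.exp (-(v * z))‖ : ℝ) : ℂ) := by
    intro v
    rw [norm_cexp_neg_mul]
    push_cast
    rfl
  simp only [h2] at h1
  rw [integral_complex_ofReal] at h1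
  exact_mod_cast h1

/-- The transforms of the convolution powers are powers of the ladder transform, so the renewal
transform is a geometric series. The hypothesis says that its ratio is less than one in absolute
value. -/
lemma ren_transform (hs : 0 ≤ s) {z : ℂ} (hz : 0 ≤ z.re)
    (h : p.lam * ∫ u, Real.exp (-(u * z.re)) * p.h (p.c s) u < p.a) :
    Integrable (fun v : ℝ => Complex.exp (-(v * z))) (p.ren s) ∧
      (p.a - p.lam * lt (p.psi (p.c s)) z) * ∫ v : ℝ, Complex.exp (-(v * z)) ∂(p.ren s) = p.a := by
  have ha := p.a_pos
  have hr0 : 0 ≤ p.lam / p.a * ∫ u, Real.exp (-(u * z.re)) * p.h (p.c s) u :=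
    mul_nonneg (div_pos p.lam_pos p.a_pos).le
      (integral_nonneg fun u => mul_nonneg (Real.exp_pos _).le (p.h_nonneg _ _))
  have hr1 : p.lam / p.a * ∫ u, Real.exp (-(u * z.re)) * p.h (p.c s) u < 1 := by
    rw [div_mul_eq_mul_div, div_lt_one ha]
    exact h
  have hi : Integrable (fun v : ℝ => Complex.exp (-(v * z))) (p.ren s) := by
    refine integrable_sum_measure (integrable_exp_lpow hs hz) ?_
    simp only [integral_norm_exp_lpow hs hz]
    exact summable_geometric_of_lt_one hr0 hr1
  refine ⟨hi, ?_⟩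
  have hsum := hasSum_integral_measure hi
  simp only [integral_exp_lpow hs hz] at hsum
  have hn : ‖(p.lam / p.a * lt (p.psi (p.c s)) z : ℂ)‖ < 1 := by
    refine lt_of_le_of_lt ?_ hr1
    rw [norm_mul, norm_div, Complex.norm_real, Complex.norm_real,
      Real.norm_of_nonneg p.a_pos.le, Real.norm_of_nonneg p.lam_pos.le]
    exact mul_le_mul_of_nonneg_left (p.norm_lt_h_le _ z) (div_pos p.lam_pos p.a_pos).le
  have hg := hasSum_geometric_of_norm_lt_one hn
  have ha' : (p.a : ℂ) ≠ 0 := by exact_mod_cast ha.ne'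
  have hne : (1 : ℂ) - p.lam / p.a * lt (p.psi (p.c s)) z ≠ 0 := by
    intro h0
    rw [← sub_eq_zero.1 h0, norm_one] at hn
    exact lt_irrefl _ hn
  rw [ren, hsum.unique hg]
  have : (p.a : ℂ) - p.lam * lt (p.psi (p.c s)) z =
      p.a * (1 - p.lam / p.a * lt (p.psi (p.c s)) z) := by
    field_simp
  rw [this, mul_assoc, mul_inv_cancel₀ hne, mul_one]

lemma ren_isWeight (hs : 0 ≤ s) : IsWeight (p.c s) (p.ren s) fun _ => 1 where
  meas := measurable_const
  zero := by
    filter_upwards [ae_ren_nonneg hs] with v hv h using absurd hv (not_le.2 h)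
  int z hz := by
    simpa using (ren_transform hs ((p.c_nonneg hs).trans hz.le) (p.lam_lt_h_lt hs hz)).1

/-- For `s > 0` the killing rate is positive, so the ladder law has mass less than one and the
geometric series converges at `z = 0`. -/
lemma finite_ren (hs : 0 < s) : IsFiniteMeasure (p.ren s) := by
  have h := (ren_transform (p := p) hs.le (z := 0) (by simp) (by
    have := p.q_pos hs
    rw [q] at this
    simpa using this)).1
  simp only [mul_zero, neg_zero, Complex.exp_zero] at h
  exact (integrable_const_iff.1 h).resolve_left one_ne_zero

/-! ### The resolvent -/

variable (p s) in
/-- The resolvent, from the renewal measure. -/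
def res (u : ℝ) : ℝ :=
  1 / p.a * ∫ v, (if v ≤ u then Real.exp (p.c s * (u - v)) else 0) ∂(p.ren s)

lemma res_eq (u : ℝ) :
    (p.res s u : ℂ) = 1 / p.a * cv (p.ren s) (fun _ => 1) (ez (p.c s)) u := by
  rw [res, cv, Complex.ofReal_mul, ← integral_complex_ofReal]
  push_cast
  congr 2
  ext v
  simp only [ez, sub_nonneg, one_mul]
  split_ifs <;> simp

lemma res_isOrig (hs : 0 ≤ s) : IsOrig (p.c s) fun u => (p.res s u : ℂ) := by
  have := sfinite_ren (p := p) hs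
  simp only [res_eq]
  have h1 := ez_isOrig (p.c s : ℂ)
  rw [Complex.ofReal_re] at h1
  exact (h1.cv (ren_isWeight hs)).smul _

/-- In the factorization of `k - s`, the factor `1/(z - c)` is the transform of `e^{cu}` and `a/(a -
λ ψ̂)` is that of the renewal measure. This form makes the sign and the monotonicity of the
resolvent evident. -/
lemma lt_res (hs : 0 ≤ s) {z : ℂ} (hz : p.c s < z.re) :
    lt (fun u => (p.res s u : ℂ)) z = (p.k z - s)⁻¹ := by
  have := sfinite_ren (p := p) hs
  simp only [res_eq]
  have h1 := ez_isOrig (p.c s : ℂ)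
  rw [Complex.ofReal_re] at h1
  rw [lt_smul, lt_cv h1 (ren_isWeight hs) hz, lt_ez (by simpa using hz)]
  have h0 : 0 < z.re := (p.c_nonneg hs).trans_lt hz
  have h2 := (ren_transform hs h0.le (p.lam_lt_h_lt hs hz)).2
  have h3 := p.k_sub_ne_zero hs hz
  have h4 := p.k_sub hs h0.le (Or.inr h0)
  have ha' : (p.a : ℂ) ≠ 0 := by exact_mod_cast p.a_pos.ne'
  rw [h4] at h3 ⊢
  have h5 := left_ne_zero_of_mul h3
  have h6 := right_ne_zero_of_mul h3
  simp only [mul_one]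
  field_simp
  linear_combination h2

lemma res_isResolvent (hs : 0 ≤ s) : IsResolvent p s (p.res s) :=
  (res_isOrig hs).isOriginal (fun _ hz => hz) fun _ hz => lt_res hs hz

lemma R_eq (hs : 0 ≤ s) : R p s = p.res s :=
  (res_isResolvent hs).original_eq (θ := p.c s) fun _ hz => hz

lemma R_isOrig (hs : 0 ≤ s) : IsOrig (p.c s) fun u => (R p s u : ℂ) := by
  rw [R_eq hs]; exact res_isOrig hs

lemma lt_R (hs : 0 ≤ s) {z : ℂ} (hz : p.c s < z.re) :
    lt (fun u => (R p s u : ℂ)) z = (p.k z - s)⁻¹ := by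
  rw [R_eq hs]; exact lt_res hs hz

lemma R_neg (hs : 0 ≤ s) {u : ℝ} (hu : u < 0) : R p s u = 0 := by
  exact_mod_cast (R_isOrig (p := p) hs).zero u hu

lemma measurable_R (hs : 0 ≤ s) : Measurable (R p s) :=
  Complex.measurable_re.comp (R_isOrig (p := p) hs).meas

lemma res_integrable (hs : 0 ≤ s) (u : ℝ) :
    Integrable (fun v => if v ≤ u then Real.exp (p.c s * (u - v)) else 0) (p.ren s) := by
  have := sfinite_ren (p := p) hs
  have h1 := ez_isOrig (p.c s : ℂ)
  rw [Complex.ofReal_re] at h1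
  refine ((cv_integrable h1 (ren_isWeight hs) u).re).congr (Eventually.of_forall fun v => ?_)
  simp only [ez, sub_nonneg, one_mul]
  split_ifs
  · rw [← Complex.ofReal_mul, ← Complex.ofReal_exp]
    exact Complex.ofReal_re _
  · simp

/-- `e^{-cu} R(u)` is nondecreasing. -/
lemma R_exp_mono (hs : 0 ≤ s) {u v : ℝ} (h : u ≤ v) :
    R p s u ≤ Real.exp (-(p.c s * (v - u))) * R p s v := by
  rw [R_eq hs, res, res, mul_left_comm]
  refine mul_le_mul_of_nonneg_left ?_ (by have := p.a_pos; positivity)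
  rw [← integral_const_mul]
  refine integral_mono (res_integrable hs u) ((res_integrable hs v).const_mul _) fun w => ?_
  dsimp only
  split_ifs with h1 h2 h2
  · rw [← Real.exp_add]
    refine Real.exp_le_exp.2 (le_of_eq ?_)
    ring
  · exact absurd (h1.trans h) h2
  · positivity
  · simp

lemma R_nonneg (hs : 0 ≤ s) (u : ℝ) : 0 ≤ R p s u := by
  rw [R_eq hs, res]
  refine mul_nonneg (by have := p.a_pos; positivity) (integral_nonneg fun v => ?_)
  dsimp only
  split_ifs <;> positivity

lemma R_mono (hs : 0 ≤ s) : Monotone (R p s) := by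
  intro u v h
  refine (R_exp_mono hs h).trans (mul_le_of_le_one_left (R_nonneg hs v) ?_)
  rw [Real.exp_le_one_iff]
  have := p.c_nonneg hs
  nlinarith

lemma R_rc (hs : 0 ≤ s) (u : ℝ) : ContinuousWithinAt (R p s) (Ici u) u :=
  Complex.continuous_re.continuousAt.comp_continuousWithinAt ((R_isOrig (p := p) hs).rc u)

lemma intervalIntegrable_R (hs : 0 ≤ s) (u v : ℝ) : IntervalIntegrable (R p s) volume u v :=
  (R_mono hs).intervalIntegrable

/-- The difference `R(y)/c - ∫₀^y R` is bounded if `s > 0`. -/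
lemma R_div_c_sub_le (hs : 0 < s) : ∃ B, ∀ y, 0 ≤ y →
    R p s y / p.c s - ∫ u in (0 : ℝ)..y, R p s u ≤ B := by
  have hf := finite_ren (p := p) hs
  have hc := p.c_pos hs
  have ha := p.a_pos
  refine ⟨1 / p.a * (1 / p.c s) * (p.ren s).real univ, fun y hy => ?_⟩
  have hm : Measurable (fun q : ℝ × ℝ => if q.2 ≤ q.1 then Real.exp (p.c s * (q.1 - q.2)) else 0) :=
    Measurable.ite (measurableSet_le measurable_snd measurable_fst) (by fun_prop) measurable_const
  have hint : IntegrableOn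
      (fun q : ℝ × ℝ => if q.2 ≤ q.1 then Real.exp (p.c s * (q.1 - q.2)) else 0)
      (Ioc 0 y ×ˢ Ici 0) (volume.prod (p.ren s)) := by
    refine Measure.integrableOn_of_bounded (M := Real.exp (p.c s * y)) ?_ hm.aestronglyMeasurable ?_
    · rw [Measure.prod_prod]
      exact (ENNReal.mul_lt_top (by simp) (measure_lt_top _ _)).ne
    · filter_upwards [ae_restrict_mem (measurableSet_Ioc.prod measurableSet_Ici)] with q hq
      have h1 : q.1 ≤ y := hq.1.2
      have h2 : 0 ≤ q.2 := hq.2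
      split_ifs
      · rw [Real.norm_of_nonneg (Real.exp_pos _).le]
        refine Real.exp_le_exp.2 ?_
        nlinarith
      · simpa using (Real.exp_pos _).le
  have hae : (p.ren s).restrict (Ici 0) = p.ren s :=
    Measure.restrict_eq_self_of_ae_mem (ae_ren_nonneg hs.le)
  have hswap : ∫ u in (0 : ℝ)..y, R p s u = 1 / p.a * ∫ v, (∫ u in (0 : ℝ)..y,
      if v ≤ u then Real.exp (p.c s * (u - v)) else 0) ∂(p.ren s) := by
    rw [R_eq hs.le]
    simp only [res]
    rw [intervalIntegral.integral_const_mul, intervalIntegral.integral_of_le hy]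
    congr 1
    rw [IntegrableOn, ← Measure.prod_restrict, hae] at hint
    rw [integral_integral_swap hint]
    simp only [intervalIntegral.integral_of_le hy]
  have hinner : ∀ v, 0 ≤ v → (∫ u in (0 : ℝ)..y,
      if v ≤ u then Real.exp (p.c s * (u - v)) else 0) =
      if v ≤ y then (Real.exp (p.c s * (y - v)) - 1) / p.c s else 0 := by
    intro v hv
    split_ifs with hvy
    · have h1 : (∫ u in (0 : ℝ)..y, if v ≤ u then Real.exp (p.c s * (u - v)) else 0) =
          ∫ u in v..y, Real.exp (p.c s * (u - v)) := by
        rw [intervalIntegral.integral_of_le hy, intervalIntegral.integral_of_le hvy,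
          ← integral_Icc_eq_integral_Ioc, ← integral_Icc_eq_integral_Ioc,
          ← integral_indicator measurableSet_Icc, ← integral_indicator measurableSet_Icc]
        congr 1
        ext u
        simp only [indicator, mem_Icc]
        by_cases h1 : v ≤ u
        · simp [h1, hv.trans h1]
        · simp [h1]
      rw [h1]
      have hd : ∀ u ∈ uIcc v y, HasDerivAt (fun u => Real.exp (p.c s * (u - v)) / p.c s)
          (Real.exp (p.c s * (u - v))) u := by
        intro u _
        have := ((((hasDerivAt_id u).sub_const v).const_mul (p.c s)).exp).div_const (p.c s)
        refine HasDerivAt.congr_deriv this ?_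
        simp only [id, mul_one]
        rw [mul_div_assoc, div_self hc.ne', mul_one]
      rw [intervalIntegral.integral_eq_sub_of_hasDerivAt hd
        (Continuous.intervalIntegrable (by fun_prop) _ _)]
      simp
      ring
    · rw [intervalIntegral.integral_of_le hy]
      refine setIntegral_eq_zero_of_forall_eq_zero fun u hu => ?_
      rw [if_neg]
      exact fun h => hvy (h.trans hu.2)
  -- Each renewal point `v ≤ y` contributes `e^{c(y-v)}/c - (e^{c(y-v)} - 1)/c = 1/c`, whatever its
  -- position. The total mass of the renewal measure then bounds the difference.
  have hkey : R p s y / p.c s - ∫ u in (0 : ℝ)..y, R p s u =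
      1 / p.a * ∫ v, (if v ≤ y then 1 / p.c s else 0) ∂(p.ren s) := by
    rw [hswap, R_eq hs.le, res, mul_div_assoc, ← mul_sub]
    congr 1
    have h2 : ∫ v, (∫ u in (0 : ℝ)..y, if v ≤ u then Real.exp (p.c s * (u - v)) else 0) ∂(p.ren s) =
        ∫ v, (if v ≤ y then (Real.exp (p.c s * (y - v)) - 1) / p.c s else 0) ∂(p.ren s) := by
      refine integral_congr_ae ?_
      filter_upwards [ae_ren_nonneg hs.le] with v hv using hinner v hv
    rw [h2, ← integral_div]
    have h3 : Integrable (fun v => if v ≤ y then 1 / p.c s else 0) (p.ren s) := by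
      refine Integrable.of_bound (C := 1 / p.c s) ?_ (Eventually.of_forall fun v => ?_)
      · exact (Measurable.ite measurableSet_Iic measurable_const measurable_const).aestronglyMeasurable
      · split_ifs
        · rw [Real.norm_of_nonneg (by positivity)]
        · simpa using hc.le
    have h4 : Integrable (fun v => if v ≤ y then (Real.exp (p.c s * (y - v)) - 1) / p.c s else 0)
        (p.ren s) := by
      refine (((res_integrable hs.le y).div_const (p.c s)).sub h3).congr
        (Eventually.of_forall fun v => ?_)
      simp only [Pi.sub_apply]
      split_ifs
      · ring
      · simp
    rw [← integral_sub ((res_integrable hs.le y).div_const _) h4]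
    congr 1
    ext v
    split_ifs
    · ring
    · simp
  rw [hkey, mul_assoc]
  refine mul_le_mul_of_nonneg_left ?_ (by positivity)
  have : ∫ v, (1 / p.c s) ∂(p.ren s) = 1 / p.c s * (p.ren s).real univ := by
    rw [integral_const, smul_eq_mul, mul_comm]
  rw [← this]
  refine integral_mono_of_nonneg (Eventually.of_forall fun v => ?_) (integrable_const _)
    (Eventually.of_forall fun v => ?_)
  · dsimp only
    split_ifs
    · simp only [Pi.zero_apply]; positivity
    · simp
  · dsimp only
    split_ifs
    · exact le_rfl
    · positivity

/-- Resolvent identity. -/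
lemma R_sub_R (hs : 0 ≤ s) {t : ℝ} (ht : 0 ≤ t) (u : ℝ) (hu : 0 ≤ u) :
    R p t u - R p s u = (t - s) * ∫ v in (0 : ℝ)..u, R p t v * R p s (u - v) := by
  have h1 := (R_isOrig (p := p) hs).mono (le_max_left (p.c s) (p.c t))
  have h2 := (R_isOrig (p := p) ht).mono (le_max_right (p.c s) (p.c t))
  have h3 := (h1.cv h2.weight)
  have key := (h2.sub h1).ext (h3.smul (t - s)) fun z hz => by
    have hzs := (le_max_left _ _).trans_lt hz
    have hzt := (le_max_right _ _).trans_lt hz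
    rw [lt_sub h2 h1 hz, lt_smul, lt_cv h1 h2.weight hz, lt_R hs hzs, lt_R ht hzt]
    have e : (∫ v : ℝ, Complex.exp (-(v * z)) * (R p t v : ℂ)) = (p.k z - t)⁻¹ := lt_R ht hzt
    rw [e]
    have n1 := p.k_sub_ne_zero hs hzs
    have n2 := p.k_sub_ne_zero ht hzt
    field_simp
    ring
  have := congrFun key u
  rw [cv_volume_eq h1.zero h2.zero hu] at this
  have h4 : (∫ v in (0 : ℝ)..u, (R p t v : ℂ) * (R p s (u - v) : ℂ)) =
      ((∫ v in (0 : ℝ)..u, R p t v * R p s (u - v) : ℝ) : ℂ) := by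
    rw [← intervalIntegral.integral_ofReal]
    push_cast
    rfl
  rw [h4] at this
  exact_mod_cast this

lemma R_le_R (hs : 0 ≤ s) {t : ℝ} (hst : s ≤ t) (u : ℝ) : R p s u ≤ R p t u := by
  rcases lt_or_ge u 0 with hu | hu
  · rw [R_neg hs hu, R_neg (hs.trans hst) hu]
  · rw [← sub_nonneg, R_sub_R hs (hs.trans hst) u hu]
    refine mul_nonneg (sub_nonneg.2 hst) (intervalIntegral.integral_nonneg hu fun v _ => ?_)
    exact mul_nonneg (R_nonneg (hs.trans hst) _) (R_nonneg hs _)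

/-- The resolvent identity with base `0` bounds the difference by `s` times a constant, uniformly
for `s ≤ 1`. -/
lemma tendsto_R (u : ℝ) : Tendsto (fun s => R p s u) (𝓝[>] 0) (𝓝 (R p 0 u)) := by
  rcases lt_or_ge u 0 with hu | hu
  · rw [R_neg le_rfl hu]
    refine tendsto_const_nhds.congr' ?_
    filter_upwards [self_mem_nhdsWithin] with s hs
    rw [R_neg (mem_Ioi.1 hs).le hu]
  · have hlim : Tendsto (fun s : ℝ => R p 0 u + s * (u * (R p 1 u * R p 0 u))) (𝓝[>] 0)
        (𝓝 (R p 0 u + 0 * (u * (R p 1 u * R p 0 u)))) :=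
      ((continuous_const.add (continuous_id.mul continuous_const)).tendsto 0).mono_left
        nhdsWithin_le_nhds
    rw [zero_mul, add_zero] at hlim
    refine tendsto_of_tendsto_of_tendsto_of_le_of_le' tendsto_const_nhds hlim ?_ ?_
    · filter_upwards [self_mem_nhdsWithin] with s hs using R_le_R le_rfl (mem_Ioi.1 hs).le u
    · filter_upwards [self_mem_nhdsWithin, mem_nhdsWithin_of_mem_nhds (Iio_mem_nhds one_pos)]
        with s hs hs1
      have hs0 := (mem_Ioi.1 hs).le
      have h1 := R_sub_R (p := p) le_rfl hs0 u hu
      have h2 : ∫ v in (0 : ℝ)..u, R p s v * R p 0 (u - v) ≤ u * (R p 1 u * R p 0 u) := by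
        have := intervalIntegral.norm_integral_le_of_norm_le_const (a := (0 : ℝ)) (b := u)
          (C := R p 1 u * R p 0 u) (f := fun v => R p s v * R p 0 (u - v)) (fun v hv => by
            rw [uIoc_of_le hu] at hv
            rw [Real.norm_of_nonneg (mul_nonneg (R_nonneg hs0 _) (R_nonneg le_rfl _))]
            refine mul_le_mul ?_ (R_mono le_rfl (by linarith [hv.1])) (R_nonneg le_rfl _)
              (R_nonneg zero_le_one _)
            exact (R_le_R hs0 (mem_Iio.1 hs1).le v).trans (R_mono zero_le_one hv.2))
        rw [sub_zero, abs_of_nonneg hu, mul_comm] at this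
        exact (le_abs_self _).trans this
      have h3 := mul_le_mul_of_nonneg_left h2 hs0
      rw [sub_zero] at h1
      linarith

end CompoundPoisson
end Oscillating
end

noncomputable section
namespace Oscillating
namespace CompoundPoisson
variable {p : CompoundPoisson} {s : ℝ}

/-! ### Volterra equations solved by the resolvent -/

lemma jump_isWeight : IsWeight 0 p.jump fun _ => 1 where
  meas := measurable_const
  zero := by
    filter_upwards [p.ae_jump_pos] with v hv h using absurd hv (not_lt.2 h.le)
  int z hz := by simpa using p.integrable_exp_jump hz.le

lemma lt_cv_jump {G : ℝ → ℂ} {σ : ℝ} (hσ : 0 ≤ σ) (hG : IsOrig σ G) {z : ℂ} (hz : σ < z.re) :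
    lt (cv p.jump (fun _ => 1) G) z = p.phi z * lt G z := by
  rw [lt_cv hG (jump_isWeight.mono hσ) hz]
  simp [phi]

lemma C_of_neg {x : ℝ} (hx : x < 0) (z : ℂ) : C p x z s = Complex.exp (z * x) := by
  rw [C, if_pos hx]

lemma C_of_nonneg {x : ℝ} (hx : 0 ≤ x) (z : ℂ) : C p x z s = Complex.exp (z * x) *
    (1 - (p.k z - s) * ∫ u in (0 : ℝ)..x, Complex.exp (-(u * z)) * R p s u) := by
  rw [C, if_neg (not_lt.2 hx)]

lemma C_zero (z : ℂ) : C p 0 z s = 1 := by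
  simp [C]

/-- At `w` the left side has transform `(k(w) - k(z)) / ((w - z)(k(w) - s))`, and `k(w) - k(z) = (w
- z)(a - λ ψ̂_z(w))`. The identity exhibits `C` as the solution with exponential data: initial value
`1` and source `psi z`. -/
lemma C_eq (hs : 0 ≤ s) {z : ℂ} (hz : 0 ≤ z.re) {y : ℝ} (hy : 0 ≤ y) :
    C p y z s = p.a * R p s y - p.lam * cv volume (p.psi z) (fun u => (R p s u : ℂ)) y := by
  set σ := max (p.c s) z.re
  have hσ0 : 0 ≤ σ := hz.trans (le_max_right _ _)
  have hR := (R_isOrig (p := p) hs).mono (le_max_left (p.c s) z.re)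
  have hE := (ez_isOrig z).mono (le_max_right (p.c s) z.re)
  have hP := (psi_isOrig (p := p) hz).1.mono hσ0
  have key := (hE.sub ((hE.cv hR.weight).smul (p.k z - s))).ext
    ((hR.smul p.a).sub ((hR.cv hP.weight).smul p.lam)) fun w hw => by
      have hwc := (le_max_left _ _).trans_lt hw
      have hwz := (le_max_right _ _).trans_lt hw
      have hw0 : 0 < w.re := hσ0.trans_lt hw
      rw [lt_sub hE ((hE.cv hR.weight).smul _) hw, lt_sub (hR.smul _) ((hR.cv hP.weight).smul _) hw,
        lt_smul, lt_smul, lt_smul, lt_cv hE hR.weight hw, lt_cv hR hP.weight hw]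
      change lt (ez z) w - (p.k z - s) * (lt (fun u => (R p s u : ℂ)) w * lt (ez z) w) =
        p.a * lt (fun u => (R p s u : ℂ)) w -
          p.lam * (lt (p.psi z) w * lt (fun u => (R p s u : ℂ)) w)
      rw [lt_R hs hwc, lt_ez hwz]
      have h1 := p.lt_psi hz hw0
      have hne : w - z ≠ 0 := fun h0 => by
        have := congrArg Complex.re h0
        simp at this
        linarith
      have hk := p.k_sub_ne_zero hs hwc
      have e : p.k w - s = p.k z - s + (w - z) * (p.a - p.lam * lt (p.psi z) w) := by
        rw [p.k_eq hz, p.k_eq hw0.le]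
        linear_combination p.lam * h1
      field_simp
      linear_combination e
  have := congrFun key y
  rw [← this, C_of_nonneg hy, cv_volume_eq hE.zero hR.zero hy, ez, if_pos hy, mul_sub, mul_one,
    mul_left_comm, ← intervalIntegral.integral_const_mul]
  congr 2
  refine intervalIntegral.integral_congr fun u hu => ?_
  rw [uIcc_of_le hy] at hu
  simp only [ez, sub_nonneg, hu.2, if_true]
  have e : Complex.exp (z * (y - u : ℝ)) = Complex.exp (z * y) * Complex.exp (-(u * z)) := by
    rw [← Complex.exp_add]
    congr 1
    push_cast
    ring
  rw [e]
  ring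

lemma cv_volume_zero {f g : ℝ → ℂ} (hf : ∀ u, u < 0 → f u = 0) (hg : ∀ u, u < 0 → g u = 0) :
    cv volume g f 0 = 0 := by
  rw [cv_volume_eq hf hg le_rfl, intervalIntegral.integral_same]

lemma R_zero (hs : 0 ≤ s) : p.a * R p s 0 = 1 := by
  have h := C_eq (p := p) hs (z := 0) (by simp) le_rfl
  rw [C_zero, cv_volume_zero (R_isOrig hs).zero (psi_isOrig (by simp)).1.zero, mul_zero,
    sub_zero] at h
  exact_mod_cast h.symm

lemma R_pos (hs : 0 ≤ s) {u : ℝ} (hu : 0 ≤ u) : 0 < R p s u := by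
  have h1 := R_zero (p := p) hs
  have h2 := R_mono (p := p) hs hu
  have h3 := p.a_pos
  by_contra! hle
  nlinarith

/-- The solution of the Volterra equation with source `ψ` and initial value `g₀`. -/
def vol (p : CompoundPoisson) (s : ℝ) (ψ : ℝ → ℂ) (g₀ : ℂ) (y : ℝ) : ℂ :=
  p.a * g₀ * R p s y - p.lam * cv volume ψ (fun u => (R p s u : ℂ)) y

/-- The right-hand side of the Volterra equation. -/
def volRhs (p : CompoundPoisson) (s : ℝ) (ψ G : ℝ → ℂ) (v : ℝ) : ℂ :=
  (p.lam + s) * G v - p.lam * cv p.jump (fun _ => 1) G v - p.lam * ψ v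

lemma vol_isOrig (hs : 0 ≤ s) {ψ : ℝ → ℂ} (hψ : IsOrig 0 ψ) (g₀ : ℂ) :
    IsOrig (p.c s) (p.vol s ψ g₀) :=
  ((R_isOrig hs).smul _).sub
    (((R_isOrig hs).cv (hψ.mono (p.c_nonneg hs)).weight).smul _)

lemma volRhs_isOrig (hs : 0 ≤ s) {ψ : ℝ → ℂ} (hψ : IsOrig 0 ψ) (g₀ : ℂ) :
    IsOrig (p.c s) (p.volRhs s ψ (p.vol s ψ g₀)) := by
  have hG := vol_isOrig (p := p) hs hψ g₀
  exact ((hG.smul _).sub ((hG.cv (jump_isWeight.mono (p.c_nonneg hs))).smul _)).sub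
    ((hψ.mono (p.c_nonneg hs)).smul _)

/-- This is the integrated form of `a G' = (λ + s) G - λ E G(· - W) - λ ψ` with `G(0) = g₀`; it
holds because the transform of `G` is `(a g₀ - λ ψ̂)/(k - s)`. -/
lemma vol_eq (hs : 0 ≤ s) {ψ : ℝ → ℂ} (hψ : IsOrig 0 ψ) (g₀ : ℂ) {y : ℝ} (hy : 0 ≤ y) :
    p.a * p.vol s ψ g₀ y = p.a * g₀ + ∫ v in (0 : ℝ)..y, p.volRhs s ψ (p.vol s ψ g₀) v := by
  have hc := p.c_nonneg hs
  have hG := vol_isOrig (p := p) hs hψ g₀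
  have hN := volRhs_isOrig (p := p) hs hψ g₀
  have hψ' := hψ.mono hc
  have hR := R_isOrig (p := p) hs
  have hJ := hG.cv ((jump_isWeight (p := p)).mono hc)
  have hE : IsOrig (p.c s) (ez 0) := (ez_isOrig 0).mono (by simpa using hc)
  have key := (hG.smul p.a).ext ((hE.smul (p.a * g₀)).add (hE.cv hN.weight)) fun w hw => by
    have hw0 : 0 < w.re := hc.trans_lt hw
    rw [lt_smul, lt_add (hE.smul _) (hE.cv hN.weight) hw, lt_smul, lt_cv hE hN.weight hw]
    change p.a * lt (p.vol s ψ g₀) w = p.a * g₀ * lt (ez 0) w +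
      lt (p.volRhs s ψ (p.vol s ψ g₀)) w * lt (ez 0) w
    have e1 : lt (p.volRhs s ψ (p.vol s ψ g₀)) w = (p.lam + s) * lt (p.vol s ψ g₀) w -
        p.lam * (p.phi w * lt (p.vol s ψ g₀) w) - p.lam * lt ψ w := by
      unfold volRhs
      rw [lt_sub ((hG.smul _).sub (hJ.smul _)) (hψ'.smul _) hw, lt_sub (hG.smul _) (hJ.smul _) hw,
        lt_smul, lt_smul, lt_smul, lt_cv_jump hc hG hw]
    have e2 : lt (p.vol s ψ g₀) w = p.a * g₀ * (p.k w - s)⁻¹ -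
        p.lam * (lt ψ w * (p.k w - s)⁻¹) := by
      unfold vol
      rw [lt_sub (hR.smul _) ((hR.cv hψ'.weight).smul _) hw, lt_smul, lt_smul,
        lt_cv hR hψ'.weight hw, lt_R hs hw]
      rfl
    have hk := p.k_sub_ne_zero hs hw
    have hw' : w ≠ 0 := fun h => by rw [h] at hw0; simp at hw0
    have e3 : (p.k w - s) * lt (p.vol s ψ g₀) w = p.a * g₀ - p.lam * lt ψ w := by
      rw [e2]
      field_simp
    rw [p.k_eq hw0.le] at e3
    rw [e1, lt_ez (by simpa using hw0), sub_zero]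
    field_simp
    linear_combination e3
  have := congrFun key y
  rw [cv_step hN.zero hy] at this
  rw [this]
  simp [ez, hy]

lemma IsOrig.intervalIntegrable {σ : ℝ} {f : ℝ → ℂ} (hf : IsOrig σ f) (a b : ℝ) :
    IntervalIntegrable f volume a b := by
  obtain ⟨B, hB⟩ := hf.bdd (max a b)
  rw [intervalIntegrable_iff]
  refine Measure.integrableOn_of_bounded (M := B) (by simp [uIoc]) hf.meas.aestronglyMeasurable ?_
  filter_upwards [ae_restrict_mem measurableSet_uIoc] with u hu
  exact hB u hu.2

/-- The right-hand side is only right-continuous, so only a one-sided derivative is available; the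
fundamental theorem of calculus used later needs no more. -/
lemma vol_hasDeriv (hs : 0 ≤ s) {ψ : ℝ → ℂ} (hψ : IsOrig 0 ψ) (g₀ : ℂ) {y : ℝ} (hy : 0 ≤ y) :
    HasDerivWithinAt (p.vol s ψ g₀) (p.volRhs s ψ (p.vol s ψ g₀) y / p.a) (Ici y) y := by
  have hN := volRhs_isOrig (p := p) hs hψ g₀
  have ha : (p.a : ℂ) ≠ 0 := by exact_mod_cast p.a_pos.ne'
  have h1 : HasDerivWithinAt (fun u => ∫ v in (0 : ℝ)..u, p.volRhs s ψ (p.vol s ψ g₀) v)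
      (p.volRhs s ψ (p.vol s ψ g₀) y) (Ici y) y :=
    intervalIntegral.integral_hasDerivWithinAt_right (IsOrig.intervalIntegrable hN 0 y) (t := Ioi y)
      hN.meas.stronglyMeasurable.stronglyMeasurableAtFilter
      ((hN.rc y).mono Ioi_subset_Ici_self)
  have h2 := (h1.const_add (p.a * g₀)).div_const (p.a : ℂ)
  refine h2.congr (fun u hu => ?_) ?_
  · rw [← vol_eq hs hψ g₀ (hy.trans hu)]
    field_simp
  · rw [← vol_eq hs hψ g₀ hy]
    field_simp

lemma vol_continuousOn (hs : 0 ≤ s) {ψ : ℝ → ℂ} (hψ : IsOrig 0 ψ) (g₀ : ℂ) :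
    ContinuousOn (p.vol s ψ g₀) (Ici 0) := by
  have hN := volRhs_isOrig (p := p) hs hψ g₀
  have ha : (p.a : ℂ) ≠ 0 := by exact_mod_cast p.a_pos.ne'
  have h1 : Continuous fun u => ∫ v in (0 : ℝ)..u, p.volRhs s ψ (p.vol s ψ g₀) v :=
    intervalIntegral.continuous_primitive (fun a b => IsOrig.intervalIntegrable hN a b) 0
  have h2 : Continuous fun u => (p.a * g₀ +
      ∫ v in (0 : ℝ)..u, p.volRhs s ψ (p.vol s ψ g₀) v) / p.a :=
    (continuous_const.add h1).div_const _
  refine h2.continuousOn.congr fun u hu => ?_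
  dsimp only
  rw [← vol_eq hs hψ g₀ hu]
  field_simp

/-- A function on the line that is bounded to the left, and on `[0, ∞)` solves the equation
`(generator - s) f = 0`. -/
structure IsHarmonic (p : CompoundPoisson) (s B : ℝ) (f : ℝ → ℂ) : Prop where
  meas : Measurable f
  bound : ∀ t < 0, ‖f t‖ ≤ B
  rc : ∀ t < 0, ContinuousWithinAt f (Ici t) t
  eq : ∀ y, 0 ≤ y → f y = p.vol s (p.src f) (f 0) y

lemma IsHarmonic.src_isOrig {B : ℝ} {f : ℝ → ℂ} (hf : IsHarmonic p s B f) :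
    IsOrig 0 (p.src f) ∧ ∀ v, ‖p.src f v‖ ≤ B :=
  CompoundPoisson.src_isOrig hf.meas hf.bound hf.rc

lemma IsHarmonic.bdd {B : ℝ} {f : ℝ → ℂ} (hs : 0 ≤ s) (hf : IsHarmonic p s B f) (U : ℝ) :
    ∃ B', ∀ y ≤ U, ‖f y‖ ≤ B' := by
  obtain ⟨B', hB'⟩ := (vol_isOrig (p := p) hs hf.src_isOrig.1 (f 0)).bdd U
  refine ⟨max B B', fun y hy => ?_⟩
  rcases lt_or_ge y 0 with h | h
  · exact (hf.bound y h).trans (le_max_left _ _)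
  · rw [hf.eq y h]
    exact (hB' y hy).trans (le_max_right _ _)

lemma IsHarmonic.integrable {B : ℝ} {f : ℝ → ℂ} (hs : 0 ≤ s) (hf : IsHarmonic p s B f) (v : ℝ) :
    Integrable (fun x => f (v - x)) p.jump := by
  obtain ⟨B', hB'⟩ := hf.bdd hs v
  refine Integrable.of_bound (C := B') (hf.meas.comp (by fun_prop)).aestronglyMeasurable ?_
  filter_upwards [p.ae_jump_pos] with x hx using hB' _ (by linarith)

/-- Jumps `x ≤ v` land in `[0, ∞)`, where `f` is given by `vol`; jumps `x > v` are collected by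
`src`. The function `vol` vanishes to the left of `0`, so the two parts do not overlap. -/
lemma IsHarmonic.mean_eq {B : ℝ} {f : ℝ → ℂ} (hs : 0 ≤ s) (hf : IsHarmonic p s B f) {v : ℝ}
    (hv : 0 ≤ v) : ∫ x, f (v - x) ∂p.jump =
      cv p.jump (fun _ => 1) (p.vol s (p.src f) (f 0)) v + p.src f v := by
  have hG := vol_isOrig (p := p) hs hf.src_isOrig.1 (f 0)
  have h1 := cv_integrable hG ((jump_isWeight (p := p)).mono (p.c_nonneg hs)) v
  have hpt : ∀ x, (if v < x then f (v - x) else 0) =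
      f (v - x) - 1 * p.vol s (p.src f) (f 0) (v - x) := by
    intro x
    split_ifs with h
    · rw [hG.zero _ (by linarith)]; simp
    · rw [hf.eq _ (by linarith)]; simp
  rw [cv, src, if_pos hv]
  simp only [hpt]
  rw [integral_sub (hf.integrable hs v) h1]
  ring

/-- The equation obtained by stopping at the first jump or on reaching the position `y₁`. -/
lemma IsHarmonic.first_step {B : ℝ} {f : ℝ → ℂ} (hs : 0 ≤ s) (hf : IsHarmonic p s B f) {y y₁ : ℝ}
    (hy : 0 ≤ y) (hyy : y ≤ y₁) :
    f y = Real.exp (-((p.lam + s) / p.a * (y₁ - y))) * f y₁ + p.lam / p.a *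
      ∫ v in y..y₁, Real.exp (-((p.lam + s) / p.a * (v - y))) * ∫ x, f (v - x) ∂p.jump := by
  have ha : (p.a : ℂ) ≠ 0 := by exact_mod_cast p.a_pos.ne'
  set β : ℝ := (p.lam + s) / p.a
  set ψ := p.src f
  set G := p.vol s ψ (f 0) with hGdef
  have hψ := hf.src_isOrig.1
  have hG := vol_isOrig (p := p) hs hψ (f 0)
  set M : ℝ → ℂ := fun v => cv p.jump (fun _ => 1) G v + ψ v with hM
  have hMo : IsOrig (p.c s) M :=
    (hG.cv (jump_isWeight.mono (p.c_nonneg hs))).add (hψ.mono (p.c_nonneg hs))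
  have hexp : ∀ v : ℝ, HasDerivAt (fun v : ℝ => ((Real.exp (-(β * (v - y))) : ℝ) : ℂ))
      ((-β * Real.exp (-(β * (v - y))) : ℝ) : ℂ) v := by
    intro v
    have := ((((hasDerivAt_id v).sub_const y).const_mul β).neg.exp).ofReal_comp
    refine this.congr_deriv ?_
    push_cast
    simp
    ring
  -- The factor `e^{-β(v-y)}` with `β = (λ + s)/a` absorbs the local term of the equation, and only
  -- the jump term remains in the derivative of the product.
  have key : ∫ v in y..y₁, -(p.lam / p.a * (Real.exp (-(β * (v - y))) * M v)) =
      Real.exp (-(β * (y₁ - y))) * G y₁ - Real.exp (-(β * (y - y))) * G y := by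
    refine intervalIntegral.integral_eq_sub_of_hasDeriv_right_of_le hyy
      (f := fun v : ℝ => ((Real.exp (-(β * (v - y))) : ℝ) : ℂ) * G v) ?_ ?_ ?_
    · refine ContinuousOn.mul (by fun_prop) ?_
      exact (vol_continuousOn hs hψ (f 0)).mono fun v hv => hy.trans hv.1
    · intro v hv
      have hv0 : 0 ≤ v := hy.trans hv.1.le
      have h1 := (hexp v).hasDerivWithinAt (s := Ioi v)
      have h2 := (vol_hasDeriv (p := p) hs hψ (f 0) hv0).mono Ioi_subset_Ici_self
      refine (h1.mul h2).congr_deriv ?_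
      simp only [hM, volRhs]
      have hb : (β : ℂ) = (p.lam + s) / p.a := by simp [β]
      push_cast
      rw [hb]
      field_simp
      ring
    · have h1 : IntervalIntegrable (fun v : ℝ => ((Real.exp (-(β * (v - y))) : ℝ) : ℂ) * M v)
          volume y y₁ :=
        (IsOrig.intervalIntegrable hMo y y₁).continuousOn_mul (by fun_prop)
      exact (h1.const_mul _).neg
  have hcongr : ∫ v in y..y₁, ((Real.exp (-(β * (v - y))) : ℝ) : ℂ) * ∫ x, f (v - x) ∂p.jump =
      ∫ v in y..y₁, ((Real.exp (-(β * (v - y))) : ℝ) : ℂ) * M v := by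
    refine intervalIntegral.integral_congr fun v hv => ?_
    rw [uIcc_of_le hyy] at hv
    rw [hf.mean_eq hs (hy.trans hv.1)]
  rw [hcongr, hf.eq y hy, hf.eq y₁ (hy.trans hyy)]
  rw [intervalIntegral.integral_neg, intervalIntegral.integral_const_mul] at key
  simp only [sub_self, mul_zero, neg_zero, Real.exp_zero, Complex.ofReal_one, one_mul] at key
  linear_combination key

/-- The solution is bounded if it satisfies the right boundary condition. -/
lemma IsHarmonic.bounded {B : ℝ} {f : ℝ → ℂ} (hs : 0 < s) (hf : IsHarmonic p s B f)
    (h0 : p.a * f 0 = p.lam * lt (p.src f) (p.c s)) : ∃ B', ∀ y, ‖f y‖ ≤ B' := by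
  obtain ⟨D, hD⟩ := R_div_c_sub_le (p := p) hs
  have hc := p.c_pos hs
  obtain ⟨hψ, hψB⟩ := hf.src_isOrig
  have hB0 : 0 ≤ B := (norm_nonneg _).trans (hψB 0)
  refine ⟨max B (p.lam * (B * D)), fun y => ?_⟩
  rcases lt_or_ge y 0 with h | hy
  · exact (hf.bound y h).trans (le_max_left _ _)
  refine le_trans ?_ (le_max_right _ _)
  have hi1 : Integrable fun v : ℝ => Complex.exp (-(v * (p.c s : ℂ))) * p.src f v :=
    hψ.int _ (by simpa using hc)
  have hi2 : Integrable fun v : ℝ => p.src f v * (R p s (y - v) : ℂ) :=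
    cv_integrable (R_isOrig hs.le) (hψ.mono hc.le).weight y
  -- The boundary condition replaces `a f(0)` by an integral of the source. The kernel becomes `R(y)
  -- e^{-cv} - R(y - v)`, which is nonnegative by `R_exp_mono`.
  have e : f y = p.lam * ∫ v : ℝ, ((R p s y : ℂ) * (Complex.exp (-(v * (p.c s : ℂ))) * p.src f v) -
      p.src f v * (R p s (y - v) : ℂ)) := by
    rw [integral_sub (hi1.const_mul _) hi2, hf.eq y hy, vol, h0, integral_const_mul]
    change _ = p.lam * (R p s y * lt (p.src f) (p.c s) -
      cv volume (p.src f) (fun u => (R p s u : ℂ)) y)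
    ring
  have hR0 : ∀ u, 0 ≤ R p s u := R_nonneg hs.le
  have hb1 : Integrable ((Ioi (0 : ℝ)).indicator fun v => R p s y * Real.exp (-p.c s * v)) :=
    (integrable_indicator_iff measurableSet_Ioi).2
      ((integrableOn_exp_mul_Ioi (by linarith) 0).const_mul _)
  have hb2 : Integrable ((Ioc (0 : ℝ) y).indicator fun v => R p s (y - v)) := by
    rw [integrable_indicator_iff measurableSet_Ioc,
      ← intervalIntegrable_iff_integrableOn_Ioc_of_le hy]
    have := (intervalIntegrable_R (p := p) hs.le y 0).comp_sub_left y
    simpa using this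
  have hbd : ∀ᵐ v : ℝ, ‖(R p s y : ℂ) * (Complex.exp (-(v * (p.c s : ℂ))) * p.src f v) -
      p.src f v * (R p s (y - v) : ℂ)‖ ≤
      B * ((Ioi (0 : ℝ)).indicator (fun v => R p s y * Real.exp (-p.c s * v)) v -
        (Ioc (0 : ℝ) y).indicator (fun v => R p s (y - v)) v) := by
    have hne : ∀ᵐ u : ℝ, u ≠ 0 := by simp [ae_iff]
    filter_upwards [hne] with v hv
    rcases lt_or_gt_of_ne hv with h | h
    · rw [hψ.zero v h]
      simp [indicator, not_lt.2 h.le]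
    · have hle : R p s (y - v) ≤ R p s y * Real.exp (-p.c s * v) := by
        have := R_exp_mono (p := p) hs.le (u := y - v) (v := y) (by linarith)
        rw [mul_comm]
        convert this using 3
        ring
      have h1 : (Ioc (0 : ℝ) y).indicator (fun v => R p s (y - v)) v = R p s (y - v) := by
        by_cases hvy : v ≤ y
        · rw [indicator_of_mem (mem_Ioc.2 ⟨h, hvy⟩)]
        · rw [indicator_of_notMem (fun h' => hvy h'.2), R_neg hs.le (by linarith)]
      rw [h1, indicator_of_mem (mem_Ioi.2 h)]
      have h2 : (R p s y : ℂ) * (Complex.exp (-(v * (p.c s : ℂ))) * p.src f v) -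
          p.src f v * (R p s (y - v) : ℂ) =
          p.src f v * ((R p s y * Real.exp (-p.c s * v) - R p s (y - v) : ℝ) : ℂ) := by
        push_cast
        have : -((v : ℂ) * (p.c s : ℂ)) = -(p.c s : ℂ) * v := by ring
        rw [this]
        ring
      rw [h2, norm_mul, Complex.norm_real, Real.norm_of_nonneg (sub_nonneg.2 hle)]
      exact mul_le_mul_of_nonneg_right (hψB v) (sub_nonneg.2 hle)
  rw [e, norm_mul, Complex.norm_real, Real.norm_of_nonneg p.lam_pos.le]
  refine mul_le_mul_of_nonneg_left ?_ p.lam_pos.le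
  refine (norm_integral_le_of_norm_le ((hb1.sub hb2).const_mul B) hbd).trans ?_
  simp only [Pi.sub_apply]
  rw [integral_const_mul, integral_sub hb1 hb2, integral_indicator measurableSet_Ioi,
    integral_indicator measurableSet_Ioc, integral_const_mul, integral_exp_mul_Ioi (by linarith),
    ← intervalIntegral.integral_of_le hy, intervalIntegral.integral_comp_sub_left]
  -- The integral of the kernel over `v > 0` is exactly `R(y)/c - ∫₀^y R`, which `R_div_c_sub_le`
  -- bounds independently of `y`.
  refine mul_le_mul_of_nonneg_left (le_trans (le_of_eq ?_) (hD y hy)) hB0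
  simp
  ring

/-- The resolvent is strictly increasing on `[0, ∞)`. -/
lemma R_lt (hs : 0 ≤ s) {u v : ℝ} (hv : 0 ≤ v) (huv : u < v) : R p s u < R p s v := by
  rcases lt_or_ge u 0 with hu | hu
  · rw [R_neg hs hu]; exact R_pos hs hv
  rcases (p.c_nonneg hs).eq_or_lt with h0 | hpos
  swap
  · refine (R_exp_mono hs huv.le).trans_lt ?_
    refine mul_lt_of_lt_one_left (R_pos hs hv) ?_
    rw [Real.exp_lt_one_iff]
    nlinarith
  -- Only `c(s) = 0` remains, where the exponential growth gives no strictness; this forces `s = 0`.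
  have hs0 : s = 0 := by
    have := p.kR_c hs
    rw [← h0, kR_zero] at this
    exact this.symm
  by_contra! hge
  set S : Set ℝ := {w | 0 ≤ w ∧ R p s w = R p s v}
  have hSb : BddBelow S := ⟨0, fun w hw => hw.1⟩
  have huS : u ∈ S := ⟨hu, le_antisymm (R_mono hs huv.le) hge⟩
  -- The leftmost point at which the resolvent takes the value `R(v)`. It is strictly smaller before
  -- `w` and constant on `[w, v]`.
  set w := sInf S
  have hw0 : 0 ≤ w := le_csInf ⟨u, huS⟩ fun x hx => hx.1
  have hwu : w ≤ u := csInf_le hSb huS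
  have hconst' : ∀ x, w < x → x ≤ v → R p s x = R p s v := by
    intro x hx hxv
    obtain ⟨x', hx', hlt⟩ := exists_lt_of_csInf_lt ⟨u, huS⟩ hx
    exact le_antisymm (R_mono hs hxv) (hx'.2.symm.le.trans (R_mono hs hlt.le))
  have hwv : R p s w = R p s v := by
    have h1 : Tendsto (R p s) (𝓝[>] w) (𝓝 (R p s w)) :=
      (R_rc hs w).mono_left (nhdsWithin_mono _ Ioi_subset_Ici_self)
    refine tendsto_nhds_unique h1 (tendsto_const_nhds.congr' ?_)
    filter_upwards [Ioo_mem_nhdsGT (hwu.trans_lt huv)] with x hx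
    exact (hconst' x hx.1 hx.2.le).symm
  have hbelow : ∀ x, x < w → R p s x < R p s w := by
    intro x hx
    rcases lt_or_ge x 0 with h | h
    · rw [R_neg hs h]; exact R_pos hs hw0
    · refine lt_of_le_of_ne (R_mono hs hx.le) fun he => ?_
      exact absurd (csInf_le hSb (show x ∈ S from ⟨h, he.trans hwv⟩)) (not_le.2 hx)
  have hψ : IsOrig 0 (fun _ : ℝ => (0 : ℂ)) :=
    ⟨measurable_const, fun _ _ => rfl, fun _ => continuousWithinAt_const,
      fun _ => ⟨0, fun _ _ => by simp⟩, fun _ _ => by simp⟩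
  have hvol : p.vol s (fun _ => 0) (p.a : ℂ)⁻¹ = fun x => (R p s x : ℂ) := by
    have ha : (p.a : ℂ) ≠ 0 := by exact_mod_cast p.a_pos.ne'
    ext x
    simp [vol, cv, ha]
  have hd := vol_hasDeriv (p := p) hs hψ (p.a : ℂ)⁻¹ hw0
  rw [hvol] at hd
  have hd0 : HasDerivWithinAt (fun x => (R p s x : ℂ)) 0 (Ici w) w := by
    refine (hasDerivWithinAt_const w (Ici w) (R p s v : ℂ)).congr_of_eventuallyEq ?_ (by rw [hwv])
    filter_upwards [Icc_mem_nhdsGE (hwu.trans_lt huv)] with x hx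
    rcases hx.1.eq_or_lt with h | h
    · rw [← h, hwv]
    · rw [hconst' x h hx.2]
  -- The right derivative at `w` vanishes, so the equation forces `R(w) = E R(w - W)`. This is
  -- impossible, since almost every jump leads to a strictly smaller value.
  have hN : p.volRhs s (fun _ => 0) (fun x => (R p s x : ℂ)) w / p.a = 0 :=
    (uniqueDiffOn_Ici w w self_mem_Ici).eq_deriv _ hd hd0
  rw [div_eq_zero_iff] at hN
  have hN' := hN.resolve_right (by exact_mod_cast p.a_pos.ne')
  have hcv : cv p.jump (fun _ => 1) (fun x => (R p s x : ℂ)) w =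
      ((∫ x, R p s (w - x) ∂p.jump : ℝ) : ℂ) := by
    rw [cv, ← integral_complex_ofReal]
    simp
  rw [volRhs, hcv] at hN'
  have hs0' : (s : ℂ) = 0 := by exact_mod_cast hs0
  have hN2 : p.lam * (R p s w - ∫ x, R p s (w - x) ∂p.jump) = 0 := by
    have : ((p.lam * (R p s w - ∫ x, R p s (w - x) ∂p.jump) : ℝ) : ℂ) = 0 := by
      push_cast
      linear_combination hN' - (R p s w : ℂ) * hs0'
    exact_mod_cast this
  have hN3 := (mul_eq_zero.1 hN2).resolve_left p.lam_pos.ne'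
  have hint : Integrable (fun x => R p s (w - x)) p.jump := by
    have := (cv_integrable (R_isOrig (p := p) hs)
      ((jump_isWeight (p := p)).mono (p.c_nonneg hs)) w).re
    simpa using this
  have hz : (fun x => R p s w - R p s (w - x)) =ᵐ[p.jump] 0 := by
    refine (integral_eq_zero_iff_of_nonneg_ae ?_ ((integrable_const _).sub hint)).1 ?_
    · filter_upwards [p.ae_jump_pos] with x hx using sub_nonneg.2 (hbelow _ (by linarith)).le
    · simp only [Pi.sub_apply]
      rw [integral_sub (integrable_const _) hint]
      simpa using hN3
  obtain ⟨x, hx, hx0⟩ := (p.ae_jump_pos.and hz).exists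
  have := hbelow (w - x) (by linarith)
  simp only [Pi.zero_apply] at hx0
  linarith

end CompoundPoisson
end Oscillating
end

noncomputable section
namespace Oscillating

/-! ### Functionals of functions on the negative half-line -/

/-- The functional `g ↦ A g(0) - κ ∫ g(-t) m(dt)`. -/
def func (A κ : ℝ) (m : Measure ℝ) (g : ℝ → ℂ) : ℂ := A * g 0 - κ * ∫ t, g (-t) ∂m

/-- The functional `func` applied to a shifted resolvent. -/
def tfun (p : CompoundPoisson) (s A κ : ℝ) (m : Measure ℝ) (u : ℝ) : ℝ :=
  A * R p s u - κ * ∫ t, R p s (u - t) ∂m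

section functional
open CompoundPoisson
variable {p : CompoundPoisson} {s A κ : ℝ} {m : Measure ℝ}

lemma tfun_eq_cv (u : ℝ) : (tfun p s A κ m u : ℂ) =
    A * R p s u - κ * cv m (fun _ => 1) (fun u => (R p s u : ℂ)) u := by
  rw [tfun, cv]
  simp only [one_mul]
  rw [integral_complex_ofReal]
  push_cast
  rfl

lemma tfun_eq_func (u : ℝ) :
    (tfun p s A κ m u : ℂ) = func A κ m fun y => (R p s (u + y) : ℂ) := by
  rw [tfun_eq_cv, func, cv]
  simp [sub_eq_add_neg]

lemma finite_isWeight [IsFiniteMeasure m] (hm : ∀ᵐ t ∂m, 0 ≤ t) : IsWeight 0 m fun _ => 1 where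
  meas := measurable_const
  zero := by filter_upwards [hm] with t ht h using absurd ht (not_le.2 h)
  int z hz := by
    refine Integrable.of_bound (C := 1) (by fun_prop) ?_
    filter_upwards [hm] with t ht
    rw [mul_one, norm_cexp_neg_mul, Real.exp_le_one_iff]
    nlinarith

lemma tfun_isOrig (hs : 0 ≤ s) [IsFiniteMeasure m] (hm : ∀ᵐ t ∂m, 0 ≤ t) :
    IsOrig (p.c s) fun u => (tfun p s A κ m u : ℂ) := by
  simp only [tfun_eq_cv]
  exact ((R_isOrig hs).smul _).sub
    (((R_isOrig hs).cv ((finite_isWeight hm).mono (p.c_nonneg hs))).smul _)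

lemma func_exp (z : ℂ) : func A κ m (fun t => Complex.exp (t * z)) =
    A - κ * ∫ t : ℝ, Complex.exp (-(t * z)) ∂m := by
  simp [func]

/-- Shifting the resolvent multiplies its transform by an exponential, so the functional acts on
exponentials. Unlike the left side, the right side makes sense for all `Re z ≥ 0`, which supplies
the continuations. -/
lemma lt_tfun (hs : 0 ≤ s) [IsFiniteMeasure m] (hm : ∀ᵐ t ∂m, 0 ≤ t) {z : ℂ}
    (hz : p.c s < z.re) : (p.k z - s) * lt (fun u => (tfun p s A κ m u : ℂ)) z =
      func A κ m fun t => Complex.exp (t * z) := by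
  have hw := (finite_isWeight hm).mono (p.c_nonneg hs)
  have hR := R_isOrig (p := p) hs
  have hk := p.k_sub_ne_zero hs hz
  simp only [tfun_eq_cv]
  rw [lt_sub (hR.smul _) ((hR.cv hw).smul _) hz, lt_smul, lt_smul, lt_cv hR hw hz, lt_R hs hz,
    func_exp]
  simp only [mul_one]
  field_simp
  simp only [mul_comm z]

lemma func_exp_continuousOn [IsFiniteMeasure m] (hm : ∀ᵐ t ∂m, 0 ≤ t) :
    ContinuousOn (fun z => func A κ m fun t => Complex.exp (t * z)) {z | 0 ≤ z.re} := by
  simp only [func_exp]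
  refine continuousOn_const.sub (continuousOn_const.mul fun z hz => ?_)
  refine continuousWithinAt_of_dominated (bound := fun _ => 1) ?_ ?_ (integrable_const _) ?_
  · exact Eventually.of_forall fun w => by fun_prop
  · filter_upwards [self_mem_nhdsWithin] with w hw
    have hw' : 0 ≤ w.re := hw
    filter_upwards [hm] with t ht
    rw [norm_cexp_neg_mul, Real.exp_le_one_iff]
    nlinarith
  · refine Eventually.of_forall fun x => ?_
    fun_prop

lemma func_exp_differentiableOn [IsFiniteMeasure m] (hm : ∀ᵐ t ∂m, 0 ≤ t) :
    DifferentiableOn ℂ (fun z => func A κ m fun t => Complex.exp (t * z)) {z | 0 < z.re} := by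
  simp only [func_exp]
  have h1 : DifferentiableOn ℂ (complexMGF (fun t : ℝ => -t) m) {z | 0 < z.re} := by
    refine differentiableOn_complexMGF.mono fun z hz => ?_
    have hsub : Ioi (0 : ℝ) ⊆ integrableExpSet (fun t : ℝ => -t) m := by
      intro θ hθ
      rw [mem_Ioi] at hθ
      refine Integrable.of_bound (C := 1) (by fun_prop) ?_
      filter_upwards [hm] with t ht
      rw [Real.norm_of_nonneg (Real.exp_pos _).le, Real.exp_le_one_iff]
      nlinarith
    exact interior_mono hsub (by rw [isOpen_Ioi.interior_eq]; exact hz)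
  have h2 : (fun z : ℂ => (A : ℂ) - κ * ∫ t : ℝ, Complex.exp (-(t * z)) ∂m) =
      fun z => (A : ℂ) - κ * complexMGF (fun t : ℝ => -t) m z := by
    ext z
    rw [complexMGF]
    congr 3
    ext t
    congr 1
    push_cast
    ring
  rw [h2]
  exact (differentiableOn_const _).sub ((differentiableOn_const _).mul h1)

/-- For `y ≤ 0` the shifted resolvent vanishes until `u = -y`, so the integral up to `d + y` becomes
one over the fixed interval `[0, d]`. In this form a functional in `y` can be taken under the
integral. -/
lemma C_shift (hs : 0 ≤ s) {d : ℝ} (hd : 0 ≤ d) {y : ℝ} (hy : y ≤ 0) (z : ℂ) :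
    C p (d + y) z s = Complex.exp (z * d) * (Complex.exp (y * z) -
      (p.k z - s) * ∫ u in (0 : ℝ)..d, Complex.exp (-(u * z)) * R p s (u + y)) := by
  have hI : ∀ e, 0 ≤ e → e + y ≤ 0 →
      ∫ u in (0 : ℝ)..e, Complex.exp (-(u * z)) * R p s (u + y) = 0 := by
    intro e he hey
    have hne : ∀ᵐ u : ℝ, u ≠ e := by simp [ae_iff]
    refine intervalIntegral.integral_zero_ae ?_
    filter_upwards [hne] with u hue hu
    rw [uIoc_of_le he] at hu
    have : u < e := lt_of_le_of_ne hu.2 hue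
    rw [R_neg hs (by linarith)]
    simp
  rcases lt_or_ge (d + y) 0 with h | h
  · rw [C_of_neg h, hI d hd h.le, mul_zero, sub_zero, ← Complex.exp_add]
    congr 1
    push_cast
    ring
  · rw [C_of_nonneg h]
    have hint : ∀ a b, IntervalIntegrable (fun u : ℝ => Complex.exp (-(u * z)) * R p s (u + y))
        volume a b := by
      intro a b
      have h1 : IntervalIntegrable (fun u => (R p s (u + y) : ℂ)) volume a b := by
        have := ((R_mono (p := p) hs).comp (fun u v (h : u ≤ v) =>
          add_le_add_left h y)).intervalIntegrable (μ := volume) (a := a) (b := b)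
        exact ⟨this.1.ofReal, this.2.ofReal⟩
      exact h1.continuousOn_mul (by fun_prop)
    have h1 := intervalIntegral.integral_add_adjacent_intervals (hint 0 (-y)) (hint (-y) d)
    rw [hI (-y) (by linarith) (by linarith), zero_add] at h1
    have h2 : ∫ u in (-y)..d, Complex.exp (-(u * z)) * R p s (u + y) =
        Complex.exp (y * z) * ∫ u in (0 : ℝ)..(d + y), Complex.exp (-(u * z)) * R p s u := by
      have := intervalIntegral.integral_comp_add_right (a := -y) (b := d)
        (fun v : ℝ => Complex.exp (-((v - y : ℝ) * z)) * (R p s v : ℂ)) y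
      simp only [neg_add_cancel] at this
      rw [← intervalIntegral.integral_const_mul]
      convert this using 1
      · congr 1
        ext u
        simp
      · congr 1
        ext u
        rw [← mul_assoc, ← Complex.exp_add]
        congr 2
        push_cast
        ring
    rw [← h1, h2]
    have : Complex.exp (z * (d + y : ℝ)) = Complex.exp (z * d) * Complex.exp (y * z) := by
      rw [← Complex.exp_add]
      congr 1
      push_cast
      ring
    rw [this]
    ring

/-- Fubini's theorem applied to `C_shift`. It produces the truncated transforms of `K` and `F` in
the formulas for the overshoot. -/
lemma func_C (hs : 0 ≤ s) [IsFiniteMeasure m] (hm : ∀ᵐ t ∂m, 0 ≤ t) {d : ℝ} (hd : 0 ≤ d) {z : ℂ}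
    (hz : 0 ≤ z.re) : func A κ m (fun y => C p (d + y) z s) = Complex.exp (z * d) *
      (func A κ m (fun t => Complex.exp (t * z)) -
        (p.k z - s) * ∫ u in (0 : ℝ)..d, Complex.exp (-(u * z)) * tfun p s A κ m u) := by
  have hmR := measurable_R (p := p) hs
  have hbd : ∀ u t : ℝ, 0 ≤ t → u ≤ d → 0 ≤ u →
      ‖Complex.exp (-(u * z)) * (R p s (u - t) : ℂ)‖ ≤ R p s d := by
    intro u t ht hu hu0
    rw [norm_mul, norm_cexp_neg_mul, Complex.norm_real, Real.norm_of_nonneg (R_nonneg hs _)]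
    refine (mul_le_of_le_one_left (R_nonneg hs _) ?_).trans (R_mono hs (by linarith))
    rw [Real.exp_le_one_iff]
    nlinarith
  have hint : Integrable (fun q : ℝ × ℝ => Complex.exp (-(q.1 * z)) * (R p s (q.1 - q.2) : ℂ))
      ((volume.restrict (Ioc 0 d)).prod m) := by
    refine Integrable.of_bound (C := R p s d) (by fun_prop) ?_
    have h1 : ∀ᵐ q ∂(volume.restrict (Ioc 0 d)).prod m, q.1 ∈ Ioc 0 d :=
      Measure.quasiMeasurePreserving_fst.ae (ae_restrict_mem measurableSet_Ioc)
    have h2 : ∀ᵐ q ∂(volume.restrict (Ioc 0 d)).prod m, 0 ≤ q.2 :=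
      Measure.quasiMeasurePreserving_snd.ae hm
    filter_upwards [h1, h2] with q hq1 hq2 using hbd _ _ hq2 hq1.2 hq1.1.le
  have hintR : Integrable (fun u : ℝ => Complex.exp (-(u * z)) * (R p s u : ℂ))
      (volume.restrict (Ioc 0 d)) := by
    refine Integrable.of_bound (C := R p s d) (by fun_prop) ?_
    filter_upwards [ae_restrict_mem measurableSet_Ioc] with u hu
    simpa using hbd u 0 le_rfl hu.2 hu.1.le
  have hexpi : Integrable (fun t : ℝ => Complex.exp ((-t : ℝ) * z)) m := by
    refine Integrable.of_bound (C := 1) (by fun_prop) ?_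
    filter_upwards [hm] with t ht
    rw [Complex.norm_exp, Real.exp_le_one_iff]
    simp
    nlinarith
  have h1 : ∫ t, C p (d + -t) z s ∂m = Complex.exp (z * d) *
      ((∫ t : ℝ, Complex.exp ((-t : ℝ) * z) ∂m) - (p.k z - s) *
        ∫ u in (0 : ℝ)..d, Complex.exp (-(u * z)) * ((∫ t, R p s (u - t) ∂m : ℝ) : ℂ)) := by
    have e1 : ∀ᵐ t ∂m, C p (d + -t) z s = Complex.exp (z * d) * (Complex.exp ((-t : ℝ) * z) -
        (p.k z - s) * ∫ u in Ioc 0 d, Complex.exp (-(u * z)) * R p s (u - t)) := by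
      filter_upwards [hm] with t ht
      rw [C_shift hs hd (by linarith), intervalIntegral.integral_of_le hd]
      rfl
    rw [integral_congr_ae e1, integral_const_mul, integral_sub hexpi
      (hint.integral_prod_right.const_mul _), integral_const_mul]
    have := integral_integral_swap
      (f := fun u t => Complex.exp (-((u : ℝ) * z)) * (R p s (u - t) : ℂ)) hint
    rw [← this, intervalIntegral.integral_of_le hd]
    congr 3
    refine integral_congr_ae (Eventually.of_forall fun u => ?_)
    simp only
    rw [integral_const_mul, integral_complex_ofReal]
  have h0 := C_shift (p := p) hs hd (le_refl (0 : ℝ)) z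
  have hi2 : Integrable (fun u : ℝ => Complex.exp (-(u * z)) * ((∫ t, R p s (u - t) ∂m : ℝ) : ℂ))
      (volume.restrict (Ioc 0 d)) := by
    refine hint.integral_prod_left.congr (Eventually.of_forall fun u => ?_)
    simp only
    rw [integral_const_mul, integral_complex_ofReal]
  have h2 : ∫ u in (0 : ℝ)..d, Complex.exp (-(u * z)) * tfun p s A κ m u =
      A * (∫ u in (0 : ℝ)..d, Complex.exp (-(u * z)) * R p s u) -
      κ * ∫ u in (0 : ℝ)..d, Complex.exp (-(u * z)) * ((∫ t, R p s (u - t) ∂m : ℝ) : ℂ) := by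
    rw [intervalIntegral.integral_of_le hd, intervalIntegral.integral_of_le hd,
      intervalIntegral.integral_of_le hd, ← integral_const_mul, ← integral_const_mul,
      ← integral_sub (hintR.const_mul _) (hi2.const_mul _)]
    congr 1
    ext u
    rw [tfun]
    push_cast
    ring
  simp only [add_zero] at h0
  rw [func, func, add_zero, h1, h0, h2]
  simp only [Complex.ofReal_zero, zero_mul, Complex.exp_zero]
  ring

end functional

namespace CompoundPoisson
variable {p : CompoundPoisson} {s : ℝ}

/-! ### Overshoot measures -/

/-- The law of the overshoot over the level `y`, weighted by the resolvent. -/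
def overLaw (p : CompoundPoisson) (s y : ℝ) : Measure ℝ :=
  ((((volume.restrict (Icc 0 y)).withDensity fun v => ENNReal.ofReal (R p s (y - v))).prod
    p.jump).restrict {q | q.1 < q.2}).map fun q => q.2 - q.1

lemma finite_over_aux (hs : 0 ≤ s) (y : ℝ) : IsFiniteMeasure
    ((volume.restrict (Icc 0 y)).withDensity fun v => ENNReal.ofReal (R p s (y - v))) := by
  refine isFiniteMeasure_withDensity_ofReal (Integrable.hasFiniteIntegral ?_)
  have hm := measurable_R (p := p) hs
  refine Integrable.of_bound (C := R p s y) (hm.comp (by fun_prop)).aestronglyMeasurable ?_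
  filter_upwards [ae_restrict_mem measurableSet_Icc] with v hv
  rw [Real.norm_of_nonneg (R_nonneg hs _)]
  exact R_mono hs (by linarith [hv.1])

lemma finite_over (hs : 0 ≤ s) (y : ℝ) : IsFiniteMeasure (p.overLaw s y) := by
  have := finite_over_aux (p := p) hs y
  rw [overLaw]
  infer_instance

lemma ae_over_pos (y : ℝ) : ∀ᵐ t ∂(p.overLaw s y), 0 ≤ t := by
  rw [overLaw, ae_map_iff (by fun_prop) measurableSet_Ici]
  filter_upwards [ae_restrict_mem (measurableSet_lt measurable_fst measurable_snd)] with q hq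
  have : q.1 < q.2 := hq
  linarith

lemma integral_over (hs : 0 ≤ s) {g : ℝ → ℂ} {B : ℝ} (hg : Measurable g)
    (hB : ∀ t < 0, ‖g t‖ ≤ B) (y : ℝ) :
    ∫ t, g (-t) ∂(p.overLaw s y) = cv volume (p.src g) (fun u => (R p s u : ℂ)) y := by
  have hf := finite_over_aux (p := p) hs y
  have hm := measurable_R (p := p) hs
  have hS : MeasurableSet {q : ℝ × ℝ | q.1 < q.2} :=
    measurableSet_lt measurable_fst measurable_snd
  have hB0 : 0 ≤ B := (norm_nonneg _).trans (hB (-1) (by norm_num))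
  rw [overLaw, integral_map (f := fun t => g (-t)) (by fun_prop)
    (hg.comp measurable_neg).aestronglyMeasurable, ← integral_indicator hS, integral_prod]
  · rw [integral_withDensity_eq_integral_toReal_smul (by fun_prop)
      (Eventually.of_forall fun _ => ENNReal.ofReal_lt_top), cv]
    have : ∀ v, v ∉ Icc 0 y → p.src g v * (R p s (y - v) : ℂ) = 0 := by
      intro v hv
      rw [mem_Icc, not_and_or, not_le, not_le] at hv
      rcases hv with hv | hv
      · simp [src, not_le.2 hv]
      · simp [R_neg hs (show y - v < 0 by linarith)]
    rw [← setIntegral_eq_integral_of_forall_compl_eq_zero this]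
    refine setIntegral_congr_fun measurableSet_Icc fun v hv => ?_
    rw [ENNReal.toReal_ofReal (R_nonneg hs _), src, if_pos hv.1, Complex.real_smul, mul_comm]
    congr 2
    ext x
    simp only [indicator, mem_ofPred_eq, neg_sub]
  · refine Integrable.of_bound (C := B) ?_ (Eventually.of_forall fun q => ?_)
    · exact (Measurable.indicator (by fun_prop) hS).aestronglyMeasurable
    · rw [indicator]
      split_ifs with h
      · have : q.1 < q.2 := h
        exact hB _ (by linarith)
      · simpa using hB0

/-- Evaluating the harmonic extension at `y` is a functional of its data on `(-∞, 0]`, with the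
resolvent-weighted overshoot law as measure. -/
lemma func_over (hs : 0 ≤ s) {g : ℝ → ℂ} {B : ℝ} (hg : Measurable g)
    (hB : ∀ t < 0, ‖g t‖ ≤ B) (y : ℝ) :
    func (p.a * R p s y) p.lam (p.overLaw s y) g = p.vol s (p.src g) (g 0) y := by
  rw [func, integral_over hs hg hB y, vol]
  push_cast
  ring

lemma func_over_exp (hs : 0 ≤ s) {z : ℂ} (hz : 0 ≤ z.re) {y : ℝ} (hy : 0 ≤ y) :
    func (p.a * R p s y) p.lam (p.overLaw s y) (fun t => Complex.exp (t * z)) = C p y z s := by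
  rw [func_over hs (B := 1) (by fun_prop) _ y, C_eq hs hz hy, vol, psi]
  · simp
  · intro t ht
    rw [Complex.norm_exp, Real.exp_le_one_iff]
    simp
    nlinarith

lemma func_lad_exp (hs : 0 ≤ s) (z : ℂ) :
    func p.a p.a (p.lad s) (fun t => Complex.exp (t * z)) =
      p.a - p.lam * lt (p.psi (p.c s)) z := by
  have ha : (p.a : ℂ) ≠ 0 := by exact_mod_cast p.a_pos.ne'
  rw [func_exp, integral_exp_lad hs]
  field_simp

/-- The ladder functional is a boundary value of the transform of the source. -/
lemma integral_lad (hs : 0 < s) {g : ℝ → ℂ} {B : ℝ} (hg : Measurable g)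
    (hB : ∀ t ≤ 0, ‖g t‖ ≤ B) :
    p.a * ∫ t, g (-t) ∂(p.lad s) = p.lam * lt (p.src g) (p.c s) := by
  have hc := p.c_pos hs
  have ha : (p.a : ℂ) ≠ 0 := by exact_mod_cast p.a_pos.ne'
  have hm := p.measurable_h hc.le
  have hB0 : 0 ≤ B := (norm_nonneg _).trans (hB 0 le_rfl)
  set c : ℂ := (p.c s : ℂ)
  have hcre : 0 < c.re := by simpa [c] using hc
  have h1 : Integrable (fun q : ℝ × ℝ => window c 0 q * (if 0 ≤ q.1 then g (-q.1) else 0))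
      (volume.prod p.jump) := by
    refine (p.integrable_window (z := c) (w := 0) hcre.le (by simp) (Or.inl hcre)).mul_bdd
      (c := B) ?_ (Eventually.of_forall fun q => ?_)
    · exact (Measurable.ite (measurableSet_le measurable_const measurable_fst) (by fun_prop)
        measurable_const).aestronglyMeasurable
    · split_ifs with h
      · exact hB _ (by linarith)
      · simpa using hB0
  have h2 : Integrable (fun q : ℝ × ℝ => window 0 c q * (if q.1 < q.2 then g (q.1 - q.2) else 0))
      (volume.prod p.jump) := by
    refine (p.integrable_window (z := 0) (w := c) (by simp) hcre.le (Or.inr hcre)).mul_bdd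
      (c := B) ?_ (Eventually.of_forall fun q => ?_)
    · exact (Measurable.ite (measurableSet_lt measurable_fst measurable_snd) (by fun_prop)
        measurable_const).aestronglyMeasurable
    · split_ifs with h
      · exact hB _ (by linarith)
      · simpa using hB0
  have e1 : ∫ t, g (-t) ∂(p.lad s) = p.lam / p.a *
      ∫ t, ∫ x, window c 0 (t, x) * (if 0 ≤ t then g (-t) else 0) ∂p.jump := by
    rw [lad, integral_withDensity_eq_integral_toReal_smul (by fun_prop)
      (Eventually.of_forall fun _ => ENNReal.ofReal_lt_top), ← integral_const_mul]
    congr 1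
    ext t
    rw [ENNReal.toReal_ofReal (mul_nonneg (div_pos p.lam_pos p.a_pos).le (p.h_nonneg _ _)),
      Complex.real_smul, integral_mul_const]
    push_cast
    rw [← psi_ofReal, psi, src, mul_assoc]
    congr 1
    split_ifs with h
    · congr 2
      ext x
      simp [window, h, c]
    · simp
  have e2 : lt (p.src g) c =
      ∫ v, ∫ x, window 0 c (v, x) * (if v < x then g (v - x) else 0) ∂p.jump := by
    rw [lt]
    congr 1
    ext v
    rw [src]
    split_ifs with h
    · rw [← integral_const_mul]
      congr 1
      ext x
      simp only [window, h, true_and]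
      split_ifs <;> simp
    · simp [window, h]
  rw [e1, e2, integral_integral_swap
      (f := fun t x => window c 0 (t, x) * if 0 ≤ t then g (-t) else 0) h1,
    integral_integral_swap
      (f := fun v x => window 0 c (v, x) * if v < x then g (v - x) else 0) h2, ← mul_assoc,
    mul_div_cancel₀ _ ha]
  congr 2
  ext x
  -- The reflection `v ↦ x - v` for a fixed jump size `x` turns the ladder kernel into the kernel of
  -- the transform at `c`; the two agree off the endpoints.
  rw [← integral_sub_left_eq_self _ volume x]
  refine integral_congr_ae ?_
  have n1 : ∀ᵐ v : ℝ, v ≠ 0 := by simp [ae_iff]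
  have n2 : ∀ᵐ v : ℝ, v ≠ x := by simp [ae_iff]
  filter_upwards [n1, n2] with v hv hvx
  simp only [window, neg_sub, sub_nonneg, mul_zero, neg_zero, Complex.exp_zero, one_mul, mul_one]
  by_cases h : 0 ≤ v ∧ v < x
  · have h' : 0 < v := lt_of_le_of_ne h.1 hv.symm
    rw [if_pos ⟨h.2.le, by linarith⟩, if_pos h.2.le, if_pos h, if_pos h.2]
    congr 2
    push_cast
    ring
  · have h' : ¬ (v ≤ x ∧ x - v < x) := by
      rintro ⟨h1, h2⟩
      exact h ⟨by linarith, lt_of_le_of_ne h1 hvx⟩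
    rw [if_neg h', if_neg h, zero_mul, zero_mul]

/-! ### Harmonic extensions -/

/-- The extension of a function on `(-∞, 0]` that is harmonic on `[0, ∞)`. -/
def ext (p : CompoundPoisson) (s : ℝ) (g : ℝ → ℂ) (y : ℝ) : ℂ :=
  if y < 0 then g y else p.vol s (p.src g) (g 0) y

lemma src_congr {f g : ℝ → ℂ} (h : ∀ t < 0, f t = g t) : p.src f = p.src g := by
  ext v
  rw [src, src]
  congr 2
  ext x
  split_ifs with hx
  · exact h _ (by linarith)
  · rfl

lemma vol_zero (hs : 0 ≤ s) {ψ : ℝ → ℂ} (hψ : IsOrig 0 ψ) (g₀ : ℂ) : p.vol s ψ g₀ 0 = g₀ := by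
  have := R_zero (p := p) hs
  rw [vol, cv_volume_zero (R_isOrig hs).zero hψ.zero, mul_right_comm]
  have h2 : (p.a : ℂ) * R p s 0 = 1 := by exact_mod_cast this
  rw [h2]
  ring

lemma ext_isHarmonic (hs : 0 ≤ s) {g : ℝ → ℂ} {B : ℝ} (hg : Measurable g)
    (hB : ∀ t < 0, ‖g t‖ ≤ B) (hrc : ∀ t < 0, ContinuousWithinAt g (Ici t) t) :
    IsHarmonic p s B (p.ext s g) ∧ p.ext s g 0 = g 0 ∧ p.src (p.ext s g) = p.src g := by
  have hψ := (src_isOrig (p := p) hg hB hrc).1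
  have h0 : p.ext s g 0 = g 0 := by
    rw [ext, if_neg (lt_irrefl _), vol_zero hs hψ]
  have hsrc : p.src (p.ext s g) = p.src g := src_congr fun t ht => by rw [ext, if_pos ht]
  refine ⟨⟨?_, fun t ht => ?_, fun t ht => ?_, fun y hy => ?_⟩, h0, hsrc⟩
  · exact Measurable.ite measurableSet_Iio hg (vol_isOrig hs hψ _).meas
  · rw [ext, if_pos ht]; exact hB t ht
  · refine (hrc t ht).congr_of_eventuallyEq ?_ (by rw [ext, if_pos ht])
    filter_upwards [mem_nhdsWithin_of_mem_nhds (Iio_mem_nhds ht)] with w hw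
    rw [ext, if_pos (mem_Iio.1 hw)]
  · rw [hsrc, h0, ext, if_neg (not_lt.2 hy)]

lemma IsHarmonic.rc_all {B : ℝ} {f : ℝ → ℂ} (hs : 0 ≤ s) (hf : IsHarmonic p s B f) (t : ℝ) :
    ContinuousWithinAt f (Ici t) t := by
  rcases lt_or_ge t 0 with h | h
  · exact hf.rc t h
  · exact ((vol_isOrig (p := p) hs hf.src_isOrig.1 (f 0)).rc t).congr
      (fun u hu => hf.eq u (h.trans hu)) (hf.eq t h)

/-- The resolvent is harmonic with vanishing data on `(-∞, 0)`, so a multiple of it can be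
subtracted without changing the exponential data there. This is the free constant in the upward
problem. -/
lemma C_sub_isHarmonic (hs : 0 ≤ s) {z : ℂ} (hz : 0 ≤ z.re) (κ : ℂ) :
    IsHarmonic p s 1 fun y => C p y z s - κ * R p s y := by
  have hneg : ∀ t < 0, C p t z s - κ * R p s t = Complex.exp (t * z) := by
    intro t ht
    rw [C_of_neg ht, R_neg hs ht, mul_comm]
    simp
  have hsrc : p.src (fun y => C p y z s - κ * R p s y) = p.psi z := src_congr hneg
  have hpos : ∀ y, 0 ≤ y → C p y z s - κ * R p s y =
      p.vol s (p.psi z) (C p 0 z s - κ * R p s 0) y := by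
    intro y hy
    have h1 : (p.a : ℂ) * R p s 0 = 1 := by exact_mod_cast R_zero (p := p) hs
    rw [C_eq hs hz hy, C_zero, vol]
    linear_combination κ * (R p s y : ℂ) * h1
  refine ⟨?_, fun t ht => ?_, fun t ht => ?_, fun y hy => ?_⟩
  · have : (fun y => C p y z s - κ * R p s y) = fun y : ℝ => if y < 0 then Complex.exp (y * z) else
        p.vol s (p.psi z) (C p 0 z s - κ * R p s 0) y := by
      ext y
      split_ifs with h
      · exact hneg y h
      · exact hpos y (not_lt.1 h)
    rw [this]
    exact Measurable.ite measurableSet_Iio (by fun_prop)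
      (vol_isOrig hs (psi_isOrig hz).1 _).meas
  · rw [hneg t ht, Complex.norm_exp, Real.exp_le_one_iff]
    simp
    nlinarith
  · have : ContinuousWithinAt (fun t : ℝ => Complex.exp (t * z)) (Ici t) t := by fun_prop
    refine this.congr_of_eventuallyEq ?_ (hneg t ht)
    filter_upwards [mem_nhdsWithin_of_mem_nhds (Iio_mem_nhds ht)] with w hw using hneg w hw
  · rw [hsrc]
    exact hpos y hy

end CompoundPoisson
end Oscillating
end

noncomputable section
namespace Oscillating
open CompoundPoisson

/-! ### The functions `K` and `F` -/

section shift
variable {p : CompoundPoisson} {s : ℝ}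

/-- Split the transform of the resolvent at `x`: the part over `[0, x]` is the one subtracted in the
definition of `C`. -/
lemma laplace_shift (hs : 0 ≤ s) (x : ℝ) {z : ℂ} (hz : p.c s < z.re) :
    (p.k z - s) * laplace (fun u => R p s (x + u)) z = C p x z s := by
  have hk := p.k_sub_ne_zero hs hz
  have h1 : laplace (fun u => R p s (x + u)) z =
      Complex.exp (z * x) * ∫ v in Ioi x, Complex.exp (-(v * z)) * R p s v := by
    have e := (measurePreserving_add_left volume x).setIntegral_preimage_emb
      (measurableEmbedding_addLeft x)
      (fun v : ℝ => Complex.exp (-((v - x : ℝ) * z)) * (R p s v : ℂ)) (Ioi x)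
    have hpre : (fun u => x + u) ⁻¹' Ioi x = Ioi 0 := by ext; simp
    rw [hpre] at e
    rw [laplace, ← integral_const_mul]
    simp only [add_sub_cancel_left] at e
    rw [e]
    congr 1
    ext v
    rw [← mul_assoc, ← Complex.exp_add]
    congr 2
    push_cast
    ring
  have hint := (R_isOrig (p := p) hs).int z hz
  have hlt : ∫ v : ℝ, Complex.exp (-(v * z)) * (R p s v : ℂ) = (p.k z - s)⁻¹ := lt_R hs hz
  have hsplit := integral_add_compl (measurableSet_Ioi (a := x)) hint
  rw [hlt, compl_Ioi] at hsplit
  rw [h1]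
  rcases lt_or_ge x 0 with hx | hx
  · have h0 : ∫ v in Iic x, Complex.exp (-(v * z)) * (R p s v : ℂ) = 0 := by
      refine setIntegral_eq_zero_of_forall_eq_zero fun v hv => ?_
      rw [R_neg hs (lt_of_le_of_lt hv hx)]
      simp
    rw [h0, add_zero] at hsplit
    rw [hsplit, C_of_neg hx]
    field_simp
  · have h0 : ∫ v in Iic x, Complex.exp (-(v * z)) * (R p s v : ℂ) =
        ∫ v in (0 : ℝ)..x, Complex.exp (-(v * z)) * (R p s v : ℂ) := by
      rw [intervalIntegral.integral_of_le hx, ← integral_Icc_eq_integral_Ioc]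
      refine (setIntegral_eq_of_subset_of_forall_sdiff_eq_zero measurableSet_Iic
        (fun v (hv : v ∈ Icc 0 x) => hv.2) fun v hv => ?_)
      have : v < 0 := by
        by_contra! h
        exact hv.2 ⟨h, hv.1⟩
      rw [R_neg hs this]
      simp
    rw [h0] at hsplit
    rw [C_of_nonneg hx, eq_sub_of_add_eq hsplit]
    field_simp

lemma shift_isOrig (hs : 0 ≤ s) {x : ℝ} (hx : x ≤ 0) :
    IsOrig (p.c s) (fun u => (R p s (x + u) : ℂ)) where
  meas := (R_isOrig hs).meas.comp (by fun_prop)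
  zero u hu := (R_isOrig hs).zero _ (by linarith)
  rc u := by
    refine ((R_isOrig (p := p) hs).rc (x + u)).comp (f := fun v => x + v) (by fun_prop) ?_
    intro v hv
    simp only [mem_Ici] at hv ⊢
    linarith
  bdd U := by
    obtain ⟨B, hB⟩ := (R_isOrig (p := p) hs).bdd (x + U)
    exact ⟨B, fun u hu => hB _ (by linarith)⟩
  int z hz := by
    have h1 := (((R_isOrig (p := p) hs).int z hz).comp_add_left x).const_mul (Complex.exp (x * z))
    refine h1.congr (Eventually.of_forall fun u => ?_)
    dsimp only
    rw [← mul_assoc, ← Complex.exp_add]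
    congr 2
    push_cast
    ring

end shift

variable {p : Fin 2 → CompoundPoisson} {s : ℝ}

/-- The function `K_x^s`. -/
def Kfun (p : Fin 2 → CompoundPoisson) (s x : ℝ) : ℝ → ℝ :=
  if x < 0 then fun u => R (p 1) s (x + u)
  else tfun (p 1) s ((p 0).a * R (p 0) s x) (p 0).lam ((p 0).overLaw s x)

lemma Kfun_isOrig (hs : 0 ≤ s) (x : ℝ) : IsOrig ((p 1).c s) fun u => (Kfun p s x u : ℂ) := by
  have := finite_over (p := p 0) hs x
  by_cases hx : x < 0
  · simp only [Kfun, hx, if_true]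
    exact shift_isOrig hs hx.le
  · simp only [Kfun, hx, if_false]
    exact tfun_isOrig hs (ae_over_pos x)

/-- The numerator in the definition of `K` is `C₁^x(z, s)` by `laplace_shift`, and this is a
functional of `e^{tz}`. Hence the transform converges for `Re z > c₂(s)`, whatever `c₁(s)` is. -/
lemma lt_Kfun (hs : 0 ≤ s) (x : ℝ) {z : ℂ} (hz : (p 1).c s < z.re) :
    ((p 1).k z - s) * lt (fun u => (Kfun p s x u : ℂ)) z = C (p 0) x z s := by
  have := finite_over (p := p 0) hs x
  have hz0 : 0 ≤ z.re := ((p 1).c_nonneg hs).trans hz.le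
  by_cases hx : x < 0
  · simp only [Kfun, hx, if_true]
    rw [← laplace_eq_lt fun u hu => R_neg hs (by linarith), laplace_shift hs x hz, C_of_neg hx,
      C_of_neg hx]
  · simp only [Kfun, hx, if_false]
    rw [lt_tfun hs (ae_over_pos x) hz, func_over_exp hs hz0 (not_lt.1 hx)]

lemma Kfun_isK (hs : 0 ≤ s) (x : ℝ) : IsK p s x (Kfun p s x) := by
  refine (Kfun_isOrig hs x).isOriginal (fun z hz => (le_max_right _ _).trans_lt hz) fun z hz => ?_
  have h1 : (p 1).c s < z.re := (le_max_right _ _).trans_lt hz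
  have hk := (p 1).k_sub_ne_zero hs h1
  rw [KTransform, div_mul_eq_mul_div, laplace_shift hs x ((le_max_left _ _).trans_lt hz),
    ← lt_Kfun hs x h1]
  field_simp

lemma K_eq (hs : 0 ≤ s) (x : ℝ) : K p s x = Kfun p s x :=
  (Kfun_isK hs x).original_eq (θ := max ((p 0).c s) ((p 1).c s)) fun _ hz => hz

lemma K_isOrig (hs : 0 ≤ s) (x : ℝ) : IsOrig ((p 1).c s) fun u => (K p s x u : ℂ) := by
  rw [K_eq hs]
  exact Kfun_isOrig hs x

lemma laplace_K (hs : 0 ≤ s) (x : ℝ) {z : ℂ} (hz : (p 1).c s < z.re) :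
    ((p 1).k z - s) * laplace (K p s x) z = C (p 0) x z s := by
  rw [laplace_eq_lt fun u hu => by exact_mod_cast (K_isOrig (p := p) hs x).zero u hu, K_eq hs,
    lt_Kfun hs x hz]

lemma K_of_neg (hs : 0 ≤ s) {x : ℝ} (hx : x < 0) (u : ℝ) : K p s x u = R (p 1) s (x + u) := by
  rw [K_eq hs, Kfun, if_pos hx]

lemma K_of_nonneg (hs : 0 ≤ s) {x : ℝ} (hx : 0 ≤ x) (u : ℝ) : K p s x u =
    tfun (p 1) s ((p 0).a * R (p 0) s x) (p 0).lam ((p 0).overLaw s x) u := by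
  rw [K_eq hs, Kfun, if_neg (not_lt.2 hx)]

/-- The function `F_s`. -/
def Ffun (p : Fin 2 → CompoundPoisson) (s : ℝ) : ℝ → ℝ :=
  tfun (p 1) s (p 0).a (p 0).a ((p 0).lad s)

lemma Ffun_isOrig (hs : 0 ≤ s) : IsOrig ((p 1).c s) fun u => (Ffun p s u : ℂ) := by
  have := finite_lad (p := p 0) hs
  exact tfun_isOrig hs (ae_lad_nonneg hs)

/-- The extension of `(k₂(z) - s) 𝔽_s(z)` to `Re z ≥ 0`. -/
def Hfun (p : Fin 2 → CompoundPoisson) (s : ℝ) (z : ℂ) : ℂ :=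
  func (p 0).a (p 0).a ((p 0).lad s) fun t => Complex.exp (t * z)

lemma Hfun_eq (hs : 0 ≤ s) (z : ℂ) :
    Hfun p s z = (p 0).a - (p 0).lam * lt ((p 0).psi ((p 0).c s)) z := by
  rw [Hfun, func_lad_exp hs]

lemma lt_Ffun (hs : 0 ≤ s) {z : ℂ} (hz : (p 1).c s < z.re) :
    ((p 1).k z - s) * lt (fun u => (Ffun p s u : ℂ)) z = Hfun p s z := by
  have := finite_lad (p := p 0) hs
  exact lt_tfun hs (ae_lad_nonneg hs) hz

lemma F_domain {z : ℂ} (hz : max ((p 0).c s) ((p 1).c s) < z.re) :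
    z ∈ {z : ℂ | (p 1).c s < z.re ∧ z ≠ ((p 0).c s : ℂ)} := by
  refine ⟨(le_max_right _ _).trans_lt hz, fun h => ?_⟩
  rw [h, Complex.ofReal_re] at hz
  exact absurd hz (not_lt.2 (le_max_left _ _))

/-- The factorization of `k₁ - s` cancels `z - c₁(s)` and leaves the ladder functional of the
exponential, divided by `k₂ - s`. -/
lemma Ffun_isF (hs : 0 ≤ s) : IsF p s (Ffun p s) := by
  refine (Ffun_isOrig hs).isOriginal (fun z hz => hz.1) fun z hz => ?_
  have hk := (p 1).k_sub_ne_zero hs hz.1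
  have h0 : 0 < z.re := ((p 1).c_nonneg hs).trans_lt hz.1
  have h1 := lt_Ffun (p := p) hs hz.1
  have h2 := (p 0).k_sub hs h0.le (Or.inr h0)
  rw [← Hfun_eq hs] at h2
  have h3 : z - (p 0).c s ≠ 0 := sub_ne_zero.2 hz.2
  rw [FTransform, h2, ← h1]
  field_simp

lemma F_eq (hs : 0 ≤ s) : F p s = Ffun p s :=
  (Ffun_isF hs).original_eq (θ := max ((p 0).c s) ((p 1).c s)) fun _ hz => F_domain hz

lemma F_isOrig (hs : 0 ≤ s) : IsOrig ((p 1).c s) fun u => (F p s u : ℂ) := by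
  rw [F_eq hs]
  exact Ffun_isOrig hs

lemma laplace_F (hs : 0 ≤ s) {z : ℂ} (hz : (p 1).c s < z.re) :
    ((p 1).k z - s) * laplace (F p s) z = Hfun p s z := by
  rw [laplace_eq_lt fun u hu => by exact_mod_cast (F_isOrig (p := p) hs).zero u hu, F_eq hs,
    lt_Ffun hs hz]

lemma Hfun_isContinuation (hs : 0 ≤ s) : IsContinuation ((p 1).c s)
    (fun z => ((p 1).k z - s) * laplace (F p s) z) (Hfun p s) := by
  have := finite_lad (p := p 0) hs
  exact ⟨func_exp_continuousOn (ae_lad_nonneg hs), func_exp_differentiableOn (ae_lad_nonneg hs),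
    fun z hz => (laplace_F hs hz).symm⟩

/-- For `y ≥ 0` regularity up to the boundary comes from the integral over the finite overshoot law.
-/
lemma C_isContinuation (hs : 0 ≤ s) (y : ℝ) : IsContinuation (max ((p 0).c s) ((p 1).c s))
    (fun z => ((p 1).k z - s) * laplace (K p s y) z) (fun z => C (p 0) y z s) := by
  have hlast : ∀ z : ℂ, max ((p 0).c s) ((p 1).c s) < z.re →
      C (p 0) y z s = ((p 1).k z - s) * laplace (K p s y) z := fun z hz =>
    (laplace_K hs y ((le_max_right _ _).trans_lt hz)).symm
  rcases lt_or_ge y 0 with hy | hy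
  · refine ⟨?_, ?_, hlast⟩
    · simp only [C_of_neg hy]
      fun_prop
    · simp only [C_of_neg hy]
      fun_prop
  · have := finite_over (p := p 0) hs y
    refine ⟨?_, ?_, hlast⟩
    · exact (func_exp_continuousOn (ae_over_pos y)).congr fun z hz =>
        (func_over_exp hs hz hy).symm
    · exact (func_exp_differentiableOn (ae_over_pos y)).congr fun z hz =>
        (func_over_exp hs (le_of_lt hz) hy).symm

lemma lad_real_univ {p : CompoundPoisson} (hs : 0 ≤ s) : p.a * (p.lad s).real univ = p.a - p.q s := by
  have hf := finite_lad (p := p) hs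
  have h1 := func_lad_exp (p := p) hs 0
  rw [← q_eq_lt, func_exp] at h1
  simp only [mul_zero, neg_zero, Complex.exp_zero, integral_const,
    Complex.real_smul, mul_one] at h1
  have h2 : (p.a - p.a * (p.lad s).real univ : ℝ) = p.q s := by exact_mod_cast h1
  linarith

/-- The mass of the ladder law is `1 - q/a`, so `F(d) = q R₂(d) + a ∫ (R₂(d) - R₂(d - t)) lad(dt)`.
If `q = 0`, the ladder law has mass one and does not charge `0`, and strict monotonicity of `R₂`
makes the integral positive. -/
lemma F_pos (hs : 0 ≤ s) {d : ℝ} (hd : 0 ≤ d) : 0 < F p s d := by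
  have hf := finite_lad (p := p 0) hs
  have hm := measurable_R (p := p 1) hs
  have ha := (p 0).a_pos
  have hmass := lad_real_univ (p := p 0) hs
  have hq := (p 0).q_nonneg hs
  have hRd := R_pos (p := p 1) hs hd
  rw [F_eq hs, Ffun, tfun]
  have hint : Integrable (fun t => R (p 1) s (d - t)) ((p 0).lad s) := by
    refine Integrable.of_bound (C := R (p 1) s d)
      (hm.comp (measurable_const.sub measurable_id)).aestronglyMeasurable ?_
    filter_upwards [ae_lad_nonneg hs] with t ht
    rw [Real.norm_of_nonneg (R_nonneg hs _)]
    exact R_mono hs (by linarith)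
  have hsub : ∫ t, (R (p 1) s d - R (p 1) s (d - t)) ∂((p 0).lad s) =
      ((p 0).lad s).real univ * R (p 1) s d - ∫ t, R (p 1) s (d - t) ∂((p 0).lad s) := by
    rw [integral_sub (integrable_const _) hint, integral_const, smul_eq_mul]
  have hnn : 0 ≤ᵐ[(p 0).lad s] fun t => R (p 1) s d - R (p 1) s (d - t) := by
    filter_upwards [ae_lad_nonneg hs] with t ht
    exact sub_nonneg.2 (R_mono hs (by linarith))
  have hge := integral_nonneg_of_ae hnn
  have key : (p 0).a * R (p 1) s d - (p 0).a * ∫ t, R (p 1) s (d - t) ∂((p 0).lad s) =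
      (p 0).q s * R (p 1) s d +
        (p 0).a * ∫ t, (R (p 1) s d - R (p 1) s (d - t)) ∂((p 0).lad s) := by
    rw [hsub]
    linear_combination (-R (p 1) s d) * hmass
  rw [key]
  rcases hq.eq_or_lt with h0 | h0
  swap
  · have := mul_pos h0 hRd
    have := mul_nonneg ha.le hge
    linarith
  rw [← h0, zero_mul, zero_add]
  refine mul_pos ha (lt_of_le_of_ne hge fun h => ?_)
  rw [eq_comm, integral_eq_zero_iff_of_nonneg_ae hnn ((integrable_const _).sub hint)] at h
  have hpos : ∀ᵐ t ∂((p 0).lad s), t ≠ 0 := by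
    have h1 : (p 0).lad s ≪ volume := withDensity_absolutelyContinuous _ _
    have h2 : ∀ᵐ t : ℝ, t ≠ 0 := by simp [ae_iff]
    exact h1.ae_le h2
  have hfalse : ∀ᵐ t ∂((p 0).lad s), False := by
    filter_upwards [h, hpos, ae_lad_nonneg hs] with t ht ht0 htn
    have : R (p 1) s (d - t) < R (p 1) s d :=
      R_lt hs hd (by have := lt_of_le_of_ne htn ht0.symm; linarith)
    simp only [Pi.zero_apply] at ht
    linarith
  -- A zero integral of an almost everywhere positive function leaves only the null measure, whereas
  -- `a` times the mass is `a > 0` when `q = 0`.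
  have hzero : (p 0).lad s = 0 := by
    rwa [← ae_eq_bot, ← Filter.eventually_false_iff_eq_bot]
  rw [hzero] at hmass
  simp at hmass
  linarith

/-! ### Solutions of the first-passage problems -/

/-- The first-step equations, in the coordinate `y = b - x`: for `y ≥ 0` the first process moves,
for `-d ≤ y ≤ 0` the second one does, until it reaches `0`. -/
structure Solves (p : Fin 2 → CompoundPoisson) (s d : ℝ) (f : ℝ → ℂ) : Prop where
  meas : Measurable f
  lower : ∀ y y₁, 0 ≤ y → y ≤ y₁ →
    f y = Real.exp (-(((p 0).lam + s) / (p 0).a * (y₁ - y))) * f y₁ + (p 0).lam / (p 0).a *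
      ∫ v in y..y₁, Real.exp (-(((p 0).lam + s) / (p 0).a * (v - y))) *
        ∫ x, f (v - x) ∂(p 0).jump
  upper : ∀ y, -d ≤ y → y ≤ 0 →
    f y = Real.exp (-(((p 1).lam + s) / (p 1).a * (0 - y))) * f 0 + (p 1).lam / (p 1).a *
      ∫ v in y..0, Real.exp (-(((p 1).lam + s) / (p 1).a * (v - y))) *
        ∫ x, f (v - x) ∂(p 1).jump

/-- The equation is invariant under translation. Since jumps only decrease `y`, agreement of `f`
with the shifted `g` on `y ≤ 0` is enough. -/
lemma upper_of_isHarmonic {p : CompoundPoisson} (hs : 0 ≤ s) {B d : ℝ} {f g : ℝ → ℂ}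
    (hg : IsHarmonic p s B g)
    (hfg : ∀ y ≤ 0, f y = g (d + y)) {y : ℝ} (hy : -d ≤ y) (hy0 : y ≤ 0) :
    f y = Real.exp (-((p.lam + s) / p.a * (0 - y))) * f 0 + p.lam / p.a *
      ∫ v in y..0, Real.exp (-((p.lam + s) / p.a * (v - y))) * ∫ x, f (v - x) ∂p.jump := by
  have h := hg.first_step hs (y := d + y) (y₁ := d) (by linarith) (by linarith)
  rw [hfg y hy0, hfg 0 le_rfl, h]
  have e1 : d - (d + y) = 0 - y := by ring
  have e2 : ∫ v in (d + y)..d, (Real.exp (-((p.lam + s) / p.a * (v - (d + y)))) : ℂ) *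
      ∫ x, g (v - x) ∂p.jump = ∫ v in y..0,
        (Real.exp (-((p.lam + s) / p.a * (v - y))) : ℂ) * ∫ x, f (v - x) ∂p.jump := by
    have := intervalIntegral.integral_comp_add_left (a := y) (b := 0)
      (fun v => (Real.exp (-((p.lam + s) / p.a * (v - (d + y)))) : ℂ) *
        ∫ x, g (v - x) ∂p.jump) d
    rw [add_zero] at this
    rw [← this]
    refine intervalIntegral.integral_congr fun v hv => ?_
    rw [uIcc_of_le hy0] at hv
    rw [add_sub_add_left_eq_sub]
    congr 1
    refine integral_congr_ae ?_
    filter_upwards [p.ae_jump_pos] with x hx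
    rw [hfg (v - x) (by linarith [hv.2]), add_sub_assoc]
  rw [e1, e2, add_zero]

/-- The first passage downwards: the solution is `y ↦ C₁^y(c₂(s), s)`. -/
lemma down_solves (hs : 0 ≤ s) (d : ℝ) :
    Solves p s d (fun y => C (p 0) y ((p 1).c s) s) := by
  have hc := (p 1).c_nonneg hs
  have h0 := C_sub_isHarmonic (p := p 0) hs (z := (p 1).c s) (by simpa using hc) 0
  have h1 := C_sub_isHarmonic (p := p 1) hs (z := (p 1).c s) (by simpa using hc) 0
  simp only [zero_mul, sub_zero] at h0 h1
  refine ⟨h0.meas, fun y y₁ hy hyy => h0.first_step hs hy hyy, fun y hy hy0 => ?_⟩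
  -- At the root `c₂(s)` the factor `k₂ - s` vanishes, so the second process extends the exponential
  -- by itself.
  have hC1 : ∀ y : ℝ, C (p 1) y ((p 1).c s) s = Complex.exp ((p 1).c s * y) := by
    intro y
    rw [C]
    split_ifs
    · rfl
    · rw [k_c _ hs]; simp
  have hC0 : ∀ y : ℝ, y ≤ 0 → C (p 0) y ((p 1).c s) s = Complex.exp ((p 1).c s * y) := by
    intro y hy
    rcases hy.eq_or_lt with h | h
    · rw [h, C_zero]; simp
    · rw [C_of_neg h]
  have hsc : ∀ y ≤ 0, Complex.exp ((p 1).c s * d) * C (p 0) y ((p 1).c s) s =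
      C (p 1) (d + y) ((p 1).c s) s := by
    intro y hy
    rw [hC0 y hy, hC1, ← Complex.exp_add]
    congr 1
    push_cast
    ring
  have h := upper_of_isHarmonic hs h1 hsc hy hy0
  have hne := Complex.exp_ne_zero ((p 1).c s * d : ℂ)
  apply mul_left_cancel₀ hne
  rw [h]
  simp only [integral_const_mul, mul_left_comm _ (Complex.exp ((p 1).c s * d))]
  rw [intervalIntegral.integral_const_mul]
  ring

/-- If `c₂ ≤ c₁`, then `k₁(c₂) ≤ s` and the second factor of `C` is at least `1`. Otherwise `(k₁(c₂)
- s)` times the full integral of `e^{-c₂u} R₁(u)` equals `1`, and the positive tail beyond `y` makes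
the truncated one smaller. -/
lemma down_pos (hs : 0 ≤ s) {y : ℝ} (hy : 0 ≤ y) : C (p 0) y ((p 1).c s) s ≠ 0 := by
  have hc := (p 1).c_nonneg hs
  rw [C_of_nonneg hy]
  refine mul_ne_zero (Complex.exp_ne_zero _) ?_
  rw [k_ofReal _ hc]
  have e : ∫ u in (0 : ℝ)..y, Complex.exp (-(u * ((p 1).c s : ℂ))) * (R (p 0) s u : ℂ) =
      ((∫ u in (0 : ℝ)..y, Real.exp (-(u * (p 1).c s)) * R (p 0) s u : ℝ) : ℂ) := by
    rw [← intervalIntegral.integral_ofReal]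
    push_cast
    rfl
  rw [e]
  have hnn : 0 ≤ ∫ u in (0 : ℝ)..y, Real.exp (-(u * (p 1).c s)) * R (p 0) s u :=
    intervalIntegral.integral_nonneg hy fun u _ => mul_nonneg (Real.exp_pos _).le (R_nonneg hs _)
  set I := ∫ u in (0 : ℝ)..y, Real.exp (-(u * (p 1).c s)) * R (p 0) s u with hI
  suffices h : 0 < 1 - ((p 0).kR ((p 1).c s) - s) * I by
    have : (1 - ((p 0).kR ((p 1).c s) - s) * I : ℝ) ≠ 0 := h.ne'
    exact_mod_cast this
  rcases le_or_gt ((p 1).c s) ((p 0).c s) with hle | hlt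
  · have := (p 0).kR_le hs hc hle
    nlinarith
  have hk := (p 0).lt_kR hs hlt
  have hint := (R_isOrig (p := p 0) hs).int ((p 1).c s) (by simpa using hlt)
  have hintR : Integrable fun u : ℝ => Real.exp (-(u * (p 1).c s)) * R (p 0) s u := by
    have := hint.re
    refine this.congr (Eventually.of_forall fun u => ?_)
    have : Complex.exp (-(u * ((p 1).c s : ℂ))) * (R (p 0) s u : ℂ) =
      ((Real.exp (-(u * (p 1).c s)) * R (p 0) s u : ℝ) : ℂ) := by push_cast; rfl
    dsimp only
    rw [this]
    exact Complex.ofReal_re _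
  have htot : ((p 0).kR ((p 1).c s) - s) *
      ∫ u : ℝ, Real.exp (-(u * (p 1).c s)) * R (p 0) s u = 1 := by
    have h1 : ∫ u : ℝ, Complex.exp (-(u * ((p 1).c s : ℂ))) * (R (p 0) s u : ℂ) =
        ((p 0).k ((p 1).c s) - s)⁻¹ := lt_R hs (by simpa using hlt)
    have h2 : ∫ u : ℝ, Complex.exp (-(u * ((p 1).c s : ℂ))) * (R (p 0) s u : ℂ) =
        ((∫ u : ℝ, Real.exp (-(u * (p 1).c s)) * R (p 0) s u : ℝ) : ℂ) := by
      rw [← integral_complex_ofReal]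
      push_cast
      rfl
    rw [h2, k_ofReal _ hc, ← Complex.ofReal_sub, ← Complex.ofReal_inv, Complex.ofReal_inj] at h1
    rw [h1]
    exact mul_inv_cancel₀ (by linarith)
  have hrest : 0 < ∫ u in Ioi y, Real.exp (-(u * (p 1).c s)) * R (p 0) s u := by
    rw [setIntegral_pos_iff_support_of_nonneg_ae]
    · have : Ioi y ⊆ Function.support (fun u => Real.exp (-(u * (p 1).c s)) * R (p 0) s u) := by
        intro u hu
        have : 0 < R (p 0) s u := R_pos hs (hy.trans (le_of_lt hu))
        exact (mul_pos (Real.exp_pos _) this).ne'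
      rw [inter_eq_self_of_subset_right this]
      simp
    · exact Eventually.of_forall fun u => mul_nonneg (Real.exp_pos _).le (R_nonneg hs _)
    · exact hintR.integrableOn
  have hle : I + ∫ u in Ioi y, Real.exp (-(u * (p 1).c s)) * R (p 0) s u ≤
      ∫ u : ℝ, Real.exp (-(u * (p 1).c s)) * R (p 0) s u := by
    rw [hI, intervalIntegral.integral_of_le hy, ← setIntegral_union Ioc_disjoint_Ioi_same
      measurableSet_Ioi hintR.integrableOn hintR.integrableOn, Ioc_union_Ioi_eq_Ioi hy]
    exact setIntegral_le_integral hintR (Eventually.of_forall fun u =>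
      mul_nonneg (Real.exp_pos _).le (R_nonneg hs _))
  nlinarith

/-- The coefficient in the solution of the first passage upwards. -/
def upCoef (p : Fin 2 → CompoundPoisson) (s d : ℝ) (z : ℂ) : ℂ :=
  Complex.exp (z * d) * (Hfun p s z - ((p 1).k z - s) * ∫ u in (0 : ℝ)..d,
    Complex.exp (-(u * z)) * F p s u) / F p s d

/-- The solution of the first passage upwards. -/
def upSol (p : Fin 2 → CompoundPoisson) (s d : ℝ) (z : ℂ) (y : ℝ) : ℂ :=
  Complex.exp (z * d) * (C (p 0) y z s - ((p 1).k z - s) * ∫ u in (0 : ℝ)..d,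
    Complex.exp (-(u * z)) * K p s y u) - upCoef p s d z * K p s y d

/-- For `y < 0` this is `C_shift`. For `y ≥ 0` the overshoot functional is applied to the data, term
by term, and `func_C` and `tfun_eq_func` identify the two terms. -/
lemma upSol_eq_ext (hs : 0 ≤ s) {d : ℝ} (hd : 0 ≤ d) {z : ℂ} (hz : 0 ≤ z.re) (y : ℝ) :
    upSol p s d z y = (p 0).ext s
      (fun y => C (p 1) (d + y) z s - upCoef p s d z * R (p 1) s (d + y)) y := by
  set κ := upCoef p s d z
  have hH := C_sub_isHarmonic (p := p 1) hs hz κ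
  rcases lt_or_ge y 0 with hy | hy
  · rw [CompoundPoisson.ext, if_pos hy, upSol, C_of_neg hy, C_shift hs hd hy.le]
    simp only [K_of_neg hs hy]
    simp only [add_comm y, mul_comm z (y : ℂ)]
    rfl
  · obtain ⟨B, hB⟩ := hH.bdd hs d
    have hfin := finite_over (p := p 0) hs y
    have hmR := measurable_R (p := p 1) hs
    have hmeas : Measurable fun y => C (p 1) (d + y) z s - κ * R (p 1) s (d + y) :=
      hH.meas.comp (measurable_const_add d)
    rw [CompoundPoisson.ext, if_neg (not_lt.2 hy), ← func_over hs hmeas (B := B)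
      (fun t ht => hB _ (by linarith)) y]
    have hi1 : Integrable (fun t => C (p 1) (d + -t) z s - κ * R (p 1) s (d + -t))
        ((p 0).overLaw s y) := by
      refine Integrable.of_bound (C := B) (hmeas.comp measurable_neg).aestronglyMeasurable ?_
      filter_upwards [ae_over_pos y] with t ht
      exact hB _ (by linarith)
    have hi2 : Integrable (fun t => (R (p 1) s (d + -t) : ℂ)) ((p 0).overLaw s y) := by
      refine Integrable.of_bound (C := R (p 1) s d)
        (Complex.measurable_ofReal.comp (hmR.comp (by fun_prop))).aestronglyMeasurable ?_
      filter_upwards [ae_over_pos y] with t ht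
      rw [Complex.norm_real, Real.norm_of_nonneg (R_nonneg hs _)]
      exact R_mono hs (by linarith)
    have hi3 : Integrable (fun t => C (p 1) (d + -t) z s) ((p 0).overLaw s y) := by
      refine (hi1.add (hi2.const_mul κ)).congr (Eventually.of_forall fun t => ?_)
      simp
    have hlin : func ((p 0).a * R (p 0) s y) (p 0).lam ((p 0).overLaw s y)
        (fun y => C (p 1) (d + y) z s - κ * R (p 1) s (d + y)) =
        func ((p 0).a * R (p 0) s y) (p 0).lam ((p 0).overLaw s y) (fun y => C (p 1) (d + y) z s) -
        κ * func ((p 0).a * R (p 0) s y) (p 0).lam ((p 0).overLaw s y)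
          (fun y => (R (p 1) s (d + y) : ℂ)) := by
      simp only [func]
      rw [integral_sub hi3 (hi2.const_mul κ), integral_const_mul]
      ring
    rw [hlin, func_C hs (ae_over_pos y) hd hz, func_over_exp hs hz hy, ← tfun_eq_func, upSol]
    simp only [K_of_nonneg hs hy]
    rfl

/-- The equations hold for any value of the constant; the particular value in `upCoef` serves
boundedness. -/
lemma upSol_spec (hs : 0 < s) {d : ℝ} (hd : 0 ≤ d) {z : ℂ} (hz : 0 ≤ z.re) :
    Solves p s d (upSol p s d z) ∧ (∃ B, ∀ y, ‖upSol p s d z y‖ ≤ B) ∧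
      ∀ y, y < -d → upSol p s d z y = Complex.exp (z * (d + y)) := by
  set κ := upCoef p s d z with hκ
  have hH := C_sub_isHarmonic (p := p 1) hs.le hz κ
  obtain ⟨B, hB⟩ := hH.bdd hs.le d
  set g : ℝ → ℂ := fun y => C (p 1) (d + y) z s - κ * R (p 1) s (d + y) with hg
  have hgm : Measurable g := hH.meas.comp (measurable_const_add d)
  have hgB : ∀ t ≤ 0, ‖g t‖ ≤ B := fun t ht => hB _ (by linarith)
  have hgrc : ∀ t < 0, ContinuousWithinAt g (Ici t) t := by
    intro t _
    refine (hH.rc_all hs.le (d + t)).comp (f := fun y => d + y) (by fun_prop) ?_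
    intro v hv
    simp only [mem_Ici] at hv ⊢
    linarith
  obtain ⟨hE, hE0, hEsrc⟩ := ext_isHarmonic (p := p 0) hs.le hgm (fun t ht => hgB t ht.le) hgrc
  have hfg : upSol p s d z = (p 0).ext s g := funext fun y => upSol_eq_ext hs.le hd hz y
  have hle : ∀ y ≤ 0, (p 0).ext s g y = g y := by
    intro y hy
    rcases hy.eq_or_lt with h | h
    · rw [h, hE0]
    · rw [CompoundPoisson.ext, if_pos h]
  rw [hfg]
  refine ⟨⟨hE.meas, fun y y₁ hy hyy => hE.first_step hs.le hy hyy, fun y hy hy0 =>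
    upper_of_isHarmonic hs.le hH hle hy hy0⟩, ?_, ?_⟩
  · refine hE.bounded hs ?_
    rw [hE0, hEsrc, ← integral_lad hs hgm hgB, ← sub_eq_zero]
    have hfin := finite_lad (p := p 0) hs.le
    have hmR := measurable_R (p := p 1) hs.le
    have hi1 : Integrable (fun t => g (-t)) ((p 0).lad s) := by
      refine Integrable.of_bound (C := B) (hgm.comp measurable_neg).aestronglyMeasurable ?_
      filter_upwards [ae_lad_nonneg hs.le] with t ht
      exact hgB _ (by linarith)
    have hi2 : Integrable (fun t => (R (p 1) s (d + -t) : ℂ)) ((p 0).lad s) := by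
      refine Integrable.of_bound (C := R (p 1) s d)
        (Complex.measurable_ofReal.comp (hmR.comp (by fun_prop))).aestronglyMeasurable ?_
      filter_upwards [ae_lad_nonneg hs.le] with t ht
      rw [Complex.norm_real, Real.norm_of_nonneg (R_nonneg hs.le _)]
      exact R_mono hs.le (by linarith)
    have hi3 : Integrable (fun t => C (p 1) (d + -t) z s) ((p 0).lad s) := by
      refine (hi1.add (hi2.const_mul κ)).congr (Eventually.of_forall fun t => ?_)
      simp [hg]
    have hlin : func (p 0).a (p 0).a ((p 0).lad s) g =
        func (p 0).a (p 0).a ((p 0).lad s) (fun y => C (p 1) (d + y) z s) -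
        κ * func (p 0).a (p 0).a ((p 0).lad s) (fun y => (R (p 1) s (d + y) : ℂ)) := by
      simp only [func, hg]
      rw [integral_sub hi3 (hi2.const_mul κ), integral_const_mul]
      ring
    have hFd : (F p s d : ℂ) ≠ 0 := by exact_mod_cast (F_pos hs.le hd).ne'
    change func (p 0).a (p 0).a ((p 0).lad s) g = 0
    -- The ladder functional of the data is the numerator of `upCoef` minus the constant times
    -- `F(d)`, so it vanishes by the choice of the constant.
    rw [hlin, func_C hs.le (ae_lad_nonneg hs.le) hd hz, ← tfun_eq_func, sub_eq_zero]
    have e : ∀ u, tfun (p 1) s (p 0).a (p 0).a ((p 0).lad s) u = F p s u := fun u => by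
      rw [F_eq hs.le, Ffun]
    simp only [e]
    rw [hκ, upCoef, div_mul_cancel₀ _ hFd]
    rfl
  · intro y hy
    rw [hle y (by linarith), hg]
    simp only
    rw [C_of_neg (by linarith), R_neg hs.le (by linarith)]
    simp

end Oscillating
end

noncomputable section
namespace Oscillating
open CompoundPoisson

/-! ### Continuity at `s = 0` -/

lemma eventually_pos_le_one : ∀ᶠ s : ℝ in 𝓝[>] 0, 0 < s ∧ s ≤ 1 := by
  filter_upwards [self_mem_nhdsWithin, mem_nhdsWithin_of_mem_nhds (Iio_mem_nhds one_pos)]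
    with s hs hs1 using ⟨hs, le_of_lt hs1⟩

namespace CompoundPoisson
variable {p : CompoundPoisson}

lemma measurable_src {f : ℝ → ℂ} (hf : Measurable f) : Measurable (p.src f) := by
  have hm2 : Measurable (fun q : ℝ × ℝ => if q.1 < q.2 then f (q.1 - q.2) else 0) :=
    Measurable.ite (measurableSet_lt measurable_fst measurable_snd) (by fun_prop) measurable_const
  refine Measurable.ite measurableSet_Ici ?_ measurable_const
  exact (StronglyMeasurable.integral_prod_right
    (f := fun v x => if v < x then f (v - x) else 0) hm2.stronglyMeasurable).measurable

lemma norm_src_le {f : ℝ → ℂ} {B : ℝ} (hB : ∀ t < 0, ‖f t‖ ≤ B) (v : ℝ) : ‖p.src f v‖ ≤ B := by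
  have hB0 : 0 ≤ B := (norm_nonneg _).trans (hB (-1) (by norm_num))
  rw [src]
  split_ifs
  · have := norm_integral_le_of_norm_le (μ := p.jump) (f := fun x => if v < x then f (v - x) else 0)
      (integrable_const B) (Eventually.of_forall fun x => by
        split_ifs with h
        · exact hB _ (by linarith)
        · simpa using hB0)
    simpa using this
  · simpa using hB0

variable {g : ℝ → ℝ → ℂ} {g₀ : ℝ → ℂ} {B : ℝ}

/-- The convolution only involves `[0, y]`, where the resolvents for `s ≤ 1` are bounded by the one
for `s = 1` at `y`. -/
lemma tendsto_cv_src (hg : ∀ s, 0 < s → s ≤ 1 → Measurable (g s))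
    (hB : ∀ s, 0 < s → s ≤ 1 → ∀ t < 0, ‖g s t‖ ≤ B)
    (hlim : ∀ t < 0, Tendsto (fun s => g s t) (𝓝[>] 0) (𝓝 (g₀ t))) (y : ℝ) :
    Tendsto (fun s => cv volume (p.src (g s)) (fun u => (R p s u : ℂ)) y) (𝓝[>] 0)
      (𝓝 (cv volume (p.src g₀) (fun u => (R p 0 u : ℂ)) y)) := by
  have hB0 : 0 ≤ B := (norm_nonneg _).trans (hB 1 one_pos le_rfl (-1) (by norm_num))
  have hsrc : ∀ v, Tendsto (fun s => p.src (g s) v) (𝓝[>] 0) (𝓝 (p.src g₀ v)) := by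
    intro v
    simp only [src]
    split_ifs with hv
    · refine tendsto_integral_filter_of_dominated_convergence (fun _ => B) ?_ ?_
        (integrable_const _) (Eventually.of_forall fun x => ?_)
      · filter_upwards [eventually_pos_le_one] with s hs
        have := hg s hs.1 hs.2
        exact (Measurable.ite (measurableSet_lt measurable_const measurable_id)
          (by fun_prop) measurable_const).aestronglyMeasurable
      · filter_upwards [eventually_pos_le_one] with s hs
        refine Eventually.of_forall fun x => ?_
        split_ifs with h
        · exact hB s hs.1 hs.2 _ (by linarith)
        · simpa using hB0
      · split_ifs with h
        · exact hlim _ (by linarith)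
        · exact tendsto_const_nhds
    · exact tendsto_const_nhds
  refine tendsto_integral_filter_of_dominated_convergence
    ((Icc 0 y).indicator fun _ => B * R p 1 y) ?_ ?_ ?_ (Eventually.of_forall fun v => ?_)
  · filter_upwards [eventually_pos_le_one] with s hs
    have h1 := measurable_src (p := p) (hg s hs.1 hs.2)
    have h2 := measurable_R (p := p) hs.1.le
    exact (h1.mul (Complex.measurable_ofReal.comp
      (h2.comp (measurable_const.sub measurable_id)))).aestronglyMeasurable
  · filter_upwards [eventually_pos_le_one] with s hs
    refine Eventually.of_forall fun v => ?_
    rw [indicator]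
    split_ifs with hv
    · rw [norm_mul, Complex.norm_real, Real.norm_of_nonneg (R_nonneg hs.1.le _)]
      exact mul_le_mul (norm_src_le (hB s hs.1 hs.2) v) ((R_mono hs.1.le (by linarith [hv.1])).trans
        (R_le_R hs.1.le hs.2 y)) (R_nonneg hs.1.le _) hB0
    · rw [mem_Icc, not_and_or, not_le, not_le] at hv
      rcases hv with hv | hv
      · simp [src, not_le.2 hv]
      · simp [R_neg hs.1.le (show y - v < 0 by linarith)]
  · exact (integrable_indicator_iff measurableSet_Icc).2 (integrableOn_const (by simp))
  · exact (hsrc v).mul (Complex.continuous_ofReal.tendsto _ |>.comp (tendsto_R _))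

lemma tendsto_vol (hg : ∀ s, 0 < s → s ≤ 1 → Measurable (g s))
    (hB : ∀ s, 0 < s → s ≤ 1 → ∀ t < 0, ‖g s t‖ ≤ B)
    (hlim : ∀ t ≤ 0, Tendsto (fun s => g s t) (𝓝[>] 0) (𝓝 (g₀ t))) (y : ℝ) :
    Tendsto (fun s => p.vol s (p.src (g s)) (g s 0) y) (𝓝[>] 0)
      (𝓝 (p.vol 0 (p.src g₀) (g₀ 0) y)) := by
  refine Tendsto.sub (Tendsto.mul ((hlim 0 le_rfl).const_mul _)
    (Complex.continuous_ofReal.tendsto _ |>.comp (tendsto_R _)))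
    ((tendsto_cv_src hg hB (fun t ht => hlim t ht.le) y).const_mul _)

lemma tendsto_ext (hg : ∀ s, 0 < s → s ≤ 1 → Measurable (g s))
    (hB : ∀ s, 0 < s → s ≤ 1 → ∀ t < 0, ‖g s t‖ ≤ B)
    (hlim : ∀ t ≤ 0, Tendsto (fun s => g s t) (𝓝[>] 0) (𝓝 (g₀ t))) (y : ℝ) :
    Tendsto (fun s => p.ext s (g s) y) (𝓝[>] 0) (𝓝 (p.ext 0 g₀ y)) := by
  simp only [CompoundPoisson.ext]
  split_ifs with hy
  · exact hlim y hy.le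
  · exact tendsto_vol hg hB hlim y

/-- Here the measure varies as well. Written as a density, it is dominated by the ladder density at
`s = 0`. -/
lemma tendsto_integral_lad (hg : ∀ s, 0 < s → s ≤ 1 → Measurable (g s))
    (hB : ∀ s, 0 < s → s ≤ 1 → ∀ t ≤ 0, ‖g s t‖ ≤ B)
    (hlim : ∀ t ≤ 0, Tendsto (fun s => g s t) (𝓝[>] 0) (𝓝 (g₀ t))) :
    Tendsto (fun s => ∫ t, g s (-t) ∂(p.lad s)) (𝓝[>] 0) (𝓝 (∫ t, g₀ (-t) ∂(p.lad 0))) := by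
  have hB0 : 0 ≤ B := (norm_nonneg _).trans (hB 1 one_pos le_rfl 0 le_rfl)
  have hq : 0 ≤ p.lam / p.a := (div_pos p.lam_pos p.a_pos).le
  have e : ∀ s, 0 ≤ s → ∀ f : ℝ → ℂ, ∫ t, f (-t) ∂(p.lad s) =
      ∫ t, ((p.lam / p.a : ℝ) : ℂ) * p.psi (p.c s) t * f (-t) := by
    intro s hs f
    have := p.measurable_h (p.c_nonneg hs)
    rw [lad, integral_withDensity_eq_integral_toReal_smul (by fun_prop)
      (Eventually.of_forall fun _ => ENNReal.ofReal_lt_top)]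
    congr 1
    ext t
    rw [ENNReal.toReal_ofReal (mul_nonneg hq (p.h_nonneg _ _)), Complex.real_smul, psi_ofReal]
    push_cast
    rfl
  have ev : (fun s => ∫ t, ((p.lam / p.a : ℝ) : ℂ) * p.psi (p.c s) t * g s (-t)) =ᶠ[𝓝[>] 0]
      fun s => ∫ t, g s (-t) ∂(p.lad s) := by
    filter_upwards [eventually_pos_le_one] with s hs using (e s hs.1.le _).symm
  rw [e 0 le_rfl]
  refine Tendsto.congr' ev ?_
  refine tendsto_integral_filter_of_dominated_convergence
    (fun t => p.lam / p.a * p.h (p.c 0) t * B) ?_ ?_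
    (((p.integrable_h le_rfl).const_mul _).mul_const _) (Eventually.of_forall fun t => ?_)
  · filter_upwards [eventually_pos_le_one] with s hs
    have h1 := hg s hs.1 hs.2
    have h2 := (psi_isOrig (p := p) (z := p.c s) (by simpa using p.c_nonneg hs.1.le)).1.meas
    exact ((h2.const_mul _).mul (h1.comp measurable_neg)).aestronglyMeasurable
  · filter_upwards [eventually_pos_le_one] with s hs
    refine Eventually.of_forall fun t => ?_
    rw [norm_mul, norm_mul, psi_ofReal, Complex.norm_real, Complex.norm_real,
      Real.norm_of_nonneg hq, Real.norm_of_nonneg (p.h_nonneg _ _)]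
    rcases lt_or_ge t 0 with ht | ht
    · simp [p.h_neg _ t ht]
    · exact mul_le_mul (mul_le_mul_of_nonneg_left
        (p.h_antitone (p.c_nonneg le_rfl) (p.c_mono le_rfl hs.1.le) t) hq)
        (hB s hs.1 hs.2 _ (by linarith)) (norm_nonneg _) (mul_nonneg hq (p.h_nonneg _ _))
  · rcases lt_or_ge t 0 with ht | ht
    · simp only [psi_ofReal, p.h_neg _ t ht]
      simp
    · exact ((p.tendsto_psi_c t).const_mul _).mul (hlim _ (by linarith))

lemma tendsto_C {z : ℝ → ℂ} {z₀ : ℂ} (hz : ∀ s, 0 < s → 0 ≤ (z s).re) (hz₀ : 0 ≤ z₀.re)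
    (hlim : Tendsto z (𝓝[>] 0) (𝓝 z₀)) (y : ℝ) :
    Tendsto (fun s => C p y (z s) s) (𝓝[>] 0) (𝓝 (C p y z₀ 0)) := by
  have he : ∀ t : ℝ, Tendsto (fun s => Complex.exp (t * z s)) (𝓝[>] 0)
      (𝓝 (Complex.exp (t * z₀))) := fun t =>
    (Complex.continuous_exp.tendsto _).comp (hlim.const_mul _)
  rcases lt_or_ge y 0 with hy | hy
  · simp only [C_of_neg hy, mul_comm _ (y : ℂ)]
    exact he y
  · rw [← func_over_exp le_rfl hz₀ hy, func_over le_rfl (B := 1) (by fun_prop)]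
    · refine Tendsto.congr' ?_ (tendsto_vol (g := fun s t => Complex.exp (t * z s)) (B := 1)
        (fun s _ _ => by fun_prop) (fun s hs hs1 t ht => ?_) (fun t ht => he t) y)
      · filter_upwards [eventually_pos_le_one] with s hs
        rw [← func_over_exp hs.1.le (hz s hs.1) hy, func_over hs.1.le (B := 1) (by fun_prop)]
        intro t ht
        rw [Complex.norm_exp, Real.exp_le_one_iff]
        have := hz s hs.1
        simp
        nlinarith
      · rw [Complex.norm_exp, Real.exp_le_one_iff]
        have := hz s hs
        simp
        nlinarith
    · intro t ht
      rw [Complex.norm_exp, Real.exp_le_one_iff]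
      simp
      nlinarith

lemma C_bounded {z : ℂ} (hz : 0 ≤ z.re) (d : ℝ) : ∃ B, ∀ s, 0 < s → s ≤ 1 → ∀ t ≤ d,
    ‖C p t z s‖ ≤ B := by
  refine ⟨Real.exp (z.re * |d|) * (1 + (‖p.k z‖ + 1) * (R p 1 d * |d|)), fun s hs hs1 t ht => ?_⟩
  have hR := R_nonneg (p := p) zero_le_one d
  have he : ∀ t ≤ d, ‖Complex.exp (z * t)‖ ≤ Real.exp (z.re * |d|) := by
    intro t ht
    rw [Complex.norm_exp, Real.exp_le_exp]
    simp only [Complex.mul_re, Complex.ofReal_re, Complex.ofReal_im, mul_zero, sub_zero]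
    exact mul_le_mul_of_nonneg_left (ht.trans (le_abs_self d)) hz
  rcases lt_or_ge t 0 with h | h
  · rw [C_of_neg h]
    refine (he t ht).trans (le_mul_of_one_le_right (Real.exp_pos _).le ?_)
    have : 0 ≤ (‖p.k z‖ + 1) * (R p 1 d * |d|) := by positivity
    linarith
  · rw [C_of_nonneg h, norm_mul]
    refine mul_le_mul (he t ht) ?_ (norm_nonneg _) (Real.exp_pos _).le
    refine (norm_sub_le _ _).trans ?_
    rw [norm_one, norm_mul]
    gcongr
    · refine (norm_sub_le _ _).trans ?_
      rw [Complex.norm_real, Real.norm_of_nonneg hs.le]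
      linarith
    · refine (intervalIntegral.norm_integral_le_of_norm_le_const (C := R p 1 d) fun u hu => ?_).trans
        ?_
      · rw [uIoc_of_le h] at hu
        rw [norm_mul, norm_cexp_neg_mul, Complex.norm_real, Real.norm_of_nonneg (R_nonneg hs.le _)]
        refine (mul_le_of_le_one_left (R_nonneg hs.le _) ?_).trans
          ((R_le_R hs.le hs1 u).trans (R_mono zero_le_one (hu.2.trans ht)))
        rw [Real.exp_le_one_iff]
        have := hu.1
        nlinarith
      · rw [sub_zero]
        exact mul_le_mul_of_nonneg_left (abs_le_abs_of_nonneg h ht) hR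

end CompoundPoisson

/-! ### Limits of `F`, of the coefficient and of the solutions as `s ↓ 0`. -/

variable {p : Fin 2 → CompoundPoisson}

lemma tendsto_F (d : ℝ) : Tendsto (fun s => F p s d) (𝓝[>] 0) (𝓝 (F p 0 d)) := by
  have h : ∀ s, 0 ≤ s → (F p s d : ℂ) = func (p 0).a (p 0).a ((p 0).lad s)
      fun y => (R (p 1) s (d + y) : ℂ) := fun s hs => by
    rw [F_eq hs, Ffun, tfun_eq_func]
  have hR : ∀ t, Tendsto (fun s => (R (p 1) s t : ℂ)) (𝓝[>] 0) (𝓝 (R (p 1) 0 t : ℂ)) := fun t =>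
    (Complex.continuous_ofReal.tendsto _).comp (tendsto_R t)
  have h1 : Tendsto (fun s => (F p s d : ℂ)) (𝓝[>] 0) (𝓝 (F p 0 d : ℂ)) := by
    rw [h 0 le_rfl]
    refine Tendsto.congr' (f₁ := fun s => func (p 0).a (p 0).a ((p 0).lad s)
      fun y => (R (p 1) s (d + y) : ℂ)) ?_ ?_
    · filter_upwards [eventually_pos_le_one] with s hs using (h s hs.1.le).symm
    · refine Tendsto.sub ((hR _).const_mul _) (Tendsto.const_mul _
        (tendsto_integral_lad (g := fun s y => (R (p 1) s (d + y) : ℂ)) (B := R (p 1) 1 d)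
          (fun s hs _ => ?_) (fun s hs hs1 t ht => ?_) fun t _ => hR _))
      · have := measurable_R (p := p 1) hs.le
        exact Complex.measurable_ofReal.comp (this.comp (measurable_const_add d))
      · rw [Complex.norm_real, Real.norm_of_nonneg (R_nonneg hs.le _)]
        exact (R_mono hs.le (by linarith)).trans (R_le_R hs.le hs1 _)
  have := (Complex.continuous_re.tendsto _).comp h1
  simpa [Function.comp_def] using this

lemma upCoef_eq {s : ℝ} (hs : 0 ≤ s) {d : ℝ} (hd : 0 ≤ d) {z : ℂ} (hz : 0 ≤ z.re) :
    upCoef p s d z =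
      func (p 0).a (p 0).a ((p 0).lad s) (fun y => C (p 1) (d + y) z s) / F p s d := by
  have hfin := finite_lad (p := p 0) hs
  rw [func_C hs (ae_lad_nonneg hs) hd hz, upCoef, F_eq hs]
  rfl

lemma tendsto_upCoef {d : ℝ} (hd : 0 ≤ d) {z : ℂ} (hz : 0 ≤ z.re) :
    Tendsto (fun s => upCoef p s d z) (𝓝[>] 0) (𝓝 (upCoef p 0 d z)) := by
  obtain ⟨B, hB⟩ := C_bounded (p := p 1) hz d
  rw [upCoef_eq le_rfl hd hz]
  refine Tendsto.congr' (f₁ := fun s => func (p 0).a (p 0).a ((p 0).lad s)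
    (fun y => C (p 1) (d + y) z s) / F p s d) ?_ ?_
  · filter_upwards [eventually_pos_le_one] with s hs using (upCoef_eq hs.1.le hd hz).symm
  · have hC : ∀ t, Tendsto (fun s => C (p 1) t z s) (𝓝[>] 0) (𝓝 (C (p 1) t z 0)) := fun t =>
      tendsto_C (fun _ _ => hz) hz tendsto_const_nhds t
    refine Tendsto.div (Tendsto.sub ((hC _).const_mul _) (Tendsto.const_mul _
      (tendsto_integral_lad (g := fun s y => C (p 1) (d + y) z s) (B := B) (fun s hs _ => ?_)
        (fun s hs hs1 t ht => hB s hs hs1 _ (by linarith)) fun t _ => hC _)))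
      ((Complex.continuous_ofReal.tendsto _).comp (tendsto_F d)) ?_
    · have := (C_sub_isHarmonic (p := p 1) hs.le hz 0).meas
      simp only [zero_mul, sub_zero] at this
      exact this.comp (measurable_const_add d)
    · exact_mod_cast (F_pos le_rfl hd).ne'

lemma tendsto_upSol {d : ℝ} (hd : 0 ≤ d) {z : ℂ} (hz : 0 ≤ z.re) (y : ℝ) :
    Tendsto (fun s => upSol p s d z y) (𝓝[>] 0) (𝓝 (upSol p 0 d z y)) := by
  obtain ⟨B, hB⟩ := C_bounded (p := p 1) hz d
  have hκ := tendsto_upCoef (p := p) hd hz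
  have hκB : ∀ᶠ s in 𝓝[>] (0 : ℝ), ‖upCoef p s d z‖ ≤ ‖upCoef p 0 d z‖ + 1 := by
    filter_upwards [hκ.norm.eventually (gt_mem_nhds (lt_add_one _))] with s hs using hs.le
  -- `tendsto_ext` wants bounds for all `0 < s ≤ 1`, but convergence bounds the coefficient only
  -- near `0`; the truncation changes nothing in the limit.
  set κ : ℝ → ℂ := fun s => if ‖upCoef p s d z‖ ≤ ‖upCoef p 0 d z‖ + 1 then upCoef p s d z else 0
    with hκdef
  have hκe : κ =ᶠ[𝓝[>] 0] fun s => upCoef p s d z := by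
    filter_upwards [hκB] with s hs
    rw [hκdef]
    exact if_pos hs
  have hκn : ∀ s, ‖κ s‖ ≤ ‖upCoef p 0 d z‖ + 1 := by
    intro s
    simp only [hκdef]
    split_ifs with h
    · exact h
    · rw [norm_zero]; positivity
  rw [upSol_eq_ext le_rfl hd hz]
  have key := tendsto_ext (p := p 0)
    (g := fun s y => C (p 1) (d + y) z s - κ s * R (p 1) s (d + y))
    (g₀ := fun y => C (p 1) (d + y) z 0 - upCoef p 0 d z * R (p 1) 0 (d + y))
    (B := B + (‖upCoef p 0 d z‖ + 1) * R (p 1) 1 d) (fun s hs _ => ?_) (fun s hs hs1 t ht => ?_)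
    (fun t _ => ?_) y
  · refine key.congr' ?_
    filter_upwards [eventually_pos_le_one, hκe] with s hs h
    rw [upSol_eq_ext hs.1.le hd hz, h]
  · exact (C_sub_isHarmonic (p := p 1) hs.le hz (κ s)).meas.comp (measurable_const_add d)
  · refine (norm_sub_le _ _).trans (add_le_add (hB s hs hs1 _ (by linarith)) ?_)
    rw [norm_mul, Complex.norm_real, Real.norm_of_nonneg (R_nonneg hs.le _)]
    exact mul_le_mul (hκn s) ((R_mono hs.le (by linarith)).trans (R_le_R hs.le hs1 _))
      (R_nonneg hs.le _) (by positivity)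
  · exact (tendsto_C (fun _ _ => hz) hz tendsto_const_nhds _).sub ((hκ.congr' hκe.symm).mul
      ((Complex.continuous_ofReal.tendsto _).comp (tendsto_R _)))

lemma tendsto_down (y : ℝ) : Tendsto (fun s => C (p 0) y ((p 1).c s) s) (𝓝[>] 0)
    (𝓝 (C (p 0) y ((p 1).c 0) 0)) :=
  tendsto_C (fun s hs => by simpa using (p 1).c_nonneg hs.le) (by simpa using (p 1).c_nonneg le_rfl)
    ((Complex.continuous_ofReal.tendsto _).comp (p 1).tendsto_c) y

end Oscillating
end

noncomputable section
namespace Oscillating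

/-! ### Iteration of a discounted step -/

section iteration
variable {𝓓 : Type*} [MeasurableSpace 𝓓]

/-- The functional `Φ` after `n` steps of the walk, started from the guess `G`. -/
def iter {E : Type*} [SMul ℝ≥0 E] (A : Set ℝ) (β : ℝ → 𝓓 → ℝ≥0) (N : ℝ → 𝓓 → ℝ) (S : ℝ → 𝓓 → 𝓓)
    (G : ℝ → E) : ℕ → ℝ → 𝓓 → E
  | 0, x, _ => G x
  | n + 1, x, D => open Classical in
    if x ∈ A then β x D • iter A β N S G n (N x D) (S x D) else G x

variable {A : Set ℝ} {β : ℝ → 𝓓 → ℝ≥0} {N : ℝ → 𝓓 → ℝ} {S : ℝ → 𝓓 → 𝓓}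

lemma measurable_iter {E : Type*} [MeasurableSpace E] [SMul ℝ≥0 E] [MeasurableSMul₂ ℝ≥0 E]
    (hA : MeasurableSet A) (hβ : Measurable (Function.uncurry β))
    (hN : Measurable (Function.uncurry N)) (hS : Measurable (Function.uncurry S)) {G : ℝ → E}
    (hG : Measurable G) (n : ℕ) : Measurable (Function.uncurry (iter A β N S G n)) := by
  classical
  induction n with
  | zero => exact hG.comp measurable_fst
  | succ n ih =>
    have h : Function.uncurry (iter A β N S G (n + 1)) = fun q : ℝ × 𝓓 => if q.1 ∈ A then
        β q.1 q.2 • Function.uncurry (iter A β N S G n) (N q.1 q.2, S q.1 q.2) else G q.1 := by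
      ext q
      simp only [Function.uncurry, iter]
    rw [h]
    exact Measurable.ite (measurable_fst hA) (hβ.smul (ih.comp (hN.prodMk hS)))
      (hG.comp measurable_fst)

/-- A functional of a discounted walk is the expectation that solves the one-step equation. -/
theorem integral_eq_of_step {P : Measure 𝓓} [IsProbabilityMeasure P] (hA : MeasurableSet A)
    (hβ : Measurable (Function.uncurry β)) (hN : Measurable (Function.uncurry N))
    (hS : Measurable (Function.uncurry S))
    (hmp : ∀ x ∈ A, MeasurePreserving (fun D => ((β x D, N x D), S x D)) P
      ((P.map fun D => (β x D, N x D)).prod P))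
    {good : Set 𝓓} (hgood : ∀ᵐ D ∂P, D ∈ good) (hSg : ∀ x ∈ A, ∀ D ∈ good, S x D ∈ good)
    (hβ1 : ∀ x ∈ A, ∀ D ∈ good, β x D ≤ 1)
    {Φ : ℝ → 𝓓 → ℂ} (hΦ : ∀ x, ∀ D ∈ good, ‖Φ x D‖ ≤ 1)
    (hstep : ∀ x ∈ A, ∀ D ∈ good, Φ x D = β x D • Φ (N x D) (S x D))
    {G : ℝ → ℂ} {B : ℝ} (hG : Measurable G) (hB : ∀ x, ‖G x‖ ≤ B)
    (hGstep : ∀ x ∈ A, G x = ∫ D, β x D • G (N x D) ∂P)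
    (hdead : ∀ x, x ∉ A → ∀ D ∈ good, Φ x D = G x)
    {W : ℝ → ℝ≥0∞} (hW : Measurable W) {θ : ℝ≥0∞} (hθ : θ < 1) (hWA : ∀ x ∈ A, 1 ≤ W x)
    (hWfin : ∀ x, W x ≠ ∞)
    (hWstep : ∀ x ∈ A, ∫⁻ D, β x D * W (N x D) ∂P ≤ θ * W x) (x : ℝ) :
    AEStronglyMeasurable (Φ x) P ∧ ∫ D, Φ x D ∂P = G x := by
  classical
  have hB0 : 0 ≤ B := (norm_nonneg _).trans (hB 0)
  have hβx : ∀ x, Measurable (β x) := fun x => hβ.of_uncurry_left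
  have hNx : ∀ x, Measurable (N x) := fun x => hN.of_uncurry_left
  have hm := measurable_iter hA hβ hN hS hG
  have hmx : ∀ n x, Measurable (iter A β N S G n x) := fun n x => (hm n).of_uncurry_left
  have hbd : ∀ n x, ∀ D ∈ good, ‖iter A β N S G n x D‖ ≤ B := by
    intro n
    induction n with
    | zero => exact fun x D _ => hB x
    | succ n ih =>
      intro x D hD
      rw [iter]
      split_ifs with hx
      · rw [NNReal.smul_def, norm_smul, Real.norm_of_nonneg (NNReal.coe_nonneg _)]
        have h1 : (β x D : ℝ) ≤ 1 := by exact_mod_cast hβ1 x hx D hD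
        exact (mul_le_of_le_one_left (norm_nonneg _) h1).trans (ih _ _ (hSg x hx D hD))
      · exact hB x
  -- Independence of the remaining driver from the step gives, by induction on `n`, that the guess
  -- `G` propagates unchanged in expectation.
  have hint : ∀ n x, ∫ D, iter A β N S G n x D ∂P = G x := by
    intro n
    induction n with
    | zero => intro x; simp [iter]
    | succ n ih =>
      intro x
      by_cases hx : x ∈ A
      · have hp : IsProbabilityMeasure (P.map fun D => (β x D, N x D)) :=
          Measure.isProbabilityMeasure_map ((hβx x).prodMk (hNx x)).aemeasurable
        have hF : Measurable fun q : (ℝ≥0 × ℝ) × 𝓓 => q.1.1 • iter A β N S G n q.1.2 q.2 :=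
          (measurable_fst.comp measurable_fst).smul
            ((hm n).comp ((measurable_snd.comp measurable_fst).prodMk measurable_snd))
        have e1 : ∀ D, iter A β N S G (n + 1) x D =
            (fun q : (ℝ≥0 × ℝ) × 𝓓 => q.1.1 • iter A β N S G n q.1.2 q.2)
              ((β x D, N x D), S x D) := fun D => by rw [iter, if_pos hx]
        have hi : Integrable (fun q : (ℝ≥0 × ℝ) × 𝓓 => q.1.1 • iter A β N S G n q.1.2 q.2)
            ((P.map fun D => (β x D, N x D)).prod P) := by
          rw [← (hmp x hx).integrable_comp hF.aestronglyMeasurable]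
          refine Integrable.of_bound (C := B)
            (hF.comp (hmp x hx).measurable).aestronglyMeasurable ?_
          filter_upwards [hgood] with D hD
          have := hbd (n + 1) x D hD
          rwa [e1] at this
        simp only [e1]
        rw [← integral_map (hmp x hx).measurable.aemeasurable hF.aestronglyMeasurable,
          (hmp x hx).map_eq, integral_prod _ hi]
        simp only [NNReal.smul_def, integral_smul, ih]
        rw [hGstep x hx, integral_map ((hβx x).prodMk (hNx x)).aemeasurable]
        · rfl
        · exact (Measurable.smul (measurable_coe_nnreal_real.comp measurable_fst)
            (hG.comp measurable_snd)).aestronglyMeasurable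
      · simp [iter, hx]
  -- The accumulated discount on the event that the walk is still alive after `n` steps. Its
  -- expectation decays like `θ ^ n` thanks to the weight.
  set Z : ℕ → ℝ → 𝓓 → ℝ≥0∞ := iter A β N S (A.indicator fun _ => 1) with hZdef
  have hmZ := measurable_iter hA hβ hN hS (G := A.indicator fun _ => (1 : ℝ≥0∞))
    (measurable_const.indicator hA)
  have hZdead : ∀ n x, x ∉ A → ∀ D, Z n x D = 0 := by
    intro n x hx D
    cases n <;> simp [hZdef, iter, hx]
  have hZint : ∀ n x, ∫⁻ D, Z n x D ∂P ≤ θ ^ n * W x := by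
    intro n
    induction n with
    | zero =>
      intro x
      by_cases hx : x ∈ A
      · simpa [hZdef, iter, hx] using hWA x hx
      · simp [hZdef, iter, hx]
    | succ n ih =>
      intro x
      by_cases hx : x ∈ A
      · have hp : IsProbabilityMeasure (P.map fun D => (β x D, N x D)) :=
          Measure.isProbabilityMeasure_map ((hβx x).prodMk (hNx x)).aemeasurable
        have hF : Measurable fun q : (ℝ≥0 × ℝ) × 𝓓 => (q.1.1 : ℝ≥0∞) * Z n q.1.2 q.2 :=
          (measurable_coe_nnreal_ennreal.comp (measurable_fst.comp measurable_fst)).mul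
            ((hmZ n).comp ((measurable_snd.comp measurable_fst).prodMk measurable_snd))
        have e1 : ∀ D, Z (n + 1) x D = (fun q : (ℝ≥0 × ℝ) × 𝓓 => (q.1.1 : ℝ≥0∞) *
            Z n q.1.2 q.2) ((β x D, N x D), S x D) := fun D => by
          simp only [hZdef]
          rw [iter, if_pos hx, ENNReal.smul_def, smul_eq_mul]
        simp only [e1]
        rw [← lintegral_map hF (hmp x hx).measurable, (hmp x hx).map_eq,
          lintegral_prod _ hF.aemeasurable]
        calc ∫⁻ q, ∫⁻ D, (q.1 : ℝ≥0∞) * Z n q.2 D ∂P ∂(P.map fun D => (β x D, N x D))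
            = ∫⁻ q, (q.1 : ℝ≥0∞) * ∫⁻ D, Z n q.2 D ∂P ∂(P.map fun D => (β x D, N x D)) :=
              lintegral_congr fun q => lintegral_const_mul _ (hmZ n).of_uncurry_left
          _ ≤ ∫⁻ q, θ ^ n * ((q.1 : ℝ≥0∞) * W q.2) ∂(P.map fun D => (β x D, N x D)) := by
              refine lintegral_mono fun q => ?_
              calc (q.1 : ℝ≥0∞) * ∫⁻ D, Z n q.2 D ∂P ≤ q.1 * (θ ^ n * W q.2) := by
                    gcongr
                    exact ih _
                _ = _ := by ring
          _ = θ ^ n * ∫⁻ D, β x D * W (N x D) ∂P := by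
              have hmW : Measurable fun q : ℝ≥0 × ℝ => (q.1 : ℝ≥0∞) * W q.2 :=
                (measurable_coe_nnreal_ennreal.comp measurable_fst).mul (hW.comp measurable_snd)
              rw [lintegral_const_mul _ hmW, lintegral_map hmW ((hβx x).prodMk (hNx x))]
          _ ≤ θ ^ n * (θ * W x) := by gcongr; exact hWstep x hx
          _ = θ ^ (n + 1) * W x := by ring
      · simp [hZdead _ _ hx]
  -- Once the walk has stopped, guess and functional agree; until then they differ by at most `B +
  -- 1`, times the discount.
  have hdiff : ∀ n x, ∀ D ∈ good,
      ENNReal.ofReal ‖iter A β N S G n x D - Φ x D‖ ≤ ENNReal.ofReal (B + 1) * Z n x D := by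
    intro n
    induction n with
    | zero =>
      intro x D hD
      by_cases hx : x ∈ A
      · simp only [hZdef, iter, indicator_of_mem hx, mul_one]
        exact ENNReal.ofReal_le_ofReal ((norm_sub_le _ _).trans (add_le_add (hB x) (hΦ x D hD)))
      · simp [iter, hdead x hx D hD]
    | succ n ih =>
      intro x D hD
      by_cases hx : x ∈ A
      · simp only [hZdef]
        rw [iter, iter, if_pos hx, if_pos hx, hstep x hx D hD, ← smul_sub, NNReal.smul_def,
          norm_smul, Real.norm_of_nonneg (NNReal.coe_nonneg _),
          ENNReal.ofReal_mul (NNReal.coe_nonneg _), ENNReal.ofReal_coe_nnreal, ENNReal.smul_def,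
          smul_eq_mul, mul_left_comm]
        gcongr
        exact ih _ _ (hSg x hx D hD)
      · simp [iter, hx, hdead x hx D hD]
  -- Summability of the expectations makes the surviving discounts tend to zero almost surely. Thus
  -- the iterates converge to `Φ`, which yields both its measurability and its expectation.
  have hsum : ∫⁻ D, ∑' n, Z n x D ∂P ≠ ∞ := by
    rw [lintegral_tsum fun n => ((hmZ n).of_uncurry_left).aemeasurable]
    refine ne_top_of_le_ne_top ?_ (ENNReal.tsum_le_tsum fun n => hZint n x)
    rw [ENNReal.tsum_mul_right, ENNReal.tsum_geometric]
    refine ENNReal.mul_ne_top (ENNReal.inv_ne_top.2 ?_) (hWfin x)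
    exact (tsub_pos_of_lt hθ).ne'
  have hlim : ∀ᵐ D ∂P, Tendsto (fun n => iter A β N S G n x D) atTop (𝓝 (Φ x D)) := by
    filter_upwards [hgood, ae_lt_top (Measurable.tsum fun n =>
      (hmZ n).of_uncurry_left) hsum] with D hD hD2
    have h0 := ENNReal.tendsto_atTop_zero_of_tsum_ne_top hD2.ne
    have h1 : Tendsto (fun n => ENNReal.ofReal (B + 1) * Z n x D) atTop (𝓝 0) := by
      have := ENNReal.Tendsto.const_mul (a := ENNReal.ofReal (B + 1)) h0
        (Or.inr ENNReal.ofReal_ne_top)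
      simpa using this
    have h2 := tendsto_of_tendsto_of_tendsto_of_le_of_le tendsto_const_nhds h1
      (fun n => zero_le) (fun n => hdiff n x D hD)
    rw [tendsto_iff_norm_sub_tendsto_zero]
    have h3 := (ENNReal.tendsto_toReal ENNReal.zero_ne_top).comp h2
    simpa [Function.comp_def, ENNReal.toReal_ofReal (norm_nonneg _)] using h3
  refine ⟨aestronglyMeasurable_of_tendsto_ae atTop
    (fun n => (hmx n x).aestronglyMeasurable) hlim, ?_⟩
  have h1 := tendsto_integral_of_dominated_convergence (fun _ => B)
    (fun n => (hmx n x).aestronglyMeasurable (μ := P)) (integrable_const B)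
    (fun n => by filter_upwards [hgood] with D hD using hbd n x D hD) hlim
  simp only [hint] at h1
  exact (tendsto_nhds_unique h1 tendsto_const_nhds)

end iteration

/-! ### The sequence of interarrival times and jumps -/

/-- Indices of the interarrival times (left) and of the jumps (right). -/
abbrev Idx : Type := (Fin 2 × ℕ × ℕ) ⊕ (Fin 2 × ℕ × ℕ)

/-- The laws of the interarrival times and of the jumps. -/
def idxLaw (p : Fin 2 → CompoundPoisson) : Idx → Measure ℝ :=
  Sum.elim (fun j => expMeasure (p j.1).lam) (fun j => (p j.1).jump)

instance (p : Fin 2 → CompoundPoisson) (i : Idx) : IsProbabilityMeasure (idxLaw p i) := by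
  rcases i with i | i
  · exact isProbabilityMeasure_expMeasure (p i.1).lam_pos
  · exact (p i.1).isProb

/-- The joint law of all interarrival times and jumps. -/
def drvLaw (p : Fin 2 → CompoundPoisson) : Measure (Idx → ℝ) := Measure.infinitePi (idxLaw p)

instance (p : Fin 2 → CompoundPoisson) : IsProbabilityMeasure (drvLaw p) := by
  rw [drvLaw]; infer_instance

/-- Discarding the first arrival of the current copy of process `i`. -/
def skipIdx (i : Fin 2) (j : Fin 2 × ℕ × ℕ) : Fin 2 × ℕ × ℕ :=
  if j.1 = i ∧ j.2.1 = 0 then (j.1, j.2.1, j.2.2 + 1) else j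

/-- Passing to the next copies. -/
def nextIdx (j : Fin 2 × ℕ × ℕ) : Fin 2 × ℕ × ℕ := (j.1, j.2.1 + 1, j.2.2)

lemma skipIdx_injective (i : Fin 2) : Function.Injective (skipIdx i) := by
  rintro ⟨a, n, j⟩ ⟨a', n', j'⟩ h
  simp only [skipIdx] at h
  split_ifs at h <;> simp_all

lemma nextIdx_injective : Function.Injective nextIdx := by
  rintro ⟨a, n, j⟩ ⟨a', n', j'⟩ h
  simp only [nextIdx] at h
  simp_all

lemma skipIdx_fst (i : Fin 2) (j : Fin 2 × ℕ × ℕ) : (skipIdx i j).1 = j.1 := by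
  rw [skipIdx]; split_ifs <;> rfl

lemma skipIdx_ne (i : Fin 2) (j : Fin 2 × ℕ × ℕ) : skipIdx i j ≠ (i, 0, 0) := by
  rintro h
  simp only [skipIdx] at h
  split_ifs at h with h1
  · simp at h
  · rw [h] at h1; simp at h1

lemma nextIdx_ne (i : Fin 2) (j : Fin 2 × ℕ × ℕ) : nextIdx j ≠ (i, 0, 0) := by
  simp [nextIdx]

variable {p : Fin 2 → CompoundPoisson}

/-- Reindexing that avoids the first pair of process `i` gives an independent driver of the same
law. -/
lemma drvLaw_split {i : Fin 2} {f : Fin 2 × ℕ × ℕ → Fin 2 × ℕ × ℕ} (hf : Function.Injective f)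
    (h1 : ∀ j, (f j).1 = j.1) (h2 : ∀ j, f j ≠ (i, 0, 0)) :
    MeasurePreserving (fun D : Idx → ℝ => ((D (.inl (i, 0, 0)), D (.inr (i, 0, 0))),
      D ∘ Sum.map f f)) (drvLaw p)
      (((expMeasure (p i).lam).prod (p i).jump).prod (drvLaw p)) := by
  have hmeas : ∀ k : Idx, Measurable fun D : Idx → ℝ => D k := fun k => measurable_pi_apply k
  have hind : iIndepFun (fun (k : Idx) (D : Idx → ℝ) => D k) (drvLaw p) :=
    iIndepFun_infinitePi (X := fun _ x => x) fun _ => measurable_id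
  have hmf : Measurable fun D : Idx → ℝ => D ∘ Sum.map f f :=
    measurable_pi_lambda _ fun k => hmeas _
  have hpair : (drvLaw p).map (fun D => (D (.inl (i, 0, 0)), D (.inr (i, 0, 0)))) =
      (expMeasure (p i).lam).prod (p i).jump := by
    exact Measure.infinitePi_map_eval_prod (P := idxLaw p) (by simp)
  have hshift : (drvLaw p).map (fun D => D ∘ Sum.map f f) = drvLaw p := by
    have hinj : Function.Injective (Sum.map f f) := hf.sumMap hf
    have := Measure.map_infinitePi_infinitePi_of_inj (P := idxLaw p) (f := Sum.map f f) hinj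
    have e : (fun k : Idx => idxLaw p (Sum.map f f k)) = idxLaw p := by
      ext1 k
      rcases k with k | k <;> simp [idxLaw, h1]
    rw [e] at this
    exact this
  refine ⟨((hmeas _).prodMk (hmeas _)).prodMk hmf, ?_⟩
  have key : IndepFun (fun D : Idx → ℝ => (D (.inl (i, 0, 0)), D (.inr (i, 0, 0))))
      (fun D => D ∘ Sum.map f f) (drvLaw p) := by
    -- The reindexed driver never reads the first pair, so the two families use disjoint sets of
    -- independent coordinates.
    have hd : Disjoint {.inl (i, 0, 0), .inr (i, 0, 0)} (range (Sum.map f f)) := by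
      rw [Set.disjoint_left]
      rintro k hk ⟨j, rfl⟩
      rcases j with j | j <;> simp [h2] at hk
    have hI := indep_iSup_of_disjoint
      (m := fun k : Idx => MeasurableSpace.comap (fun D : Idx → ℝ => D k) inferInstance)
      (fun k => (hmeas k).comap_le) hind hd
    rw [IndepFun_iff_Indep]
    refine indep_of_indep_of_le_left (indep_of_indep_of_le_right hI ?_) ?_
    · rw [MeasurableSpace.pi, MeasurableSpace.comap_iSup]
      refine iSup_le fun k => ?_
      rw [MeasurableSpace.comap_comp]
      exact le_iSup₂_of_le _ (mem_range_self k) le_rfl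
    · rw [Prod.instMeasurableSpace, MeasurableSpace.prod, MeasurableSpace.comap_sup,
        MeasurableSpace.comap_comp, MeasurableSpace.comap_comp]
      exact sup_le (le_iSup₂_of_le _ (mem_insert _ _) le_rfl)
        (le_iSup₂_of_le _ (mem_insert_of_mem _ (mem_singleton _)) le_rfl)
  rw [indepFun_iff_map_prod_eq_prod_map_map ((hmeas _).prodMk (hmeas _)).aemeasurable
    hmf.aemeasurable, hpair, hshift] at key
  exact key

end Oscillating
end

noncomputable section
namespace Oscillating

/-! ### First times -/

lemma firstTime_add {A A' : Set ℝ≥0} {t₀ : ℝ≥0} (h0 : ∀ t < t₀, t ∉ A)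
    (h : ∀ t, t₀ + t ∈ A ↔ t ∈ A') : firstTime A = t₀ + firstTime A' := by
  rw [firstTime, firstTime]
  apply le_antisymm
  · rw [ENNReal.add_iInf]
    refine le_iInf fun t => ?_
    by_cases ht : t ∈ A'
    · simp only [ht, iInf_pos]
      rw [← ENNReal.coe_add]
      exact iInf₂_le _ ((h t).2 ht)
    · simp [ht]
  · refine le_iInf₂ fun t ht => ?_
    have hle : t₀ ≤ t := not_lt.1 fun hlt => h0 t hlt ht
    obtain ⟨v, rfl⟩ := exists_add_of_le hle
    rw [ENNReal.coe_add]
    gcongr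
    exact iInf₂_le _ ((h v).1 ht)

lemma firstTime_of_zero {A : Set ℝ≥0} (h : 0 ∈ A) : firstTime A = 0 :=
  le_antisymm ((iInf₂_le (f := fun (t : ℝ≥0) (_ : t ∈ A) => (t : ℝ≥0∞)) 0 h).trans_eq
    ENNReal.coe_zero) zero_le

/-- The discounted payoff `g` at the first time when `X` is in the target set. -/
def hitVal (tgt : Set ℝ) (g : ℝ → ℂ) (s : ℝ) (X : ℝ≥0 → ℝ) : ℂ :=
  open Classical in
  if firstTime {t | X t ∈ tgt} < ∞ then
    Complex.exp (-(s * (firstTime {t | X t ∈ tgt}).toReal)) *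
      g (X (firstTime {t | X t ∈ tgt}).toNNReal)
  else 0

/-- Time spent outside the target only delays the hitting time, so it enters as a discount factor.
-/
lemma hitVal_add {tgt : Set ℝ} {g : ℝ → ℂ} {s : ℝ} {X X' : ℝ≥0 → ℝ} {t₀ : ℝ≥0}
    (h0 : ∀ t < t₀, X t ∉ tgt) (h : ∀ t, X (t₀ + t) = X' t) :
    hitVal tgt g s X = (Real.exp (-(s * t₀)) : ℂ) * hitVal tgt g s X' := by
  have e : firstTime {t | X t ∈ tgt} = t₀ + firstTime {t | X' t ∈ tgt} :=
    firstTime_add h0 fun t => by simp [h]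
  rw [hitVal, hitVal, e]
  by_cases hT : firstTime {t | X' t ∈ tgt} < ∞
  · rw [if_pos hT, if_pos (ENNReal.add_lt_top.2 ⟨ENNReal.coe_lt_top, hT⟩),
      ENNReal.toNNReal_add ENNReal.coe_ne_top hT.ne, ENNReal.toReal_add ENNReal.coe_ne_top hT.ne,
      ENNReal.toNNReal_coe, h, ENNReal.coe_toReal, ← mul_assoc, Complex.ofReal_exp,
      ← Complex.exp_add]
    congr 2
    push_cast
    ring
  · rw [if_neg hT, if_neg, mul_zero]
    rw [not_lt, top_le_iff] at hT ⊢
    rw [hT, add_top]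

lemma hitVal_zero {tgt : Set ℝ} {g : ℝ → ℂ} {s : ℝ} {X : ℝ≥0 → ℝ} (h : X 0 ∈ tgt) :
    hitVal tgt g s X = g (X 0) := by
  rw [hitVal, firstTime_of_zero h]
  simp

lemma norm_hitVal_le {tgt : Set ℝ} {g : ℝ → ℂ} {s : ℝ} (hs : 0 ≤ s) {X : ℝ≥0 → ℝ}
    (hg : ∀ x, ‖g x‖ ≤ 1) : ‖hitVal tgt g s X‖ ≤ 1 := by
  rw [hitVal]
  split_ifs
  · rw [norm_mul, Complex.norm_exp]
    refine mul_le_one₀ (Real.exp_le_one_iff.2 ?_) (norm_nonneg _) (hg _)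
    simp only [Complex.neg_re, Complex.mul_re, Complex.ofReal_re, Complex.ofReal_im, mul_zero,
      sub_zero]
    have := mul_nonneg hs (ENNReal.toReal_nonneg (a := firstTime {t | X t ∈ tgt}))
    linarith
  · simp

/-! ### Compound Poisson paths -/

/-- Positive interarrival times with divergent sum. -/
structure IsArrival (e : ℕ → ℝ) : Prop where
  pos : ∀ j, 0 < e j
  top : Tendsto (fun n => ∑ j ∈ Finset.range n, e j) atTop atTop

lemma IsArrival.tail {e : ℕ → ℝ} (he : IsArrival e) : IsArrival fun j => e (j + 1) := by
  refine ⟨fun j => he.pos _, ?_⟩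
  have h := tendsto_atTop_add_const_right _ (-e 0) ((tendsto_add_atTop_iff_nat 1).2 he.top)
  refine h.congr fun n => ?_
  rw [Finset.sum_range_succ']
  ring

lemma count_of_lt {e : ℕ → ℝ} (he : IsArrival e) {t : ℝ≥0} (ht : t < e 0) : count e t = 0 := by
  rw [count]
  convert Set.ncard_empty ℕ
  ext m
  simp only [mem_ofPred_eq, mem_empty_iff_false, iff_false, not_le]
  refine ht.trans_le ?_
  rw [Finset.sum_range_succ']
  have := Finset.sum_nonneg fun (j : ℕ) (_ : j ∈ Finset.range m) => (he.pos (j + 1)).le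
  linarith

lemma count_add {e : ℕ → ℝ} (he : IsArrival e) {t₀ : ℝ≥0} (h0 : t₀ = e 0) (t : ℝ≥0) :
    count e (t₀ + t) = count (fun j => e (j + 1)) t + 1 := by
  -- Finiteness matters because `Set.ncard` is `0` on infinite sets; it comes from the divergence of
  -- the arrival times.
  have hfin : {m : ℕ | ∑ j ∈ Finset.range (m + 1), e (j + 1) ≤ t}.Finite := by
    obtain ⟨n, hn⟩ := (he.tail.top.eventually_gt_atTop (t : ℝ)).exists_forall_of_atTop
    refine (Set.finite_Iio n).subset fun m hm => ?_
    by_contra! h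
    exact absurd hm (not_le.2 (hn (m + 1) (by simp at h; omega)))
  have hset : {m : ℕ | ∑ j ∈ Finset.range (m + 1), e j ≤ ((t₀ + t : ℝ≥0) : ℝ)} =
      insert 0 (Nat.succ '' {m : ℕ | ∑ j ∈ Finset.range (m + 1), e (j + 1) ≤ t}) := by
    ext m
    rcases m with _ | m
    · simp [h0]
    · rw [mem_ofPred_eq, Finset.sum_range_succ', NNReal.coe_add, h0, add_comm (e 0),
        add_le_add_iff_right]
      simp
  rw [count, count, hset, Set.ncard_insert_of_notMem (by simp) (hfin.image _),
    Set.ncard_image_of_injective _ Nat.succ_injective]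

section path
variable {p : CompoundPoisson} {e y : ℕ → ℝ}

lemma path_of_lt (he : IsArrival e) {t : ℝ≥0} (ht : t < e 0) : path p e y t = -(p.a * t) := by
  rw [path, count_of_lt he ht]
  simp

lemma path_zero (he : IsArrival e) : path p e y 0 = 0 := by
  rw [path_of_lt he (by simpa using he.pos 0)]
  simp

lemma path_add (he : IsArrival e) {t₀ : ℝ≥0} (h0 : t₀ = e 0) (t : ℝ≥0) :
    path p e y (t₀ + t) = y 0 - p.a * e 0 + path p (fun j => e (j + 1)) (fun j => y (j + 1)) t := by
  rw [path, path, count_add he h0, Finset.sum_range_succ', NNReal.coe_add, h0]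
  ring

end path

/-! ### Gluing -/

section glue
variable {b δ x x' : ℝ} {w w' : Fin 2 → ℕ → ℝ≥0 → ℝ}

/-- `t` belongs to the phase number `n`. -/
def InPhase (b x : ℝ) (w : Fin 2 → ℕ → ℝ≥0 → ℝ) (n : ℕ) (t : ℝ≥0) : Prop :=
  (phase b x w n).1 ≤ t ∧ (t : ℝ≥0∞) < (phase b x w (n + 1)).1

/-- The position at the time `t` of the phase number `n`. -/
def phaseVal (b x : ℝ) (w : Fin 2 → ℕ → ℝ≥0 → ℝ) (n : ℕ) (t : ℝ≥0) : ℝ :=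
  if (phase b x w n).2 ≤ b then
    (phase b x w n).2 + w 0 n (t - (phase b x w n).1.toNNReal)
  else (phase b x w n).2 + w 1 n (t - (phase b x w n).1.toNNReal)

open Classical in
/-- The oscillating path with the value `δ` at the times that belong to no phase. -/
def oscD (b δ x : ℝ) (w : Fin 2 → ℕ → ℝ≥0 → ℝ) (t : ℝ≥0) : ℝ :=
  if h : ∃ n, InPhase b x w n t then phaseVal b x w (Nat.find h) t else δ

lemma phase_succ (n : ℕ) : phase b x w (n + 1) = if (phase b x w n).2 ≤ b then
    ((phase b x w n).1 + upTime (w 0 n) (b - (phase b x w n).2),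
      b + overshoot (w 0 n) (b - (phase b x w n).2))
    else ((phase b x w n).1 + downTime (w 1 n) (-((phase b x w n).2 - b)), b) := rfl

lemma phase_mono : Monotone fun n => (phase b x w n).1 := by
  refine monotone_nat_of_le_succ fun n => ?_
  rw [phase_succ]
  split_ifs <;> exact le_self_add

lemma InPhase.unique {n m : ℕ} {t : ℝ≥0} (hn : InPhase b x w n t) (hm : InPhase b x w m t) :
    n = m := by
  rcases lt_trichotomy n m with h | h | h
  · exact absurd (hn.2.trans_le ((phase_mono h).trans hm.1)) (lt_irrefl _)
  · exact h
  · exact absurd (hm.2.trans_le ((phase_mono h).trans hn.1)) (lt_irrefl _)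

lemma oscD_eq {n : ℕ} {t : ℝ≥0} (hn : InPhase b x w n t) :
    oscD b δ x w t = phaseVal b x w n t := by
  classical
  have h : ∃ n, InPhase b x w n t := ⟨n, hn⟩
  rw [oscD, dif_pos h, (Nat.find_spec h).unique hn]

/-- The default value is separated from the starting point so that it does not change when the path
is restarted elsewhere. -/
lemma oscPath_eq : oscPath b x w = oscD b x x w := by
  classical
  funext t
  by_cases h : ∃ n, InPhase b x w n t
  · rw [oscPath, dif_pos (show ∃ n, (phase b x w n).1 ≤ t ∧ (t : ℝ≥0∞) < (phase b x w (n + 1)).1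
      from h)]
    exact (oscD_eq (Nat.find_spec (p := fun n => (phase b x w n).1 ≤ t ∧
      (t : ℝ≥0∞) < (phase b x w (n + 1)).1) h)).symm
  · rw [oscPath, oscD, dif_neg h, dif_neg (show ¬ ∃ n, (phase b x w n).1 ≤ t ∧
      (t : ℝ≥0∞) < (phase b x w (n + 1)).1 from h)]

lemma oscD_congr {t t' : ℝ≥0}
    (h : ∀ n, InPhase b x' w' n t' → ∃ m, InPhase b x w m t ∧
      phaseVal b x w m t = phaseVal b x' w' n t')
    (hback : ∀ m, InPhase b x w m t → ∃ n, InPhase b x' w' n t') :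
    oscD b δ x w t = oscD b δ x' w' t' := by
  classical
  by_cases hv : ∃ n, InPhase b x' w' n t'
  · obtain ⟨n, hn⟩ := hv
    obtain ⟨m, hm, e⟩ := h n hn
    rw [oscD_eq hm, oscD_eq hn, e]
  · have hv' : ¬ ∃ m, InPhase b x w m t := fun ⟨m, hm⟩ => hv (hback m hm)
    rw [oscD, oscD, dif_neg hv, dif_neg hv']

lemma oscD_of_lt {t : ℝ≥0} (ht : t < (phase b x w 1).1) :
    oscD b δ x w t = if x ≤ b then x + w 0 0 t else x + w 1 0 t := by
  have h : InPhase b x w 0 t := ⟨by simp [phase], ht⟩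
  rw [oscD_eq h, phaseVal]
  simp [phase]

lemma time_lt_iff {t₀ t : ℝ≥0} {T : ℝ≥0∞} :
    ((t₀ + t : ℝ≥0) : ℝ≥0∞) < t₀ + T ↔ (t : ℝ≥0∞) < T := by
  rw [ENNReal.coe_add]
  exact ENNReal.add_lt_add_iff_left ENNReal.coe_ne_top

lemma le_time_iff {t₀ t : ℝ≥0} {T : ℝ≥0∞} :
    t₀ + T ≤ ((t₀ + t : ℝ≥0) : ℝ≥0∞) ↔ T ≤ t := by
  rw [ENNReal.coe_add]
  exact ENNReal.add_le_add_iff_left ENNReal.coe_ne_top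

lemma time_sub {t₀ t : ℝ≥0} {T : ℝ≥0∞} (hT : T ≠ ∞) :
    t₀ + t - (t₀ + T).toNNReal = t - T.toNNReal := by
  rw [ENNReal.toNNReal_add ENNReal.coe_ne_top hT, ENNReal.toNNReal_coe]
  exact add_tsub_add_eq_tsub_left _ _ _

/-- Restarting at the end of the first phase. -/
lemma oscD_next {t₀ : ℝ≥0} (h1 : phase b x w 1 = ((t₀ : ℝ≥0∞), x')) (t : ℝ≥0) :
    oscD b δ x w (t₀ + t) = oscD b δ x' (fun i n => w i (n + 1)) t := by
  set w' : Fin 2 → ℕ → ℝ≥0 → ℝ := fun i n => w i (n + 1)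
  have hph : ∀ n, phase b x w (n + 1) = (t₀ + (phase b x' w' n).1, (phase b x' w' n).2) := by
    intro n
    induction n with
    | zero => rw [h1]; simp [phase]
    | succ n ih =>
      rw [phase_succ, ih, phase_succ]
      dsimp only
      split_ifs <;> simp [add_assoc, w']
  have hiff : ∀ n, InPhase b x w (n + 1) (t₀ + t) ↔ InPhase b x' w' n t := by
    intro n
    rw [InPhase, InPhase, hph, hph]
    dsimp only
    rw [time_lt_iff, le_time_iff]
  refine oscD_congr (fun n hn => ⟨n + 1, (hiff n).2 hn, ?_⟩) fun m hm => ?_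
  · rw [phaseVal, phaseVal, hph]
    dsimp only
    rw [time_sub (ne_top_of_le_ne_top ENNReal.coe_ne_top hn.1)]
  · rcases m with _ | m
    · have := hm.2
      rw [zero_add, h1] at this
      exact absurd (this.trans_le (ENNReal.coe_le_coe.2 le_self_add)) (lt_irrefl _)
    · exact ⟨m, (hiff m).1 hm⟩

/-- Restarting within the first phase. -/
lemma oscD_skip {t₀ : ℝ≥0} (hside : x ≤ b ↔ x' ≤ b) (hw : ∀ i n, w i (n + 1) = w' i (n + 1))
    (hlow : x ≤ b → ∀ t, x + w 0 0 (t₀ + t) = x' + w' 0 0 t)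
    (hupp : ¬ x ≤ b → ∀ t, x + w 1 0 (t₀ + t) = x' + w' 1 0 t)
    (hexit : (phase b x w 1).1 = t₀ + (phase b x' w' 1).1) (t : ℝ≥0) :
    oscD b δ x w (t₀ + t) = oscD b δ x' w' t := by
  -- Positions are compared only after finite times: the overshoot at time `∞` is evaluated at `0`
  -- by `toNNReal` and has no meaning.
  have hph : ∀ n, (phase b x w (n + 1)).1 = t₀ + (phase b x' w' (n + 1)).1 ∧
      ((phase b x' w' (n + 1)).1 ≠ ∞ → (phase b x w (n + 1)).2 = (phase b x' w' (n + 1)).2) := by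
    intro n
    induction n with
    | zero =>
      refine ⟨hexit, fun hfin => ?_⟩
      have h0 : ∀ (x : ℝ) (w : Fin 2 → ℕ → ℝ≥0 → ℝ), phase b x w 0 = (0, x) := fun _ _ => rfl
      rw [phase_succ, phase_succ, h0, h0] at *
      dsimp only at *
      by_cases hx : x ≤ b
      · have hx' := hside.1 hx
        simp only [hx, hx', if_true, zero_add] at *
        rw [overshoot, overshoot, hexit, ENNReal.toNNReal_add ENNReal.coe_ne_top hfin,
          ENNReal.toNNReal_coe]
        have := hlow trivial (upTime (w' 0 0) (b - x')).toNNReal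
        linarith
      · have hx' : ¬ x' ≤ b := fun h => hx (hside.2 h)
        simp only [hx, hx', if_false]
    | succ n ih =>
      rw [phase_succ, phase_succ (x := x')]
      by_cases hfin : (phase b x' w' (n + 1)).1 = ∞
      · rw [ih.1, hfin]
        constructor
        · split_ifs <;> simp
        · intro h
          split_ifs at h <;> simp at h
      · rw [ih.1, ih.2 hfin, hw, hw]
        split_ifs
        · exact ⟨add_assoc _ _ _, fun _ => rfl⟩
        · exact ⟨add_assoc _ _ _, fun _ => rfl⟩
  have hiff : ∀ n, InPhase b x w n (t₀ + t) ↔ InPhase b x' w' n t := by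
    intro n
    rw [InPhase, InPhase, (hph n).1, time_lt_iff]
    rcases n with _ | n
    · simp [phase]
    · rw [(hph n).1, le_time_iff]
  refine oscD_congr (fun n hn => ⟨n, (hiff n).2 hn, ?_⟩) fun m hm => ⟨m, (hiff m).1 hm⟩
  rcases n with _ | n
  · simp only [phaseVal, phase, ENNReal.toNNReal_zero, tsub_zero]
    by_cases hx : x ≤ b
    · rw [if_pos hx, if_pos (hside.1 hx), hlow hx]
    · rw [if_neg hx, if_neg (fun h => hx (hside.2 h)), hupp hx]
  · have hfin : (phase b x' w' (n + 1)).1 ≠ ∞ := ne_top_of_le_ne_top ENNReal.coe_ne_top hn.1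
    rw [phaseVal, phaseVal, (hph n).1, (hph n).2 hfin, hw, hw, time_sub hfin]

end glue

end Oscillating
end

noncomputable section
namespace Oscillating

/-! ### The embedded walk -/

section walk
variable (p : Fin 2 → CompoundPoisson) (b r : ℝ) (lo : Bool)

/-- The number of the process that moves at the position `x`. -/
def side (x : ℝ) : Fin 2 := if x ≤ b then 0 else 1

/-- The level below `x` at which the walk stops. -/
def floor (x : ℝ) : ℝ := if x ≤ b then r else b

/-- The drift leads to the floor before the first arrival. Below `b` there is a floor only if
`lo` is true. -/
def Hits (x e : ℝ) : Prop := (x ≤ b → lo = true) ∧ x - floor b r x < (p (side b x)).a * e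

open Classical in
/-- The duration of the step. -/
def stepTime (x e : ℝ) : ℝ :=
  if Hits p b r lo x e then (x - floor b r x) / (p (side b x)).a else e

open Classical in
/-- The position after the step. -/
def stepPos (x : ℝ) (q : ℝ × ℝ) : ℝ :=
  if Hits p b r lo x q.1 then floor b r x else x - (p (side b x)).a * q.1 + q.2

/-- The phase goes on after the step. -/
def Stays (x : ℝ) (q : ℝ × ℝ) : Prop :=
  ¬ Hits p b r lo x q.1 ∧ (x ≤ b ↔ stepPos p b r lo x q ≤ b)

/-- The first interarrival time and the first jump. -/
def firstPair (i : Fin 2) (D : Idx → ℝ) : ℝ × ℝ := (D (.inl (i, 0, 0)), D (.inr (i, 0, 0)))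

/-- Discarding the first pair of the process `i`. -/
def skipDrv (i : Fin 2) (D : Idx → ℝ) : Idx → ℝ := D ∘ Sum.map (skipIdx i) (skipIdx i)

/-- Discarding the current copies. -/
def nextDrv (D : Idx → ℝ) : Idx → ℝ := D ∘ Sum.map nextIdx nextIdx

open Classical in
/-- The driver after the step. -/
def stepDrv (x : ℝ) (D : Idx → ℝ) : Idx → ℝ :=
  if Stays p b r lo x (firstPair (side b x) D) then skipDrv (side b x) D else nextDrv D

/-- The sample paths given by a driver. -/
def pths (D : Idx → ℝ) (i : Fin 2) (n : ℕ) : ℝ≥0 → ℝ :=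
  path (p i) (fun j => D (.inl (i, n, j))) (fun j => D (.inr (i, n, j)))

/-- Drivers that give regular paths. -/
structure IsGood (D : Idx → ℝ) : Prop where
  pos : ∀ k, 0 < D k
  arr : ∀ i n, IsArrival fun j => D (.inl (i, n, j))

variable {p b r lo}

lemma IsGood.skipDrv {D : Idx → ℝ} (hD : IsGood D) (i : Fin 2) : IsGood (skipDrv i D) := by
  refine ⟨fun k => hD.pos _, fun i' n => ?_⟩
  by_cases h : i' = i ∧ n = 0
  · have := (hD.arr i' n).tail
    simpa [Oscillating.skipDrv, skipIdx, h] using this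
  · simpa [Oscillating.skipDrv, skipIdx, h] using hD.arr i' n

lemma IsGood.nextDrv {D : Idx → ℝ} (hD : IsGood D) : IsGood (nextDrv D) :=
  ⟨fun _ => hD.pos _, fun i n => hD.arr i (n + 1)⟩

lemma IsGood.stepDrv {D : Idx → ℝ} (hD : IsGood D) (x : ℝ) : IsGood (stepDrv p b r lo x D) := by
  rw [Oscillating.stepDrv]
  split_ifs
  · exact hD.skipDrv _
  · exact hD.nextDrv

lemma pths_nextDrv (D : Idx → ℝ) : pths p (nextDrv D) = fun i n => pths p D i (n + 1) := rfl

lemma pths_skipDrv_succ (D : Idx → ℝ) (i i' : Fin 2) (n : ℕ) :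
    pths p (skipDrv i D) i' (n + 1) = pths p D i' (n + 1) := by
  simp [pths, skipDrv, skipIdx]

lemma pths_skipDrv_zero (D : Idx → ℝ) (i : Fin 2) : pths p (skipDrv i D) i 0 =
    path (p i) (fun j => D (.inl (i, 0, j + 1))) (fun j => D (.inr (i, 0, j + 1))) := by
  simp [pths, skipDrv, skipIdx]

section step
variable {D : Idx → ℝ} (hD : IsGood D) {t₀ : ℝ≥0} {x δ : ℝ}
include hD

lemma pths_of_lt (i : Fin 2) {t : ℝ≥0} (ht : t < D (.inl (i, 0, 0))) :
    pths p D i 0 t = -((p i).a * t) :=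
  path_of_lt (hD.arr i 0) ht

lemma pths_zero (i : Fin 2) (n : ℕ) : pths p D i n 0 = 0 :=
  path_zero (hD.arr i n)

lemma pths_add (i : Fin 2) (h0 : t₀ = D (.inl (i, 0, 0))) (t : ℝ≥0) :
    pths p D i 0 (t₀ + t) = D (.inr (i, 0, 0)) - (p i).a * D (.inl (i, 0, 0)) +
      pths p (skipDrv i D) i 0 t := by
  rw [pths_skipDrv_zero]
  exact path_add (hD.arr i 0) h0 t

/-- Until the first arrival the path only drifts down, so the level above cannot be exceeded before
it. -/
lemma exit_low (hx : x ≤ b) (h0 : t₀ = D (.inl (0, 0, 0))) :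
    (phase b x (pths p D) 1).1 = t₀ + upTime (pths p (skipDrv 0 D) 0 0)
      (b - (x - (p 0).a * D (.inl (0, 0, 0)) + D (.inr (0, 0, 0)))) := by
  rw [phase_succ]
  simp only [phase, hx, if_true, zero_add]
  refine firstTime_add (fun t ht => ?_) fun t => ?_
  · simp only [mem_ofPred_eq, not_lt]
    rw [pths_of_lt hD 0 (by rw [← h0]; exact_mod_cast ht)]
    have := mul_nonneg (p 0).a_pos.le (NNReal.coe_nonneg t)
    linarith
  · simp only [mem_ofPred_eq]
    rw [pths_add hD 0 h0]
    constructor <;> intro h <;> linarith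

/-- The hypothesis keeps the drifting path strictly above `b` at all times before the arrival, even
if it would meet `b` exactly there. -/
lemma exit_upp (hx : ¬ x ≤ b) (h0 : t₀ = D (.inl (1, 0, 0)))
    (hle : (p 1).a * D (.inl (1, 0, 0)) ≤ x - b) :
    (phase b x (pths p D) 1).1 = t₀ + downTime (pths p (skipDrv 1 D) 1 0)
      (-((x - (p 1).a * D (.inl (1, 0, 0)) + D (.inr (1, 0, 0))) - b)) := by
  rw [phase_succ]
  simp only [phase, hx, if_false, zero_add]
  refine firstTime_add (fun t ht => ?_) fun t => ?_
  · have ht' : (t : ℝ) < D (.inl (1, 0, 0)) := by rw [← h0]; exact_mod_cast ht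
    simp only [mem_ofPred_eq, not_le]
    rw [pths_of_lt hD 1 ht']
    have := mul_lt_mul_of_pos_left ht' (p 1).a_pos
    linarith
  · simp only [mem_ofPred_eq]
    rw [pths_add hD 1 h0]
    constructor <;> intro h <;> linarith

lemma oscD_drift (t : ℝ≥0) (ht : t < D (.inl (side b x, 0, 0)))
    (hb : ¬ x ≤ b → (p 1).a * t < x - b) :
    oscD b δ x (pths p D) t = x - (p (side b x)).a * t := by
  by_cases hx : x ≤ b
  · simp only [side, hx, if_true] at ht ⊢
    have he := (hD.pos (.inl (0, 0, 0))).le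
    rw [oscD_of_lt, if_pos hx, pths_of_lt hD 0 ht]
    · ring
    · rw [exit_low hD hx (t₀ := ⟨_, he⟩) rfl]
      exact lt_of_lt_of_le (ENNReal.coe_lt_coe.2 (by exact_mod_cast ht)) le_self_add
  · simp only [side, hx, if_false] at ht ⊢
    rw [oscD_of_lt, if_neg hx, pths_of_lt hD 1 ht]
    · ring
    · rw [phase_succ]
      simp only [phase, hx, if_false, zero_add]
      rw [downTime, firstTime]
      -- The exit time is an infimum, so a strict inequality needs a time `u > t` before which the
      -- level is not reached.
      have hgap : ∃ u : ℝ≥0, t < u ∧ (u : ℝ) < D (.inl (1, 0, 0)) ∧ (p 1).a * u < x - b := by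
        have ha := (p 1).a_pos
        have h1 : (t : ℝ) < (x - b) / (p 1).a := by
          rw [lt_div_iff₀ ha, mul_comm]; exact hb hx
        obtain ⟨u, hu1, hu2⟩ := exists_between (lt_min ht h1)
        refine ⟨⟨u, t.2.trans hu1.le⟩, hu1, hu2.trans_le (min_le_left _ _), ?_⟩
        have := hu2.trans_le (min_le_right _ _)
        rw [lt_div_iff₀ ha, mul_comm] at this
        exact this
      obtain ⟨u, hu1, hu2, hu3⟩ := hgap
      refine lt_of_lt_of_le (ENNReal.coe_lt_coe.2 hu1) (le_iInf₂ fun v hv => ?_)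
      by_contra! h
      have hvu : (v : ℝ) < u := by exact_mod_cast h
      simp only [mem_ofPred_eq] at hv
      rw [pths_of_lt hD 1 (hvu.trans hu2)] at hv
      have := mul_lt_mul_of_pos_left hvu (p 1).a_pos
      linarith

lemma oscD_zero : oscD b δ x (pths p D) 0 = x := by
  rw [oscD_drift hD 0 (by simpa using hD.pos _) (fun h => by simpa using h)]
  simp

/-- Below `b` the jump either leaves the path in the same phase, where one arrival is discarded, or
ends the phase exactly at the arrival, where fresh copies start. Above `b` a positive jump cannot
end the phase. -/
lemma oscD_jump (hh : ¬ Hits p b r lo x (D (.inl (side b x, 0, 0))))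
    (h0 : t₀ = D (.inl (side b x, 0, 0))) (t : ℝ≥0) :
    oscD b δ x (pths p D) (t₀ + t) = oscD b δ (stepPos p b r lo x (firstPair (side b x) D))
      (pths p (stepDrv p b r lo x D)) t := by
  have hpos : stepPos p b r lo x (firstPair (side b x) D) =
      x - (p (side b x)).a * D (.inl (side b x, 0, 0)) + D (.inr (side b x, 0, 0)) := by
    rw [stepPos, firstPair, if_neg hh]
  have hst : Stays p b r lo x (firstPair (side b x) D) ↔
      (x ≤ b ↔ stepPos p b r lo x (firstPair (side b x) D) ≤ b) := by
    rw [Stays, firstPair]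
    exact and_iff_right hh
  rw [stepDrv]
  simp only [hst]
  by_cases hx : x ≤ b
  · simp only [side, hx, if_true, true_iff] at hpos hst h0 ⊢
    rw [hpos]
    set x' := x - (p 0).a * D (.inl (0, 0, 0)) + D (.inr (0, 0, 0)) with hx'
    have hexit := exit_low (p := p) hD hx h0
    rw [← hx'] at hexit
    split_ifs with hx1
    · refine oscD_skip (by simp [hx, hx1]) (fun i n => (pths_skipDrv_succ D 0 i n).symm)
        (fun _ t => ?_) (fun h => absurd hx h) ?_ t
      · rw [pths_add hD 0 h0, hx']
        ring
      · rw [hexit, phase_succ (x := x')]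
        simp [phase, hx1]
    · have hz : upTime (pths p (skipDrv 0 D) 0 0) (b - x') = 0 := by
        refine firstTime_of_zero ?_
        simp only [mem_ofPred_eq]
        rw [pths_zero (hD.skipDrv 0)]
        linarith
      rw [hz, add_zero] at hexit
      rw [pths_nextDrv]
      refine oscD_next (Prod.ext hexit ?_) t
      have hT : upTime (pths p D 0 0) (b - x) = t₀ := by
        rw [← hexit, phase_succ]
        simp [phase, hx]
      rw [phase_succ]
      simp only [phase, hx, if_true, overshoot]
      rw [hT, ENNReal.toNNReal_coe]
      have := pths_add (p := p) hD 0 h0 0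
      rw [add_zero, pths_zero (hD.skipDrv 0)] at this
      rw [this, hx']
      ring
  · have hfl : floor b r x = b := by simp [floor, hx]
    have hle : (p 1).a * D (.inl (1, 0, 0)) ≤ x - b := by
      rw [Hits, hfl] at hh
      simp only [side, hx, if_false, false_imp_iff, true_and, not_lt] at hh
      exact hh
    simp only [side, hx, if_false, false_iff] at hpos hst h0 ⊢
    rw [hpos]
    set x' := x - (p 1).a * D (.inl (1, 0, 0)) + D (.inr (1, 0, 0)) with hx'
    have hx1 : ¬ x' ≤ b := by
      have := hD.pos (.inr (1, 0, 0))
      rw [not_le]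
      linarith
    rw [if_pos hx1]
    have hexit := exit_upp (p := p) hD hx h0 hle
    rw [← hx'] at hexit
    refine oscD_skip (by simp [hx, hx1]) (fun i n => (pths_skipDrv_succ D 1 i n).symm)
        (fun h => absurd h hx) (fun _ t => ?_) ?_ t
    · rw [pths_add hD 1 h0, hx']
      ring
    · rw [hexit, phase_succ (x := x')]
      simp [phase, hx1]

/-- The drift attains `b` before the first arrival, which ends the phase exactly at `b`; the rest of
the current copy is discarded. -/
lemma oscD_reach (hx : ¬ x ≤ b) (hh : Hits p b r lo x (D (.inl (1, 0, 0))))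
    (h0 : t₀ = (x - b) / (p 1).a) (t : ℝ≥0) :
    oscD b δ x (pths p D) (t₀ + t) = oscD b δ b (pths p (nextDrv D)) t := by
  have ha := (p 1).a_pos
  have hlt : t₀ < D (.inl (1, 0, 0)) := by
    have := hh.2
    simp only [floor, side, hx, if_false] at this
    rw [h0, div_lt_iff₀ ha, mul_comm]
    exact this
  have e0 : (p 1).a * t₀ = x - b := by rw [h0]; field_simp
  rw [pths_nextDrv]
  refine oscD_next ?_ t
  rw [phase_succ]
  simp only [phase, hx, if_false, zero_add]
  refine Prod.ext ?_ rfl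
  change firstTime _ = _
  rw [firstTime_add (t₀ := t₀) (A' := {t | pths p D 1 0 (t₀ + t) ≤ -(x - b)}) (fun t ht => ?_)
    (fun t => Iff.rfl), firstTime_of_zero, add_zero]
  · simp only [mem_ofPred_eq, add_zero]
    rw [pths_of_lt hD 1 hlt, e0]
  · have ht' : (t : ℝ) < t₀ := by exact_mod_cast ht
    simp only [mem_ofPred_eq, not_le]
    rw [pths_of_lt hD 1 (ht'.trans hlt)]
    have := mul_lt_mul_of_pos_left ht' ha
    linarith

/-- The first-step decomposition of the discounted payoff. -/
lemma hitVal_step {tgt : Set ℝ} {g : ℝ → ℂ} {s : ℝ}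
    (hrx : x ≤ b → lo = true → r ≤ x)
    (hdrift : ∀ v ≤ x, (¬ x ≤ b → b < v) → (x ≤ b → lo = true → r < v) → v ∉ tgt)
    (hr : lo = true → r ∈ tgt) :
    hitVal tgt g s (oscD b δ x (pths p D)) =
      (Real.exp (-(s * stepTime p b r lo x (D (.inl (side b x, 0, 0))))) : ℂ) *
        hitVal tgt g s (oscD b δ (stepPos p b r lo x (firstPair (side b x) D))
          (pths p (stepDrv p b r lo x D))) := by
  have ha := (p (side b x)).a_pos
  by_cases hh : Hits p b r lo x (D (.inl (side b x, 0, 0)))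
  · have hst : ¬ Stays p b r lo x (firstPair (side b x) D) := fun h => h.1 hh
    rw [stepTime, if_pos hh, stepPos, firstPair, if_pos hh, stepDrv, if_neg hst]
    have hfl : 0 ≤ x - floor b r x := by
      rw [floor]
      split_ifs with h
      · linarith [hrx h (hh.1 h)]
      · linarith
    obtain ⟨t₁, ht₁⟩ : ∃ t : ℝ≥0, (t : ℝ) = (x - floor b r x) / (p (side b x)).a :=
      ⟨⟨_, div_nonneg hfl ha.le⟩, rfl⟩
    have e0 : (p (side b x)).a * t₁ = x - floor b r x := by rw [ht₁, mul_div_cancel₀ _ ha.ne']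
    have hlt : (t₁ : ℝ) < D (.inl (side b x, 0, 0)) := by
      rw [ht₁, div_lt_iff₀ ha, mul_comm]
      exact hh.2
    have hbefore : ∀ t : ℝ≥0, t < t₁ → oscD b δ x (pths p D) t ∉ tgt := by
      intro t ht
      have ht' : (t : ℝ) < t₁ := by exact_mod_cast ht
      have h1 : (p (side b x)).a * t < x - floor b r x :=
        e0 ▸ mul_lt_mul_of_pos_left ht' ha
      rw [oscD_drift hD t (ht'.trans hlt) fun h => by simpa [side, floor, h] using h1]
      refine hdrift _ ?_ (fun h => ?_) (fun h _ => ?_)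
      · have := mul_nonneg ha.le (NNReal.coe_nonneg t)
        linarith
      · simp only [floor, h, if_false] at h1
        linarith
      · simp only [floor, h, if_true] at h1
        linarith
    rw [← ht₁]
    by_cases hxb : x ≤ b
    · have hrt := hr (hh.1 hxb)
      have e1 : floor b r x = r := by simp [floor, hxb]
      rw [e1] at e0 ⊢
      rw [hitVal_add (X' := fun t => oscD b δ x (pths p D) (t₁ + t)) hbefore (fun _ => rfl)]
      have e2 : oscD b δ x (pths p D) (t₁ + 0) = r := by
        rw [add_zero, oscD_drift hD t₁ hlt fun h => absurd hxb h, e0]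
        ring
      have e3 : oscD b δ r (pths p (nextDrv D)) 0 = r := oscD_zero hD.nextDrv
      rw [hitVal_zero (X := fun t => oscD b δ x (pths p D) (t₁ + t)) (by rw [e2]; exact hrt),
        hitVal_zero (X := oscD b δ r (pths p (nextDrv D))) (by rw [e3]; exact hrt), e2, e3]
    · have e1 : floor b r x = b := by simp [floor, hxb]
      have e2 : side b x = 1 := by simp [side, hxb]
      refine hitVal_add hbefore fun t => ?_
      rw [e1]
      exact oscD_reach (r := r) (lo := lo) hD hxb (by rw [← e2]; exact hh)
        (by rw [ht₁, e1, e2]) t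
  · rw [stepTime, if_neg hh]
    have h0 := (hD.pos (.inl (side b x, 0, 0))).le
    refine hitVal_add (t₀ := ⟨_, h0⟩) (fun t ht => ?_) fun t => oscD_jump hD hh rfl t
    have ht' : (t : ℝ) < D (.inl (side b x, 0, 0)) := by exact_mod_cast ht
    have h1 := mul_lt_mul_of_pos_left ht' ha
    have h2 : (x ≤ b → lo = true) → (p (side b x)).a * D (.inl (side b x, 0, 0)) ≤
        x - floor b r x := by
      intro h
      rw [Hits, not_and, not_lt] at hh
      exact hh h
    rw [oscD_drift hD t ht' fun h => by
      have h3 := h2 fun h' => absurd h' h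
      simp only [side, floor, h, if_false] at h1 h3
      linarith]
    refine hdrift _ ?_ (fun h => ?_) (fun h hlo => ?_)
    · have := mul_nonneg ha.le (NNReal.coe_nonneg t)
      linarith
    · have h3 := h2 fun h' => absurd h' h
      simp only [floor, h, if_false] at h3
      linarith
    · have h3 := h2 fun _ => hlo
      simp only [floor, h, if_true] at h3
      linarith

end step
end walk

end Oscillating
end

noncomputable section
namespace Oscillating

/-! ### The exponential law -/

section exponential
variable {l : ℝ}

lemma integral_expMeasure (hl : 0 < l) (f : ℝ → ℂ) :
    ∫ t, f t ∂(expMeasure l) = ∫ t in Ioi (0 : ℝ), ((l * Real.exp (-(l * t)) : ℝ) : ℂ) * f t := by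
  have h : expMeasure l = volume.withDensity (exponentialPDF l) := rfl
  have e : exponentialPDF l = fun t => ENNReal.ofReal (exponentialPDFReal l t) := rfl
  rw [h, e, integral_withDensity_eq_integral_toReal_smul (by fun_prop)
    (Eventually.of_forall fun _ => ENNReal.ofReal_lt_top), ← integral_Ici_eq_integral_Ioi,
    ← setIntegral_eq_integral_of_forall_compl_eq_zero (s := Ici 0)]
  · refine setIntegral_congr_fun measurableSet_Ici fun t ht => ?_
    rw [ENNReal.toReal_ofReal (exponentialPDFReal_nonneg hl t), Complex.real_smul]
    congr 2
    have := exponentialPDF_of_nonneg (r := l) (mem_Ici.1 ht)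
    rw [exponentialPDF, ENNReal.ofReal_eq_ofReal_iff (exponentialPDFReal_nonneg hl t)
      (by positivity)] at this
    exact this
  · intro t ht
    have : exponentialPDF l t = 0 := exponentialPDF_of_neg (not_le.1 ht)
    rw [exponentialPDF] at this
    rw [this]
    simp

lemma ae_expMeasure_pos : ∀ᵐ t ∂(expMeasure l), 0 < t := by
  have h : expMeasure l = volume.withDensity (exponentialPDF l) := rfl
  rw [h, ae_withDensity_iff (by
    have e : exponentialPDF l = fun t => ENNReal.ofReal (exponentialPDFReal l t) := rfl
    rw [e]; fun_prop)]
  have h2 : ∀ᵐ t : ℝ, t ≠ 0 := by simp [ae_iff]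
  filter_upwards [h2] with t ht hne
  by_contra! hle
  exact hne (exponentialPDF_of_neg (lt_of_le_of_ne hle ht))

end exponential

lemma integral_lt_one {Ω : Type*} [MeasurableSpace Ω] {ν : Measure Ω} [IsProbabilityMeasure ν]
    {f : Ω → ℝ} (hf : Measurable f) (h0 : ∀ᵐ t ∂ν, 0 ≤ f t) (h1 : ∀ᵐ t ∂ν, f t < 1) :
    ∫ t, f t ∂ν < 1 := by
  have hi : Integrable f ν := by
    refine Integrable.of_bound (C := 1) hf.aestronglyMeasurable ?_
    filter_upwards [h0, h1] with t ht0 ht1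
    rw [Real.norm_of_nonneg ht0]
    exact ht1.le
  have h2 : 0 < ∫ t, (1 - f t) ∂ν := by
    rw [integral_pos_iff_support_of_nonneg_ae]
    · refine pos_iff_ne_zero.2 fun h => ?_
      have hF : ∀ᵐ t ∂ν, False := by
        filter_upwards [measure_eq_zero_iff_ae_notMem.1 h, h1] with t ht ht1
        exact ht (sub_pos.2 ht1).ne'
      have : ν = 0 := by rwa [← ae_eq_bot, ← Filter.eventually_false_iff_eq_bot]
      exact IsProbabilityMeasure.ne_zero ν this
    · filter_upwards [h1] with t ht using by simpa using ht.le
    · exact (integrable_const _).sub hi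
  rw [integral_sub (integrable_const _) hi] at h2
  simp at h2
  linarith

/-! ### Regularity of the driver -/

section regular
variable {p : Fin 2 → CompoundPoisson}

lemma hasLaw_coord (k : Idx) : MeasurePreserving (fun D : Idx → ℝ => D k) (drvLaw p)
    (idxLaw p k) := measurePreserving_eval_infinitePi (idxLaw p) k

lemma ae_coord_pos (k : Idx) : ∀ᵐ D ∂(drvLaw p), 0 < D k := by
  refine (hasLaw_coord k).quasiMeasurePreserving.ae ?_
  rcases k with k | k
  · exact ae_expMeasure_pos
  · exact (p k.1).ae_jump_pos

/-- The expectation of `e^{-S_N}` is `m ^ N` with `m < 1` by independence. The sum over `N` is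
therefore finite almost surely, which forces `S_N → ∞`. -/
lemma ae_arrival_top (i : Fin 2) (n : ℕ) : ∀ᵐ D ∂(drvLaw p),
    Tendsto (fun m => ∑ j ∈ Finset.range m, D (.inl (i, n, j))) atTop atTop := by
  set X : ℕ → (Idx → ℝ) → ℝ := fun j D => D (.inl (i, n, j)) with hX
  have hXm : ∀ j, Measurable (X j) := fun j => measurable_pi_apply _
  have hind : iIndepFun (fun (k : Idx) (D : Idx → ℝ) => D k) (drvLaw p) :=
    iIndepFun_infinitePi (X := fun _ x => x) fun _ => measurable_id
  have hXi : iIndepFun X (drvLaw p) :=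
    hind.precomp (g := fun j => .inl (i, n, j)) fun a b h => by simpa using h
  have : IsProbabilityMeasure (expMeasure (p i).lam) :=
    isProbabilityMeasure_expMeasure (p i).lam_pos
  set m := ∫ t, Real.exp (-t) ∂(expMeasure (p i).lam) with hm
  have hm0 : 0 ≤ m := integral_nonneg fun t => (Real.exp_pos _).le
  have hm1 : m < 1 := by
    refine integral_lt_one (by fun_prop) (Eventually.of_forall fun t => (Real.exp_pos _).le) ?_
    filter_upwards [ae_expMeasure_pos] with t ht
    rw [Real.exp_lt_one_iff]
    linarith
  have hmgf : ∀ j, mgf (X j) (drvLaw p) (-1) = m := by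
    intro j
    have e : expMeasure (p i).lam = (drvLaw p).map (X j) :=
      (hasLaw_coord (p := p) (.inl (i, n, j))).map_eq.symm
    rw [mgf, hm, e, integral_map (hXm j).aemeasurable (by fun_prop)]
    simp
  have hS : ∀ N, mgf (∑ j ∈ Finset.range N, X j) (drvLaw p) (-1) = m ^ N := by
    intro N
    rw [hXi.mgf_sum hXm]
    simp [hmgf]
  have hpos : ∀ᵐ D ∂(drvLaw p), ∀ j, 0 < X j D := ae_all_iff.2 fun j => ae_coord_pos _
  have hlin : ∀ N, ∫⁻ D, ENNReal.ofReal (Real.exp (-∑ j ∈ Finset.range N, X j D)) ∂(drvLaw p) =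
      ENNReal.ofReal m ^ N := by
    intro N
    have hmeas : Measurable fun D => Real.exp (-∑ j ∈ Finset.range N, X j D) := by fun_prop
    rw [← ENNReal.ofReal_pow hm0, ← hS N, mgf, ofReal_integral_eq_lintegral_ofReal]
    · simp
    · refine Integrable.of_bound (C := 1) (by
        simpa using hmeas.aestronglyMeasurable) ?_
      filter_upwards [hpos] with D hD
      rw [Real.norm_of_nonneg (Real.exp_pos _).le, Real.exp_le_one_iff]
      have := Finset.sum_nonneg fun j (_ : j ∈ Finset.range N) => (hD j).le
      simpa using this
    · exact Eventually.of_forall fun D => (Real.exp_pos _).le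
  have hsum : ∫⁻ D, ∑' N, ENNReal.ofReal (Real.exp (-∑ j ∈ Finset.range N, X j D))
      ∂(drvLaw p) ≠ ∞ := by
    rw [lintegral_tsum fun N => by fun_prop]
    simp only [hlin]
    rw [ENNReal.tsum_geometric]
    refine ENNReal.inv_ne_top.2 (tsub_pos_of_lt ?_).ne'
    rw [← ENNReal.ofReal_one]
    exact (ENNReal.ofReal_lt_ofReal_iff one_pos).2 hm1
  filter_upwards [ae_lt_top (Measurable.tsum fun N => by fun_prop) hsum] with D hD
  have h0 := ENNReal.tendsto_atTop_zero_of_tsum_ne_top hD.ne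
  have h1 : Tendsto (fun N => Real.exp (-∑ j ∈ Finset.range N, X j D)) atTop (𝓝 0) := by
    have := (ENNReal.tendsto_toReal ENNReal.zero_ne_top).comp h0
    simpa [Function.comp_def, ENNReal.toReal_ofReal (Real.exp_pos _).le] using this
  have h2 := Real.tendsto_exp_comp_nhds_zero.1 h1
  exact tendsto_neg_atBot_iff.1 h2

lemma ae_isGood : ∀ᵐ D ∂(drvLaw p), IsGood D := by
  have h1 : ∀ᵐ D ∂(drvLaw p), ∀ k, 0 < D k := ae_all_iff.2 fun k => ae_coord_pos k
  have h2 : ∀ᵐ D ∂(drvLaw p), ∀ q : Fin 2 × ℕ,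
      Tendsto (fun m => ∑ j ∈ Finset.range m, D (.inl (q.1, q.2, j))) atTop atTop :=
    ae_all_iff.2 fun q => ae_arrival_top q.1 q.2
  filter_upwards [h1, h2] with D hD1 hD2
  exact ⟨hD1, fun i n => ⟨fun j => hD1 _, hD2 (i, n)⟩⟩

end regular

/-! ### Measurability of the walk -/

section measurable
variable {p : Fin 2 → CompoundPoisson} {b r s : ℝ} {lo : Bool}

lemma measurable_side : Measurable (side b) :=
  Measurable.ite measurableSet_Iic measurable_const measurable_const

lemma measurable_drift : Measurable fun x => (p (side b x)).a :=
  (measurable_of_countable fun i : Fin 2 => (p i).a).comp measurable_side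

lemma measurable_floor : Measurable (floor b r) :=
  Measurable.ite measurableSet_Iic measurable_const measurable_const

lemma measurableSet_hits : MeasurableSet {q : ℝ × ℝ | Hits p b r lo q.1 q.2} := by
  have h1 : MeasurableSet {q : ℝ × ℝ | q.1 ≤ b → lo = true} := by
    simp only [imp_iff_not_or]
    exact (measurableSet_le measurable_fst measurable_const).compl.union (MeasurableSet.const _)
  have h2 := measurable_drift (p := p) (b := b)
  have h3 := measurable_floor (b := b) (r := r)
  exact h1.inter (measurableSet_lt (measurable_fst.sub (h3.comp measurable_fst))
    ((h2.comp measurable_fst).mul measurable_snd))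

lemma measurable_stepTime : Measurable fun q : ℝ × ℝ => stepTime p b r lo q.1 q.2 := by
  have h2 := measurable_drift (p := p) (b := b)
  have h3 := measurable_floor (b := b) (r := r)
  exact Measurable.ite measurableSet_hits ((measurable_fst.sub (h3.comp measurable_fst)).div
    (h2.comp measurable_fst)) measurable_snd

lemma measurable_stepPos : Measurable fun q : ℝ × ℝ × ℝ => stepPos p b r lo q.1 q.2 := by
  have h2 := measurable_drift (p := p) (b := b)
  have h3 := measurable_floor (b := b) (r := r)
  have h4 : Measurable fun q : ℝ × ℝ × ℝ => (q.1, q.2.1) := by fun_prop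
  exact Measurable.ite (h4 measurableSet_hits) (h3.comp measurable_fst)
    ((measurable_fst.sub ((h2.comp measurable_fst).mul (measurable_fst.comp measurable_snd))).add
      (measurable_snd.comp measurable_snd))

lemma measurableSet_stays : MeasurableSet {q : ℝ × ℝ × ℝ | Stays p b r lo q.1 q.2} := by
  have h4 : Measurable fun q : ℝ × ℝ × ℝ => (q.1, q.2.1) := by fun_prop
  have h5 := measurable_stepPos (p := p) (b := b) (r := r) (lo := lo)
  have h6 : MeasurableSet {q : ℝ × ℝ × ℝ | q.1 ≤ b} :=
    measurableSet_le measurable_fst measurable_const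
  have h7 : MeasurableSet {q : ℝ × ℝ × ℝ | stepPos p b r lo q.1 q.2 ≤ b} :=
    measurableSet_le h5 measurable_const
  refine MeasurableSet.inter (h4 measurableSet_hits).compl ?_
  simp only [iff_iff_and_or_not_and_not]
  exact (h6.inter h7).union (h6.compl.inter h7.compl)

lemma measurable_firstPair (i : Fin 2) : Measurable (firstPair i) :=
  (measurable_pi_apply _).prodMk (measurable_pi_apply _)

lemma measurable_firstPair_side :
    Measurable fun q : ℝ × (Idx → ℝ) => firstPair (side b q.1) q.2 := by
  have h : Measurable fun q : Fin 2 × (Idx → ℝ) => firstPair q.1 q.2 :=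
    measurable_from_prod_countable_right fun i => measurable_firstPair i
  exact h.comp ((measurable_side.comp measurable_fst).prodMk measurable_snd)

lemma measurable_skipDrv (i : Fin 2) : Measurable (skipDrv i) :=
  measurable_pi_lambda _ fun _ => measurable_pi_apply _

lemma measurable_nextDrv : Measurable nextDrv :=
  measurable_pi_lambda _ fun _ => measurable_pi_apply _

lemma measurable_stepDrv : Measurable (Function.uncurry (stepDrv p b r lo)) := by
  have h : Measurable fun q : Fin 2 × (Idx → ℝ) => skipDrv q.1 q.2 :=
    measurable_from_prod_countable_right fun i => measurable_skipDrv i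
  exact Measurable.ite
    ((measurable_fst.prodMk measurable_firstPair_side) measurableSet_stays)
    (h.comp ((measurable_side.comp measurable_fst).prodMk measurable_snd))
    (measurable_nextDrv.comp measurable_snd)

/-- The discount of the step. -/
def stepDisc (p : Fin 2 → CompoundPoisson) (b r s : ℝ) (lo : Bool) (x e : ℝ) : ℝ≥0 :=
  Real.toNNReal (Real.exp (-(s * stepTime p b r lo x e)))

lemma coe_stepDisc (x e : ℝ) : (stepDisc p b r s lo x e : ℝ) =
    Real.exp (-(s * stepTime p b r lo x e)) := Real.coe_toNNReal _ (Real.exp_pos _).le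

lemma measurable_stepDisc : Measurable fun q : ℝ × ℝ => stepDisc p b r s lo q.1 q.2 :=
  (Real.measurable_exp.comp (measurable_stepTime.const_mul s).neg).real_toNNReal

/-- The law of the first pair. -/
def pairLaw (p : CompoundPoisson) : Measure (ℝ × ℝ) := (expMeasure p.lam).prod p.jump

instance (p : CompoundPoisson) : IsProbabilityMeasure (pairLaw p) := by
  have := isProbabilityMeasure_expMeasure p.lam_pos
  rw [pairLaw]
  infer_instance

lemma firstPair_preserving (i : Fin 2) :
    MeasurePreserving (firstPair i) (drvLaw p) (pairLaw (p i)) :=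
  ⟨measurable_firstPair i, Measure.infinitePi_map_eval_prod (P := idxLaw p) (by simp)⟩

/-- The choice depends only on the first component, so the law can be compared separately on the two
parts of the product. -/
lemma measurePreserving_ite {α β γ : Type*} [MeasurableSpace α] [MeasurableSpace β]
    [MeasurableSpace γ] {P : Measure α} {ν : Measure (β × γ)} {κ : α → β} {S₁ S₂ : α → γ}
    (h1 : MeasurePreserving (fun a => (κ a, S₁ a)) P ν)
    (h2 : MeasurePreserving (fun a => (κ a, S₂ a)) P ν) {c : β → Prop} [DecidablePred c]
    (hc : MeasurableSet {x | c x}) :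
    MeasurePreserving (fun a => (κ a, if c (κ a) then S₁ a else S₂ a)) P ν := by
  have hκ : Measurable κ := measurable_fst.comp h1.measurable
  have hm : Measurable fun a => (κ a, if c (κ a) then S₁ a else S₂ a) :=
    hκ.prodMk (Measurable.ite (hκ hc) (measurable_snd.comp h1.measurable)
      (measurable_snd.comp h2.measurable))
  refine ⟨hm, Measure.ext fun M hM => ?_⟩
  have hC : MeasurableSet {q : β × γ | c q.1} := measurable_fst hc
  rw [Measure.map_apply hm hM, ← measure_inter_add_sdiff _ (hκ hc),
    ← measure_inter_add_sdiff M hC]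
  congr 1
  · rw [← h1.measure_preimage (hM.inter hC).nullMeasurableSet]
    congr 1
    ext a
    by_cases h : c (κ a) <;> simp [h]
  · rw [← h2.measure_preimage (hM.diff hC).nullMeasurableSet]
    congr 1
    ext a
    by_cases h : c (κ a) <;> simp [h]

/-- Whether the current copy continues is decided by the first pair alone, and in either case the
remaining driver has the original law and is independent of that pair. -/
lemma stepDrv_preserving (x : ℝ) : MeasurePreserving
    (fun D => (firstPair (side b x) D, stepDrv p b r lo x D)) (drvLaw p)
    ((pairLaw (p (side b x))).prod (drvLaw p)) := by
  classical
  have hc : MeasurableSet {q : ℝ × ℝ | Stays p b r lo x q} :=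
    (measurable_const.prodMk measurable_id) measurableSet_stays
  have h1 := drvLaw_split (p := p) (skipIdx_injective (side b x)) (skipIdx_fst _)
    (skipIdx_ne (side b x))
  have h2 := drvLaw_split (p := p) nextIdx_injective (fun _ => rfl) (nextIdx_ne (side b x))
  have := measurePreserving_ite (κ := firstPair (side b x)) (S₁ := skipDrv (side b x))
    (S₂ := nextDrv) h1 h2 hc
  exact this

/-- The Markov property of the embedded walk, for the pair of discount and new position. -/
lemma step_preserving (x : ℝ) : MeasurePreserving
    (fun D => ((stepDisc p b r s lo x (firstPair (side b x) D).1,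
      stepPos p b r lo x (firstPair (side b x) D)), stepDrv p b r lo x D)) (drvLaw p)
    (((drvLaw p).map fun D => (stepDisc p b r s lo x (firstPair (side b x) D).1,
      stepPos p b r lo x (firstPair (side b x) D))).prod (drvLaw p)) := by
  have h0 := stepDrv_preserving (p := p) (b := b) (r := r) (lo := lo) x
  have hm : Measurable fun q : ℝ × ℝ => (stepDisc p b r s lo x q.1, stepPos p b r lo x q) :=
    (measurable_stepDisc.comp (measurable_const.prodMk measurable_fst)).prodMk
      (measurable_stepPos.comp (measurable_const.prodMk measurable_id))
  have h1 : MeasurePreserving (fun q : ℝ × ℝ => (stepDisc p b r s lo x q.1, stepPos p b r lo x q))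
      (pairLaw (p (side b x))) ((drvLaw p).map fun D =>
        (stepDisc p b r s lo x (firstPair (side b x) D).1,
          stepPos p b r lo x (firstPair (side b x) D))) := by
    refine ⟨hm, ?_⟩
    rw [← (firstPair_preserving (p := p) (side b x)).map_eq,
      Measure.map_map hm (measurable_firstPair _)]
    rfl
  have hp : IsProbabilityMeasure ((drvLaw p).map fun D =>
      (stepDisc p b r s lo x (firstPair (side b x) D).1,
        stepPos p b r lo x (firstPair (side b x) D))) := by
    rw [← h1.map_eq]
    exact Measure.isProbabilityMeasure_map hm.aemeasurable
  exact (h1.prod (MeasurePreserving.id (drvLaw p))).comp h0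

end measurable

end Oscillating
end

noncomputable section
namespace Oscillating

/-! ### Discounted payoffs from the one-step equation -/

/-- A target set of a first passage: it is not met before the end of a step, except at the
floor `r` (if there is one). -/
structure IsTarget (b r : ℝ) (lo : Bool) (tgt : Set ℝ) : Prop where
  meas : MeasurableSet tgt
  floor_le : ∀ x ∉ tgt, x ≤ b → lo = true → r ≤ x
  drift : ∀ x ∉ tgt, ∀ v ≤ x, (¬ x ≤ b → b < v) → (x ≤ b → lo = true → r < v) → v ∉ tgt
  reach : lo = true → r ∈ tgt

section walk
variable {p : Fin 2 → CompoundPoisson} {b r s : ℝ} {lo : Bool} {tgt : Set ℝ}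

lemma stepTime_nonneg (ht : IsTarget b r lo tgt) {x e : ℝ} (hx : x ∉ tgt) (he : 0 ≤ e) :
    0 ≤ stepTime p b r lo x e := by
  rw [stepTime]
  split_ifs with h
  · refine div_nonneg ?_ (p _).a_pos.le
    rw [floor]
    split_ifs with hb
    · linarith [ht.floor_le x hx hb (h.1 hb)]
    · linarith
  · exact he

/-- A step that drifts down to `b` from just above may take almost no time, so the discount alone
does not contract. A larger weight above `b` pays for such steps, and the discount at an arrival
pays for jumping up. -/
lemma exists_weight (hs : 0 < s) (ht : IsTarget b r lo tgt) : ∃ (W : ℝ → ℝ≥0∞) (θ : ℝ≥0∞),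
    Measurable W ∧ θ < 1 ∧ (∀ x ∈ tgtᶜ, 1 ≤ W x) ∧ (∀ x, W x ≠ ∞) ∧
    ∀ x ∈ tgtᶜ, ∫⁻ D, stepDisc p b r s lo x (firstPair (side b x) D).1 *
      W (stepPos p b r lo x (firstPair (side b x) D)) ∂(drvLaw p) ≤ θ * W x := by
  classical
  have hprob : ∀ i, IsProbabilityMeasure (expMeasure (p i).lam) := fun i =>
    isProbabilityMeasure_expMeasure (p i).lam_pos
  have hexp1 : ∀ i, ∀ᵐ t ∂(expMeasure (p i).lam), Real.exp (-(s * t)) < 1 := by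
    intro i
    filter_upwards [ae_expMeasure_pos] with t ht
    rw [Real.exp_lt_one_iff]
    have := mul_pos hs ht
    linarith
  set m₁ := ∫ t, Real.exp (-(s * t)) ∂(expMeasure (p 0).lam) with hm₁
  have hm₁0 : 0 ≤ m₁ := integral_nonneg fun t => (Real.exp_pos _).le
  have hm₁1 : m₁ < 1 :=
    integral_lt_one (by fun_prop) (Eventually.of_forall fun t => (Real.exp_pos _).le) (hexp1 0)
  -- The weight above `b` must exceed `1` and still satisfy `C m₁ < 1`; `2 / (1 + m₁)` does, because
  -- `m₁ < 1`.
  obtain ⟨C, hC1, hCm⟩ : ∃ C : ℝ, 1 < C ∧ C * m₁ < 1 := by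
    refine ⟨2 / (1 + m₁), ?_, ?_⟩
    · rw [lt_div_iff₀ (by linarith)]; linarith
    · rw [div_mul_eq_mul_div, div_lt_one (by linarith)]; linarith
  have hC0 : 0 < C := one_pos.trans hC1
  -- Above `b` the loss is either the discount up to an arrival or the drop of the weight from `C`
  -- to at most `1`; the maximum covers both cases.
  set m₂ := ∫ t, max C⁻¹ (Real.exp (-(s * t))) ∂(expMeasure (p 1).lam) with hm₂
  have hmax0 : ∀ t, 0 ≤ max C⁻¹ (Real.exp (-(s * t))) := fun t =>
    (Real.exp_pos _).le.trans (le_max_right _ _)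
  have hm₂1 : m₂ < 1 := by
    refine integral_lt_one (by fun_prop) (Eventually.of_forall hmax0) ?_
    filter_upwards [hexp1 1] with t ht
    exact max_lt (inv_lt_one_of_one_lt₀ hC1) ht
  set W : ℝ → ℝ≥0∞ := fun x => if x ∈ tgt then 0 else if x ≤ b then 1 else ENNReal.ofReal C
    with hW
  have hC1' : 1 ≤ ENNReal.ofReal C := by
    rw [← ENNReal.ofReal_one]; exact ENNReal.ofReal_le_ofReal hC1.le
  have hWC : ∀ x, W x ≤ ENNReal.ofReal C := by
    intro x
    simp only [hW]
    split_ifs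
    · exact zero_le
    · exact hC1'
    · exact le_rfl
  refine ⟨W, max (ENNReal.ofReal (C * m₁)) (ENNReal.ofReal m₂), ?_, ?_, ?_, ?_, ?_⟩
  · exact Measurable.ite ht.meas measurable_const
      (Measurable.ite measurableSet_Iic measurable_const measurable_const)
  · rw [max_lt_iff, ← ENNReal.ofReal_one]
    exact ⟨(ENNReal.ofReal_lt_ofReal_iff one_pos).2 hCm,
      (ENNReal.ofReal_lt_ofReal_iff one_pos).2 hm₂1⟩
  · intro x hx
    simp only [hW, if_neg (show x ∉ tgt from hx)]
    split_ifs
    · exact le_rfl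
    · exact hC1'
  · intro x
    exact ne_top_of_le_ne_top ENNReal.ofReal_ne_top (hWC x)
  intro x hx
  have hx' : x ∉ tgt := hx
  have hdisc : ∀ e, (stepDisc p b r s lo x e : ℝ≥0∞) =
      ENNReal.ofReal (Real.exp (-(s * stepTime p b r lo x e))) := fun e => rfl
  have hmiss : ∀ q : ℝ × ℝ, ¬ Hits p b r lo x q.1 → (stepDisc p b r s lo x q.1 : ℝ≥0∞) *
      W (stepPos p b r lo x q) ≤ ENNReal.ofReal (C * Real.exp (-(s * q.1))) := by
    intro q hq
    rw [hdisc, stepTime, if_neg hq, mul_comm C, ENNReal.ofReal_mul (Real.exp_pos _).le]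
    gcongr
    exact hWC _
  have hpush : ∀ f : ℝ → ℝ, Measurable f → (∀ t, 0 ≤ f t) →
      Integrable f (expMeasure (p (side b x)).lam) →
      (∀ D : Idx → ℝ, IsGood D → (stepDisc p b r s lo x (firstPair (side b x) D).1 : ℝ≥0∞) *
        W (stepPos p b r lo x (firstPair (side b x) D)) ≤
          ENNReal.ofReal (f (D (.inl (side b x, 0, 0))))) →
      ∫⁻ D, stepDisc p b r s lo x (firstPair (side b x) D).1 *
        W (stepPos p b r lo x (firstPair (side b x) D)) ∂(drvLaw p) ≤
        ENNReal.ofReal (∫ t, f t ∂(expMeasure (p (side b x)).lam)) := by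
    intro f hf hf0 hfi hle
    calc _ ≤ ∫⁻ D, ENNReal.ofReal (f (D (.inl (side b x, 0, 0)))) ∂(drvLaw p) := by
          refine lintegral_mono_ae ?_
          filter_upwards [ae_isGood] with D hD using hle D hD
      _ = ∫⁻ t, ENNReal.ofReal (f t) ∂(expMeasure (p (side b x)).lam) :=
          (hasLaw_coord (p := p) (.inl (side b x, 0, 0))).lintegral_comp hf.ennreal_ofReal
      _ = _ := (ofReal_integral_eq_lintegral_ofReal hfi (Eventually.of_forall hf0)).symm
  have hbdd : ∀ i (f : ℝ → ℝ), Measurable f → (∀ t, 0 ≤ f t) → (∀ t, 0 < t → f t ≤ C) →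
      Integrable f (expMeasure (p i).lam) := by
    intro i f hf hf0 hfC
    refine Integrable.of_bound (C := C) hf.aestronglyMeasurable ?_
    filter_upwards [ae_expMeasure_pos] with t ht
    rw [Real.norm_of_nonneg (hf0 t)]
    exact hfC t ht
  have hexple : ∀ t, 0 < t → Real.exp (-(s * t)) ≤ 1 := fun t ht => by
    rw [Real.exp_le_one_iff]
    have := mul_pos hs ht
    linarith
  by_cases hb : x ≤ b
  · have e2 : side b x = 0 := by simp [side, hb]
    refine (hpush (fun t => C * Real.exp (-(s * t))) (by fun_prop) (fun t => by positivity)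
      (hbdd _ _ (by fun_prop) (fun t => by positivity) fun t ht =>
        mul_le_of_le_one_right hC0.le (hexple t ht)) fun D hD => ?_).trans ?_
    · by_cases hh : Hits p b r lo x (firstPair (side b x) D).1
      · have : W (stepPos p b r lo x (firstPair (side b x) D)) = 0 := by
          rw [stepPos, if_pos hh, floor, if_pos hb]
          simp only [hW, if_pos (ht.reach (hh.1 hb))]
        rw [this, mul_zero]
        exact zero_le
      · exact hmiss _ hh
    · rw [integral_const_mul, e2]
      simp only [hW, if_neg hx', if_pos hb, mul_one]
      exact le_max_left _ _
  · have e2 : side b x = 1 := by simp [side, hb]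
    refine (hpush (fun t => C * max C⁻¹ (Real.exp (-(s * t)))) (by fun_prop)
      (fun t => mul_nonneg hC0.le (hmax0 t))
      (hbdd _ _ (by fun_prop) (fun t => mul_nonneg hC0.le (hmax0 t)) fun t ht =>
        mul_le_of_le_one_right hC0.le (max_le (inv_le_one_of_one_le₀ hC1.le) (hexple t ht)))
      fun D hD => ?_).trans ?_
    · by_cases hh : Hits p b r lo x (firstPair (side b x) D).1
      · have h1 : W (stepPos p b r lo x (firstPair (side b x) D)) ≤ 1 := by
          rw [stepPos, if_pos hh, floor, if_neg hb]
          simp only [hW, le_refl, if_true]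
          split_ifs <;> simp
        have h2 : (stepDisc p b r s lo x (firstPair (side b x) D).1 : ℝ≥0∞) ≤ 1 := by
          rw [hdisc, ← ENNReal.ofReal_one]
          refine ENNReal.ofReal_le_ofReal ?_
          rw [Real.exp_le_one_iff]
          have := mul_nonneg hs.le (stepTime_nonneg (p := p) ht hx'
            (hD.pos (.inl (side b x, 0, 0))).le)
          simpa [firstPair] using this
        refine (mul_le_one' h2 h1).trans ?_
        rw [← ENNReal.ofReal_one]
        refine ENNReal.ofReal_le_ofReal ?_
        calc (1 : ℝ) = C * C⁻¹ := (mul_inv_cancel₀ hC0.ne').symm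
          _ ≤ _ := mul_le_mul_of_nonneg_left (le_max_left _ _) hC0.le
      · refine (hmiss _ hh).trans (ENNReal.ofReal_le_ofReal ?_)
        exact mul_le_mul_of_nonneg_left (le_max_right _ _) hC0.le
    · rw [integral_const_mul, e2, mul_comm, ENNReal.ofReal_mul (integral_nonneg hmax0)]
      simp only [hW, if_neg hx', if_neg hb]
      gcongr
      exact le_max_right _ _

/-- The expectation of the discounted payoff at the first passage is the bounded solution of the
one-step equation. -/
theorem integral_hitVal (hs : 0 < s) (ht : IsTarget b r lo tgt) {g : ℝ → ℂ} (hg : ∀ x, ‖g x‖ ≤ 1)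
    {G : ℝ → ℂ} {B : ℝ} (hG : Measurable G) (hB : ∀ x, ‖G x‖ ≤ B) (hGt : ∀ x ∈ tgt, G x = g x)
    (hstep : ∀ x ∉ tgt, G x = ∫ q, (Real.exp (-(s * stepTime p b r lo x q.1)) : ℂ) *
      G (stepPos p b r lo x q) ∂(pairLaw (p (side b x)))) (δ x : ℝ) :
    AEStronglyMeasurable (fun D => hitVal tgt g s (oscD b δ x (pths p D))) (drvLaw p) ∧
      ∫ D, hitVal tgt g s (oscD b δ x (pths p D)) ∂(drvLaw p) = G x := by
  obtain ⟨W, θ, hW, hθ, hWA, hWfin, hWstep⟩ := exists_weight (p := p) hs ht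
  have hN : Measurable (Function.uncurry fun x D =>
      stepPos p b r lo x (firstPair (side b x) D)) :=
    measurable_stepPos.comp (measurable_fst.prodMk measurable_firstPair_side)
  have hβ : Measurable (Function.uncurry fun x D =>
      stepDisc p b r s lo x (firstPair (side b x) D).1) :=
    measurable_stepDisc.comp (measurable_fst.prodMk
      (measurable_fst.comp measurable_firstPair_side))
  refine integral_eq_of_step (A := tgtᶜ) (good := {D | IsGood D}) ht.meas.compl hβ hN
    measurable_stepDrv (fun x _ => step_preserving x) ae_isGood (fun x _ D hD => hD.stepDrv x)
    (fun x hx D hD => ?_) (Φ := fun x D => hitVal tgt g s (oscD b δ x (pths p D)))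
    (fun x D _ => norm_hitVal_le hs.le hg) (fun x hx D hD => ?_) hG hB (fun x hx => ?_)
    (fun x hx D hD => ?_) hW hθ hWA hWfin hWstep x
  · rw [← NNReal.coe_le_coe, coe_stepDisc, NNReal.coe_one, Real.exp_le_one_iff]
    have := mul_nonneg hs.le (stepTime_nonneg (p := p) ht hx
      (hD.pos (.inl (side b x, 0, 0))).le)
    simpa [firstPair] using this
  · rw [NNReal.smul_def, coe_stepDisc, Complex.real_smul]
    exact hitVal_step hD (ht.floor_le x hx) (ht.drift x hx) ht.reach
  · rw [hstep x hx, ← (firstPair_preserving (p := p) (side b x)).map_eq,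
      integral_map (measurable_firstPair _).aemeasurable]
    · simp only [NNReal.smul_def, coe_stepDisc, Complex.real_smul]
    · have h1 : Measurable fun q : ℝ × ℝ => stepTime p b r lo x q.1 :=
        measurable_stepTime.comp (measurable_const.prodMk measurable_fst)
      have h2 : Measurable fun q : ℝ × ℝ => stepPos p b r lo x q :=
        measurable_stepPos.comp (measurable_const.prodMk measurable_id)
      exact ((Complex.measurable_ofReal.comp (Real.measurable_exp.comp
        (h1.const_mul s).neg)).mul (hG.comp h2)).aestronglyMeasurable
  · have hx' : x ∈ tgt := not_not.1 hx
    rw [hitVal_zero, oscD_zero hD, hGt x hx']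
    rw [oscD_zero hD]
    exact hx'

end walk

/-! ### The one-step equation -/

/-- The one-step equation over the exponential time and the jump, with a floor at distance
`L`. -/
lemma integral_pairLaw_step {p : CompoundPoisson} {s : ℝ} (hs : 0 ≤ s) {f : ℝ → ℂ}
    (hf : Measurable f) {y L B : ℝ} (hL : 0 ≤ L) (hB : ∀ v ≤ y + L, ‖f v‖ ≤ B) :
    ∫ q, (if L < p.a * q.1 then (Real.exp (-(s * (L / p.a))) : ℂ) * f (y + L)
      else (Real.exp (-(s * q.1)) : ℂ) * f (y + p.a * q.1 - q.2)) ∂(pairLaw p) =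
    Real.exp (-((p.lam + s) / p.a * L)) * f (y + L) + p.lam / p.a *
      ∫ v in y..(y + L), Real.exp (-((p.lam + s) / p.a * (v - y))) * ∫ x, f (v - x) ∂p.jump := by
  have ha := p.a_pos
  have hl := p.lam_pos
  have hprob := isProbabilityMeasure_expMeasure hl
  have hB0 : 0 ≤ B := (norm_nonneg _).trans (hB _ le_rfl)
  set T := L / p.a with hT
  have hT0 : 0 ≤ T := div_nonneg hL ha.le
  have hTL : p.a * T = L := by rw [hT]; field_simp
  have hiff : ∀ t, L < p.a * t ↔ T < t := fun t => by rw [hT, div_lt_iff₀ ha, mul_comm]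
  have hm : Measurable fun q : ℝ × ℝ => (if L < p.a * q.1 then
      (Real.exp (-(s * T)) : ℂ) * f (y + L)
      else (Real.exp (-(s * q.1)) : ℂ) * f (y + p.a * q.1 - q.2)) :=
    Measurable.ite (measurableSet_lt measurable_const (by fun_prop)) measurable_const
      (by fun_prop)
  have hi : Integrable (fun q : ℝ × ℝ => (if L < p.a * q.1 then
      (Real.exp (-(s * T)) : ℂ) * f (y + L)
      else (Real.exp (-(s * q.1)) : ℂ) * f (y + p.a * q.1 - q.2)))
      ((expMeasure p.lam).prod p.jump) := by
    refine Integrable.of_bound (C := B) hm.aestronglyMeasurable ?_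
    have h1 : ∀ᵐ q ∂((expMeasure p.lam).prod p.jump), 0 < q.1 :=
      Measure.quasiMeasurePreserving_fst.ae ae_expMeasure_pos
    have h2 : ∀ᵐ q ∂((expMeasure p.lam).prod p.jump), 0 < q.2 :=
      Measure.quasiMeasurePreserving_snd.ae p.ae_jump_pos
    have hE : ∀ t, 0 ≤ t → ‖(Real.exp (-(s * t)) : ℂ)‖ ≤ 1 := by
      intro t ht
      rw [Complex.norm_real, Real.norm_of_nonneg (Real.exp_pos _).le, Real.exp_le_one_iff]
      have := mul_nonneg hs ht
      linarith
    filter_upwards [h1, h2] with q hq1 hq2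
    split_ifs with h
    · rw [norm_mul]
      exact (mul_le_of_le_one_left (norm_nonneg _) (hE T hT0)).trans (hB _ le_rfl)
    · rw [norm_mul]
      exact (mul_le_of_le_one_left (norm_nonneg _) (hE _ hq1.le)).trans (hB _ (by linarith))
  rw [pairLaw, integral_prod _ hi, integral_expMeasure hl]
  have hin : ∀ t, ∫ x, (if L < p.a * t then (Real.exp (-(s * T)) : ℂ) * f (y + L)
      else (Real.exp (-(s * t)) : ℂ) * f (y + p.a * t - x)) ∂p.jump =
      if T < t then (Real.exp (-(s * T)) : ℂ) * f (y + L) else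
        (Real.exp (-(s * t)) : ℂ) * ∫ x, f (y + p.a * t - x) ∂p.jump := by
    intro t
    simp only [hiff]
    split_ifs
    · simp
    · rw [integral_const_mul]
  simp only [hin]
  set φ : ℝ → ℂ := fun t => ((p.lam * Real.exp (-(p.lam * t)) : ℝ) : ℂ) *
    (if T < t then (Real.exp (-(s * T)) : ℂ) * f (y + L) else
        (Real.exp (-(s * t)) : ℂ) * ∫ x, f (y + p.a * t - x) ∂p.jump) with hφ
  have hφm : Measurable φ := by
    have h1 : Measurable fun t => ∫ x, f (y + p.a * t - x) ∂p.jump :=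
      (StronglyMeasurable.integral_prod_right (f := fun t x => f (y + p.a * t - x))
        (hf.comp (by fun_prop)).stronglyMeasurable).measurable
    exact Measurable.mul (by fun_prop) (Measurable.ite measurableSet_Ioi measurable_const
      (Measurable.mul (by fun_prop) h1))
  have hIoi : ∀ t ∈ Ioi T, φ t = ((p.lam * Real.exp (-(p.lam * t)) : ℝ) : ℂ) *
      ((Real.exp (-(s * T)) : ℂ) * f (y + L)) := by
    intro t ht
    simp only [hφ, if_pos (mem_Ioi.1 ht)]
  have hexpi : IntegrableOn (fun t => Real.exp (-p.lam * t)) (Ioi T) :=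
    integrableOn_exp_mul_Ioi (by linarith) T
  have hi2 : IntegrableOn φ (Ioi T) := by
    refine IntegrableOn.congr_fun (f := fun t => ((p.lam * Real.exp (-(p.lam * t)) : ℝ) : ℂ) *
      ((Real.exp (-(s * T)) : ℂ) * f (y + L))) ?_ (fun t ht => (hIoi t ht).symm) measurableSet_Ioi
    refine Integrable.mul_const (Integrable.ofReal (Integrable.const_mul ?_ _)) _
    simpa [IntegrableOn] using hexpi
  have hi1 : IntegrableOn φ (Ioc 0 T) := by
    refine Measure.integrableOn_of_bounded (M := p.lam * B) (by simp)
      hφm.aestronglyMeasurable ?_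
    filter_upwards [ae_restrict_mem measurableSet_Ioc] with t ht
    simp only [hφ, if_neg (not_lt.2 ht.2)]
    have hE : ∀ c, 0 ≤ c → Real.exp (-(c * t)) ≤ 1 := by
      intro c hc
      rw [Real.exp_le_one_iff]
      have := mul_nonneg hc ht.1.le
      linarith
    have h3 : ‖∫ x, f (y + p.a * t - x) ∂p.jump‖ ≤ B := by
      have := norm_integral_le_of_norm_le (μ := p.jump) (f := fun x => f (y + p.a * t - x))
        (integrable_const B) (by
          filter_upwards [p.ae_jump_pos] with x hx
          refine hB _ ?_
          have := mul_le_mul_of_nonneg_left ht.2 ha.le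
          linarith)
      simpa using this
    rw [norm_mul, norm_mul, Complex.norm_real, Complex.norm_real,
      Real.norm_of_nonneg (by positivity), Real.norm_of_nonneg (Real.exp_pos _).le]
    have h4 := hE p.lam hl.le
    have h5 := hE s hs
    calc p.lam * Real.exp (-(p.lam * t)) * (Real.exp (-(s * t)) * ‖∫ x, f (y + p.a * t - x) ∂p.jump‖)
        ≤ p.lam * 1 * (1 * B) := by gcongr
      _ = p.lam * B := by ring
  -- Split at the time `T = L/a` when the drift covers the distance `L`: later arrivals give the
  -- boundary term, earlier ones the jump term.
  rw [← Ioc_union_Ioi_eq_Ioi hT0, setIntegral_union Ioc_disjoint_Ioi_same measurableSet_Ioi hi1 hi2,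
    add_comm, setIntegral_congr_fun measurableSet_Ioi hIoi, integral_mul_const]
  congr 1
  · have h1 : ∫ t in Ioi T, ((p.lam * Real.exp (-(p.lam * t)) : ℝ) : ℂ) =
        (Real.exp (-(p.lam * T)) : ℂ) := by
      rw [integral_complex_ofReal, integral_const_mul]
      have := integral_exp_mul_Ioi (a := -p.lam) (by linarith) T
      simp only [neg_mul] at this
      rw [this]
      norm_cast
      field_simp
    rw [h1, ← mul_assoc, ← Complex.ofReal_mul, ← Real.exp_add]
    congr 3
    rw [hT]
    field_simp
    ring
  · rw [← intervalIntegral.integral_of_le hT0]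
    -- The substitution `v = a t + y` replaces time by position.
    have h1 := intervalIntegral.integral_comp_mul_add (a := (0 : ℝ)) (b := T)
      (fun v => (Real.exp (-((p.lam + s) / p.a * (v - y))) : ℂ) * ∫ x, f (v - x) ∂p.jump) ha.ne' y
    rw [mul_zero, zero_add, hTL, add_comm L] at h1
    have h2 : ∫ t in (0 : ℝ)..T, φ t = p.lam * ∫ t in (0 : ℝ)..T,
        (Real.exp (-((p.lam + s) / p.a * (p.a * t + y - y))) : ℂ) *
          ∫ x, f (p.a * t + y - x) ∂p.jump := by
      rw [← intervalIntegral.integral_const_mul]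
      refine intervalIntegral.integral_congr fun t ht => ?_
      rw [uIcc_of_le hT0] at ht
      simp only [hφ, if_neg (not_lt.2 ht.2)]
      rw [← mul_assoc, ← mul_assoc, add_comm y]
      congr 1
      rw [← Complex.ofReal_mul, ← Complex.ofReal_mul, mul_assoc, ← Real.exp_add]
      congr 3
      field_simp
      ring
    rw [h2, h1, Complex.real_smul, ← mul_assoc]
    congr 1
    push_cast
    rfl

end Oscillating
end

noncomputable section
namespace Oscillating
open CompoundPoisson

/-! ### Solutions of the first-step equations as one-step expectations. -/

section solves
variable {p : Fin 2 → CompoundPoisson} {s d : ℝ} {f : ℝ → ℂ}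

lemma Solves.step_low_floor (hs : 0 ≤ s) (hf : Solves p s d f) {y L B : ℝ} (hy : 0 ≤ y)
    (hL : 0 ≤ L) (hB : ∀ v ≤ y + L, ‖f v‖ ≤ B) :
    f y = ∫ q, (if L < (p 0).a * q.1 then (Real.exp (-(s * (L / (p 0).a))) : ℂ) * f (y + L)
      else (Real.exp (-(s * q.1)) : ℂ) * f (y + (p 0).a * q.1 - q.2)) ∂(pairLaw (p 0)) := by
  rw [integral_pairLaw_step hs hf.meas hL hB, hf.lower y (y + L) hy (by linarith),
    add_sub_cancel_left]

lemma Solves.step_upp (hs : 0 ≤ s) (hf : Solves p s d f) {y B : ℝ} (hy : y ≤ 0) (hyd : -d ≤ y)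
    (hB : ∀ v ≤ 0, ‖f v‖ ≤ B) :
    f y = ∫ q, (if -y < (p 1).a * q.1 then (Real.exp (-(s * (-y / (p 1).a))) : ℂ) * f 0
      else (Real.exp (-(s * q.1)) : ℂ) * f (y + (p 1).a * q.1 - q.2)) ∂(pairLaw (p 1)) := by
  have h := integral_pairLaw_step (p := p 1) hs hf.meas (y := y) (L := -y) (B := B)
    (by linarith) (by simpa using hB)
  rw [add_neg_cancel] at h
  rw [h, hf.upper y hyd hy, zero_sub]

/-- Without a floor the drift is followed to a distance `L → ∞`; boundedness of `f` allows dominated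
convergence, and the boundary term disappears. -/
lemma Solves.step_low (hs : 0 < s) (hf : Solves p s d f) {y B : ℝ} (hy : 0 ≤ y)
    (hB : ∀ v, ‖f v‖ ≤ B) :
    f y = ∫ q, (Real.exp (-(s * q.1)) : ℂ) * f (y + (p 0).a * q.1 - q.2) ∂(pairLaw (p 0)) := by
  have ha := (p 0).a_pos
  have hB0 : 0 ≤ B := (norm_nonneg _).trans (hB 0)
  have hfm := hf.meas
  have hE : ∀ t, 0 ≤ t → ‖(Real.exp (-(s * t)) : ℂ)‖ ≤ 1 := by
    intro t ht
    rw [Complex.norm_real, Real.norm_of_nonneg (Real.exp_pos _).le, Real.exp_le_one_iff]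
    have := mul_nonneg hs.le ht
    linarith
  have hpos : ∀ᵐ q ∂(pairLaw (p 0)), 0 < q.1 := by
    have := isProbabilityMeasure_expMeasure (p 0).lam_pos
    exact Measure.quasiMeasurePreserving_fst.ae ae_expMeasure_pos
  have hlim : Tendsto (fun L : ℝ => ∫ q, (if L < (p 0).a * q.1 then
      (Real.exp (-(s * (L / (p 0).a))) : ℂ) * f (y + L)
      else (Real.exp (-(s * q.1)) : ℂ) * f (y + (p 0).a * q.1 - q.2)) ∂(pairLaw (p 0))) atTop
      (𝓝 (∫ q, (Real.exp (-(s * q.1)) : ℂ) * f (y + (p 0).a * q.1 - q.2) ∂(pairLaw (p 0)))) := by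
    refine tendsto_integral_filter_of_dominated_convergence (fun _ => B)
      (Eventually.of_forall fun L => ?_) ?_ (integrable_const _) (Eventually.of_forall fun q => ?_)
    · exact (Measurable.ite (measurableSet_lt measurable_const (by fun_prop)) measurable_const
        (by fun_prop)).aestronglyMeasurable
    · filter_upwards [eventually_ge_atTop 0] with L hL
      filter_upwards [hpos] with q hq
      split_ifs
      · rw [norm_mul]
        exact (mul_le_of_le_one_left (norm_nonneg _) (hE _ (div_nonneg hL ha.le))).trans (hB _)
      · rw [norm_mul]
        exact (mul_le_of_le_one_left (norm_nonneg _) (hE _ hq.le)).trans (hB _)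
    · refine tendsto_const_nhds.congr' ?_
      filter_upwards [eventually_ge_atTop ((p 0).a * q.1)] with L hL
      rw [if_neg (not_lt.2 hL)]
  refine tendsto_nhds_unique (tendsto_const_nhds.congr' ?_) hlim
  filter_upwards [eventually_ge_atTop 0] with L hL
  exact hf.step_low_floor hs.le hy hL fun v _ => hB v

end solves

/-! ### First passages of the oscillating path. -/

variable {p : Fin 2 → CompoundPoisson} {b s : ℝ}

/-- The payoff of the first passage above `k`. -/
def upPay (k : ℝ) (z : ℂ) (v : ℝ) : ℂ := if k < v then Complex.exp (-(z * (v - k))) else 0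

lemma norm_upPay_le {k : ℝ} {z : ℂ} (hz : 0 ≤ z.re) (v : ℝ) : ‖upPay k z v‖ ≤ 1 := by
  rw [upPay]
  split_ifs with h
  · rw [Complex.norm_exp, Real.exp_le_one_iff]
    simp
    exact mul_nonneg hz (by linarith)
  · simp

lemma isTarget_Ioi {k r : ℝ} : IsTarget b r false (Ioi k) where
  meas := measurableSet_Ioi
  floor_le x hx hb h := absurd h (by simp)
  drift x hx v hv _ _ := by
    simp only [mem_Ioi, not_lt] at hx ⊢
    exact hv.trans hx
  reach h := absurd h (by simp)

lemma isTarget_Iic {r : ℝ} (hr : r ≤ b) : IsTarget b r true (Iic r) where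
  meas := measurableSet_Iic
  floor_le x hx hb h := (not_le.1 hx).le
  drift x hx v hv h1 h2 := by
    rw [mem_Iic, not_le]
    by_cases h : x ≤ b
    · exact h2 h rfl
    · exact hr.trans_lt (h1 h)
  reach h := self_mem_Iic

/-- First passage above `k`, for `s > 0`. -/
lemma up_of_pos (hs : 0 < s) {k : ℝ} (hk : b ≤ k) {z : ℂ} (hz : 0 ≤ z.re) (δ x : ℝ) :
    AEStronglyMeasurable (fun D => hitVal (Ioi k) (upPay k z) s (oscD b δ x (pths p D)))
      (drvLaw p) ∧
    ∫ D, hitVal (Ioi k) (upPay k z) s (oscD b δ x (pths p D)) ∂(drvLaw p) =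
      upSol p s (k - b) z (b - x) := by
  obtain ⟨hf, ⟨B, hB⟩, hneg⟩ := upSol_spec (p := p) hs (sub_nonneg.2 hk) hz
  set f := upSol p s (k - b) z
  -- There is no floor below `b` in this problem, so the value of `r` is arbitrary.
  refine integral_hitVal (r := 0) hs isTarget_Ioi (norm_upPay_le hz) (G := fun x => f (b - x))
    (hf.meas.comp (measurable_const.sub measurable_id)) (fun x => hB _) (fun x hx => ?_)
    (fun x hx => ?_) δ x
  · rw [mem_Ioi] at hx
    rw [hneg _ (by linarith), upPay, if_pos hx]
    congr 1
    push_cast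
    ring
  · rw [mem_Ioi, not_lt] at hx
    by_cases hb : x ≤ b
    · have e2 : side b x = 0 := by simp [side, hb]
      have hh : ∀ e, ¬ Hits p b 0 false x e := fun e h => by simpa using h.1 hb
      rw [e2]
      simp only [stepTime, stepPos, hh, if_false, e2]
      rw [hf.step_low hs (sub_nonneg.2 hb) hB]
      congr 1
      ext q
      congr 2
      ring
    · have e2 : side b x = 1 := by simp [side, hb]
      have e3 : floor b 0 x = b := by simp [floor, hb]
      have hh : ∀ e, Hits p b 0 false x e ↔ x - b < (p 1).a * e := fun e => by
        simp [Hits, hb, e2, e3]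
      rw [e2]
      simp only [stepTime, stepPos, hh, e2, e3]
      rw [hf.step_upp hs.le (by linarith) (by linarith) fun v _ => hB v]
      congr 1
      ext q
      rw [neg_sub]
      split_ifs
      · rw [sub_self]
      · congr 2
        ring

/-- First passage to `r`, for `s > 0`. -/
lemma down_of_pos (hs : 0 < s) {r : ℝ} (hr : r ≤ b) (δ : ℝ) {x : ℝ} (hx : r ≤ x) :
    AEStronglyMeasurable (fun D => hitVal (Iic r) (fun _ => 1) s (oscD b δ x (pths p D)))
      (drvLaw p) ∧
    ∫ D, hitVal (Iic r) (fun _ => 1) s (oscD b δ x (pths p D)) ∂(drvLaw p) =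
      C (p 0) (b - x) ((p 1).c s) s / C (p 0) (b - r) ((p 1).c s) s := by
  set f : ℝ → ℂ := fun y => C (p 0) y ((p 1).c s) s with hfdef
  have hf : ∀ d, Solves p s d f := fun d => down_solves hs.le d
  have hne : f (b - r) ≠ 0 := down_pos hs.le (sub_nonneg.2 hr)
  have hharm := C_sub_isHarmonic (p := p 0) hs.le (z := (p 1).c s)
    (by simpa using (p 1).c_nonneg hs.le) 0
  simp only [zero_mul, sub_zero] at hharm
  obtain ⟨B, hB⟩ := hharm.bdd hs.le (b - r)
  -- The value is frozen at `1` below `r`. Only arguments `y ≤ b - r` of the harmonic function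
  -- enter, where it is bounded; no control at infinity is needed.
  set G : ℝ → ℂ := fun x => if x ≤ r then 1 else f (b - x) / f (b - r) with hG
  have hGr : ∀ x, r ≤ x → G x = f (b - x) / f (b - r) := by
    intro x hx
    simp only [hG]
    split_ifs with h
    · rw [le_antisymm h hx, div_self hne]
    · rfl
  have key := integral_hitVal (p := p) (r := r) hs (isTarget_Iic hr) (g := fun _ => 1)
    (fun _ => by simp) (G := G) (B := max 1 (B / ‖f (b - r)‖)) ?_ ?_ ?_ ?_ δ x
  · rw [hGr x hx] at key
    exact key
  · exact Measurable.ite measurableSet_Iic measurable_const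
      (((hf 0).meas.comp (measurable_const.sub measurable_id)).div_const _)
  · intro x
    simp only [hG]
    split_ifs with h
    · simp
    · rw [norm_div]
      refine le_trans ?_ (le_max_right _ _)
      gcongr
      exact hB _ (by linarith)
  · intro x hx
    simp only [hG, if_pos (mem_Iic.1 hx)]
  · intro x hx
    rw [mem_Iic, not_le] at hx
    have hYpos : ∀ i, ∀ᵐ q ∂(pairLaw (p i)), 0 < q.2 := fun i => by
      have := isProbabilityMeasure_expMeasure (p i).lam_pos
      exact Measure.quasiMeasurePreserving_snd.ae (p i).ae_jump_pos
    rw [hGr x hx.le]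
    by_cases hb : x ≤ b
    · have e2 : side b x = 0 := by simp [side, hb]
      have e3 : floor b r x = r := by simp [floor, hb]
      have hh : ∀ e, Hits p b r true x e ↔ x - r < (p 0).a * e := fun e => by
        simp [Hits, e2, e3]
      rw [e2]
      simp only [stepTime, stepPos, hh, e2, e3]
      rw [(hf 0).step_low_floor hs.le (y := b - x) (L := x - r) (B := B) (by linarith)
        (by linarith) (fun v hv => hB v (by linarith)), ← integral_div]
      refine integral_congr_ae ?_
      filter_upwards [hYpos 0] with q hq
      split_ifs with h
      · rw [hGr r le_rfl, mul_div_assoc]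
        congr 3
        ring
      · rw [hGr _ (by linarith), mul_div_assoc]
        congr 3
        ring
    · have e2 : side b x = 1 := by simp [side, hb]
      have e3 : floor b r x = b := by simp [floor, hb]
      have hh : ∀ e, Hits p b r true x e ↔ x - b < (p 1).a * e := fun e => by
        simp [Hits, e2, e3]
      rw [e2]
      simp only [stepTime, stepPos, hh, e2, e3]
      rw [(hf (x - b)).step_upp hs.le (y := b - x) (B := B) (by linarith)
        (by linarith) (fun v hv => hB v (by linarith)), ← integral_div]
      refine integral_congr_ae ?_
      filter_upwards [hYpos 1] with q hq
      rw [neg_sub]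
      split_ifs with h
      · rw [hGr b hr, mul_div_assoc, sub_self]
      · rw [hGr _ (by linarith), mul_div_assoc]
        congr 3
        ring

/-- The target of the first passage above `k` is attained. -/
lemma up_attained (k δ x : ℝ) : ∀ᵐ D ∂(drvLaw p),
    firstTime {t | oscD b δ x (pths p D) t ∈ Ioi k} < ∞ →
      k < oscD b δ x (pths p D) (firstTime {t | oscD b δ x (pths p D) t ∈ Ioi k}).toNNReal := by
  classical
  -- This payoff charges exactly the event that the path is not above `k` at the hitting time. On
  -- the target it is `0`, so the zero function solves the one-step equation and the event has
  -- probability zero. Regularity of the glued path is not needed.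
  set g : ℝ → ℂ := fun v => if k < v then 0 else 1 with hg
  have hgle : ∀ v, ‖g v‖ ≤ 1 := fun v => by simp only [hg]; split_ifs <;> simp
  obtain ⟨hm, hi⟩ := integral_hitVal (p := p) (b := b) (r := 0) (s := 1) one_pos
    (isTarget_Ioi (k := k)) hgle (G := fun _ => 0) (B := 0) measurable_const (by simp)
    (fun x hx => by simp only [hg, if_pos (mem_Ioi.1 hx)]) (by simp) δ x
  have hre : ∫ D, (hitVal (Ioi k) g 1 (oscD b δ x (pths p D))).re ∂(drvLaw p) = 0 := by
    have := integral_re (𝕜 := ℂ) (Integrable.of_bound (C := 1) hm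
      (Eventually.of_forall fun D => norm_hitVal_le zero_le_one hgle))
    rw [hi] at this
    simpa using this
  have hval : ∀ X : ℝ≥0 → ℝ, (hitVal (Ioi k) g 1 X).re =
      if firstTime {t | X t ∈ Ioi k} < ∞ ∧ X (firstTime {t | X t ∈ Ioi k}).toNNReal ≤ k then
        Real.exp (-(firstTime {t | X t ∈ Ioi k}).toReal) else 0 := by
    intro X
    rw [hitVal]
    by_cases h1 : firstTime {t | X t ∈ Ioi k} < ∞
    · by_cases h2 : X (firstTime {t | X t ∈ Ioi k}).toNNReal ≤ k
      · rw [if_pos h1, if_pos ⟨h1, h2⟩]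
        simp only [hg, if_neg (not_lt.2 h2)]
        rw [mul_one, Complex.ofReal_one, one_mul, ← Complex.ofReal_neg, ← Complex.ofReal_exp,
          Complex.ofReal_re]
      · rw [if_pos h1, if_neg fun h => h2 h.2]
        simp only [hg, if_pos (not_le.1 h2)]
        simp
    · rw [if_neg h1, if_neg fun h => h1 h.1]
      simp
  rw [integral_eq_zero_iff_of_nonneg] at hre
  · filter_upwards [hre] with D hD hfin
    by_contra! h
    rw [hval, if_pos ⟨hfin, h⟩] at hD
    exact absurd hD (Real.exp_pos _).ne'
  · intro D
    simp only [Pi.zero_apply]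
    rw [hval]
    split_ifs
    · exact (Real.exp_pos _).le
    · exact le_rfl
  · refine Integrable.of_bound (C := 1) hm.re ?_
    refine Eventually.of_forall fun D => ?_
    exact (Complex.abs_re_le_norm _).trans (norm_hitVal_le zero_le_one hgle)

/-- Passage to the limit `s → 0` in the expectation of the discounted payoff. -/
lemma integral_hitVal_zero {tgt : Set ℝ} {g : ℝ → ℂ} (hg : ∀ x, ‖g x‖ ≤ 1) {δ x : ℝ} {Γ : ℝ → ℂ}
    (hpos : ∀ s, 0 < s →
      AEStronglyMeasurable (fun D => hitVal tgt g s (oscD b δ x (pths p D))) (drvLaw p) ∧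
      ∫ D, hitVal tgt g s (oscD b δ x (pths p D)) ∂(drvLaw p) = Γ s)
    (hΓ : Tendsto Γ (𝓝[>] 0) (𝓝 (Γ 0))) :
    ∀ s, 0 ≤ s →
      AEStronglyMeasurable (fun D => hitVal tgt g s (oscD b δ x (pths p D))) (drvLaw p) ∧
      ∫ D, hitVal tgt g s (oscD b δ x (pths p D)) ∂(drvLaw p) = Γ s := by
  intro s hs
  rcases hs.eq_or_lt with rfl | hs
  swap
  · exact hpos s hs
  have hu : Tendsto (fun n : ℕ => 1 / ((n : ℝ) + 1)) atTop (𝓝[>] 0) :=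
    tendsto_nhdsWithin_iff.2 ⟨tendsto_one_div_add_atTop_nhds_zero_nat,
      Eventually.of_forall fun n => by simp only [mem_Ioi]; positivity⟩
  have hup : ∀ n : ℕ, 0 < 1 / ((n : ℝ) + 1) := fun n => by positivity
  have hlim : ∀ X : ℝ≥0 → ℝ, Tendsto (fun s => hitVal tgt g s X) (𝓝[>] 0)
      (𝓝 (hitVal tgt g 0 X)) := by
    intro X
    simp only [hitVal]
    split_ifs
    · refine Tendsto.mul_const _ (Tendsto.mono_left ?_ nhdsWithin_le_nhds)
      exact Continuous.tendsto (by fun_prop) 0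
    · exact tendsto_const_nhds
  have hae : ∀ᵐ D ∂(drvLaw p), Tendsto (fun n : ℕ => hitVal tgt g (1 / ((n : ℝ) + 1))
      (oscD b δ x (pths p D))) atTop (𝓝 (hitVal tgt g 0 (oscD b δ x (pths p D)))) :=
    Eventually.of_forall fun D => (hlim _).comp hu
  refine ⟨aestronglyMeasurable_of_tendsto_ae atTop (fun n => (hpos _ (hup n)).1) hae, ?_⟩
  have h1 := tendsto_integral_of_dominated_convergence (fun _ => 1)
    (fun n => (hpos _ (hup n)).1) (integrable_const 1)
    (fun n => Eventually.of_forall fun D => norm_hitVal_le (hup n).le hg) hae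
  simp only [(hpos _ (hup _)).2] at h1
  exact tendsto_nhds_unique h1 (hΓ.comp hu)

end Oscillating
end

/-! ### Transfer to a given driver and the closed formulas. -/

noncomputable section
namespace Oscillating
open CompoundPoisson

/-- The driver as a random sequence. -/
def drv {Ω : Type*} (e y : Fin 2 × ℕ × ℕ → Ω → ℝ) (ω : Ω) : Idx → ℝ := fun k => Sum.elim e y k ω

lemma xi_eq {Ω : Type*} {p : Fin 2 → CompoundPoisson} {b : ℝ} {e y : Fin 2 × ℕ × ℕ → Ω → ℝ}
    (x : ℝ) (ω : Ω) : xi p b e y x ω = oscD b x x (pths p (drv e y ω)) :=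
  oscPath_eq

section transfer
variable {Ω : Type*} [MeasurableSpace Ω] {μ : Measure Ω}
  {p : Fin 2 → CompoundPoisson} {b s : ℝ} {e y : Fin 2 × ℕ × ℕ → Ω → ℝ}

/-- Joint independence and the marginal laws determine the product law, so the expectations can be
computed on the canonical sequence space. -/
lemma IsDriver.hasLaw_drv (h : IsDriver μ p e y) : HasLaw (drv e y) (drvLaw p) μ := by
  have hX : ∀ k, HasLaw (Sum.elim e y k) (idxLaw p k) μ := by
    rintro (⟨i, n, j⟩ | ⟨i, n, j⟩)
    · exact h.law_e i n j
    · exact h.law_y i n j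
  exact h.indep.hasLaw_infinitePi hX (aemeasurable_pi_lambda _ fun k => (hX k).aemeasurable)

lemma IsDriver.integral_drv (h : IsDriver μ p e y) {f : (Idx → ℝ) → ℂ}
    (hf : AEStronglyMeasurable f (drvLaw p)) :
    ∫ ω, f (drv e y ω) ∂μ = ∫ D, f D ∂(drvLaw p) := by
  have hl := h.hasLaw_drv
  rw [← hl.map_eq, integral_map hl.aemeasurable]
  rwa [hl.map_eq]

lemma jointTransform_eq (h : IsDriver μ p e y) (hs : 0 ≤ s) {x k : ℝ} (hk : b ≤ k) {z : ℂ}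
    (hz : 0 ≤ z.re) : jointTransform μ (fun ω => upTime (xi p b e y x ω) k)
      (fun ω => overshoot (xi p b e y x ω) k) z s = upSol p s (k - b) z (b - x) := by
  obtain ⟨hm, hi⟩ := integral_hitVal_zero (p := p) (b := b) (δ := x) (x := x)
    (norm_upPay_le (k := k) hz) (fun s hs => up_of_pos hs hk hz x x)
    (tendsto_upSol (sub_nonneg.2 hk) hz (b - x)) s hs
  rw [← hi, ← h.integral_drv hm, jointTransform]
  -- The payoff `upPay` vanishes at levels up to `k`, whereas the overshoot transform does not; the
  -- two integrands agree because the target is attained almost surely.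
  have hae : ∀ᵐ ω ∂μ, firstTime {t | oscD b x x (pths p (drv e y ω)) t ∈ Ioi k} < ∞ →
      k < oscD b x x (pths p (drv e y ω))
        (firstTime {t | oscD b x x (pths p (drv e y ω)) t ∈ Ioi k}).toNNReal := by
    have hl := h.hasLaw_drv
    refine ae_of_ae_map hl.aemeasurable (p := fun D =>
      firstTime {t | oscD b x x (pths p D) t ∈ Ioi k} < ∞ → k < oscD b x x (pths p D)
        (firstTime {t | oscD b x x (pths p D) t ∈ Ioi k}).toNNReal) ?_
    rw [hl.map_eq]
    exact up_attained k x x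
  refine integral_congr_ae ?_
  filter_upwards [hae] with ω hω
  rw [indicator, hitVal]
  simp only [xi_eq, mem_ofPred_eq]
  change (if firstTime {t | oscD b x x (pths p (drv e y ω)) t ∈ Ioi k} < ∞ then
    Complex.exp (-(s * (firstTime {t | oscD b x x (pths p (drv e y ω)) t ∈ Ioi k}).toReal) - z *
      ((oscD b x x (pths p (drv e y ω))
        (firstTime {t | oscD b x x (pths p (drv e y ω)) t ∈ Ioi k}).toNNReal - k : ℝ) : ℂ))
    else 0) = _
  split_ifs with hT
  · rw [upPay, if_pos (hω hT), ← Complex.exp_add]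
    congr 1
    push_cast
    ring
  · rfl

/-- At `z = 0` the overshoot drops out, so the passage time formula is a special case of the joint
one. -/
lemma timeTransform_up (μ : Measure Ω) (τ : Ω → ℝ≥0∞) (T : Ω → ℝ) (s : ℝ) :
    (timeTransform μ τ s : ℂ) = jointTransform μ τ T 0 s := by
  rw [timeTransform, jointTransform, ← integral_complex_ofReal]
  congr 1
  ext ω
  rw [indicator, indicator]
  split_ifs
  · push_cast
    simp
  · simp

lemma timeTransform_down (h : IsDriver μ p e y) (hs : 0 ≤ s) {x r : ℝ} (hr : r ≤ b) (hx : r ≤ x) :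
    (timeTransform μ (fun ω => downTime (xi p b e y x ω) r) s : ℂ) =
      C (p 0) (b - x) ((p 1).c s) s / C (p 0) (b - r) ((p 1).c s) s := by
  obtain ⟨hm, hi⟩ := integral_hitVal_zero (p := p) (b := b) (δ := x) (x := x)
    (tgt := Iic r) (g := fun _ => 1) (by simp) (fun s hs => down_of_pos hs hr x hx)
    ((tendsto_down (b - x)).div (tendsto_down (b - r)) (down_pos le_rfl (sub_nonneg.2 hr))) s hs
  rw [← hi, ← h.integral_drv hm, timeTransform, ← integral_complex_ofReal]
  congr 1
  ext ω
  rw [indicator, hitVal]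
  simp only [xi_eq, mem_ofPred_eq, mul_one]
  change (((if firstTime {t | oscD b x x (pths p (drv e y ω)) t ∈ Iic r} < ∞ then
    Real.exp (-(s * (firstTime {t | oscD b x x (pths p (drv e y ω)) t ∈ Iic r}).toReal))
    else 0 : ℝ) : ℂ)) = _
  split_ifs <;> simp

end transfer

variable {p : Fin 2 → CompoundPoisson} {s : ℝ}

lemma C_at_zero {p : CompoundPoisson} (hs : 0 ≤ s) (y : ℝ) :
    C p y 0 s = ((1 + s * ∫ u in (0 : ℝ)..y, R p s u : ℝ) : ℂ) := by
  have hk : p.k 0 = 0 := by simpa [kR_zero] using p.k_ofReal (le_refl (0 : ℝ))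
  rcases lt_or_ge y 0 with hy | hy
  · have : ∫ u in (0 : ℝ)..y, R p s u = 0 := by
      rw [intervalIntegral.integral_symm, intervalIntegral.integral_zero_ae, neg_zero]
      have hne : ∀ᵐ u : ℝ, u ≠ 0 := by simp [ae_iff]
      filter_upwards [hne] with u hu0 hu
      rw [uIoc_of_le hy.le] at hu
      exact R_neg hs (lt_of_le_of_ne hu.2 hu0)
    rw [C_of_neg hy, this]
    simp
  · rw [C_of_nonneg hy, hk]
    simp only [mul_zero, neg_zero, Complex.exp_zero, zero_mul, one_mul, zero_sub, neg_mul]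
    rw [intervalIntegral.integral_ofReal]
    push_cast
    ring

/-- Since `k₂(0) = 0`, the factor `k₂ - s` becomes `-s`, and the ladder functional of the constant
function `1` is the killing rate `q`. -/
lemma upSol_at_zero (hs : 0 ≤ s) (d y : ℝ) : upSol p s d 0 y =
    ((1 + s * (∫ u in (0 : ℝ)..y, R (p 0) s u) + s * (∫ u in (0 : ℝ)..d, K p s y u)
      - K p s y d / F p s d * ((p 0).q s + s * ∫ u in (0 : ℝ)..d, F p s u) : ℝ) : ℂ) := by
  have hk : (p 1).k 0 = 0 := by simpa [kR_zero] using (p 1).k_ofReal (le_refl (0 : ℝ))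
  rw [upSol, upCoef, C_at_zero hs, hk, Hfun_eq hs, ← q_eq_lt]
  simp only [mul_zero, neg_zero, Complex.exp_zero, zero_mul, one_mul, zero_sub, neg_mul]
  rw [intervalIntegral.integral_ofReal, intervalIntegral.integral_ofReal]
  push_cast
  ring

lemma upSol_eq (d : ℝ) (z : ℂ) (y : ℝ) : upSol p s d z y =
    Complex.exp (z * d) * (C (p 0) y z s - ((p 1).k z - s) * ∫ u in (0 : ℝ)..d,
        Complex.exp (-(u * z)) * K p s y u)
      - (K p s y d / F p s d : ℝ) * Complex.exp (z * d) *
        (Hfun p s z - ((p 1).k z - s) * ∫ u in (0 : ℝ)..d, Complex.exp (-(u * z)) * F p s u) := by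
  rw [upSol, upCoef]
  push_cast
  ring

end Oscillating
end

theorem theorem1 {Ω : Type*} [MeasurableSpace Ω] (μ : Measure Ω) [IsProbabilityMeasure μ]
    (p : Fin 2 → Oscillating.CompoundPoisson) (b : ℝ) (hb : 0 < b)
    (e y : Fin 2 × ℕ × ℕ → Ω → ℝ) (hdriver : Oscillating.IsDriver μ p e y)
    (s : ℝ) (hs : 0 ≤ s) :
    -- the quantities in the formulas are well defined
    ((0 < s → ∀ i, 0 < (p i).c s ∧ ∀ z : ℂ, 0 < z.re → ((p i).k z = s ↔ z = (p i).c s)) ∧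
      (∀ i, Tendsto (p i).c (𝓝[>] 0) (𝓝 ((p i).c 0))) ∧
      (∀ i, ∃! f, Oscillating.IsResolvent (p i) s f) ∧
      (∀ x, ∃! f, Oscillating.IsK p s x f) ∧
      (∃! f, Oscillating.IsF p s f)) ∧
    -- first passage below the level `r`
    (∀ x r : ℝ, r ≤ min x b →
      Oscillating.C (p 0) (b - r) ((p 1).c s) s ≠ 0 ∧
      (Oscillating.timeTransform μ
          (fun ω => Oscillating.downTime (Oscillating.xi p b e y x ω) r) s : ℂ) =
        Oscillating.C (p 0) (b - x) ((p 1).c s) s / Oscillating.C (p 0) (b - r) ((p 1).c s) s) ∧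
    -- first passage above the level `k`; `q` is `s / c₁(s)`, read as its limit for `s = 0`
    (∃ q : ℝ, (0 < s → q = s / (p 0).c s) ∧
      (s = 0 → Tendsto (fun t => t / (p 0).c t) (𝓝[>] 0) (𝓝 q)) ∧
      ∀ x k : ℝ, max x b ≤ k →
        Oscillating.F p s (k - b) ≠ 0 ∧
        Oscillating.timeTransform μ
            (fun ω => Oscillating.upTime (Oscillating.xi p b e y x ω) k) s =
          1 + s * (∫ u in (0 : ℝ)..(b - x), Oscillating.R (p 0) s u)
            + s * (∫ u in (0 : ℝ)..(k - b), Oscillating.K p s (b - x) u)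
            - Oscillating.K p s (b - x) (k - b) / Oscillating.F p s (k - b)
              * (q + s * ∫ u in (0 : ℝ)..(k - b), Oscillating.F p s u)) ∧
    -- first passage above the level `k` and overshoot; `G` and `H` are
    -- `(k₂(z) - s) 𝕂_{b-x}^s(z)` and `(k₂(z) - s) 𝔽_s(z)`, continued to `Re z ≥ 0`
    (∀ x k : ℝ, max x b ≤ k → ∃ G H : ℂ → ℂ,
      Oscillating.IsContinuation (max ((p 0).c s) ((p 1).c s))
        (fun z => ((p 1).k z - s) * Oscillating.laplace (Oscillating.K p s (b - x)) z) G ∧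
      Oscillating.IsContinuation ((p 1).c s)
        (fun z => ((p 1).k z - s) * Oscillating.laplace (Oscillating.F p s) z) H ∧
      ∀ z : ℂ, 0 ≤ z.re →
        Oscillating.jointTransform μ
            (fun ω => Oscillating.upTime (Oscillating.xi p b e y x ω) k)
            (fun ω => Oscillating.overshoot (Oscillating.xi p b e y x ω) k) z s =
          Complex.exp (z * (k - b : ℝ)) *
              (G z - ((p 1).k z - s) * ∫ u in (0 : ℝ)..(k - b),
                Complex.exp (-(u * z)) * Oscillating.K p s (b - x) u)
            - (Oscillating.K p s (b - x) (k - b) / Oscillating.F p s (k - b) : ℝ) *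
              Complex.exp (z * (k - b : ℝ)) *
              (H z - ((p 1).k z - s) * ∫ u in (0 : ℝ)..(k - b),
                Complex.exp (-(u * z)) * Oscillating.F p s u)) := by
  refine ⟨⟨fun hs' i => ⟨(p i).c_pos hs', fun z hz => (p i).root_iff hs' hz⟩,
    fun i => (p i).tendsto_c, fun i => ?_, fun x => ?_, ?_⟩, fun x r hr => ?_,
    ⟨(p 0).q s, fun hs' => (p 0).q_eq hs', fun h0 => ?_, fun x k hk => ?_⟩, fun x k hk => ?_⟩
  · exact Oscillating.IsOriginal.existsUnique (θ := (p i).c s) (fun _ hz => hz) ((p i).res_isResolvent hs)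
  · exact Oscillating.IsOriginal.existsUnique (θ := max ((p 0).c s) ((p 1).c s)) (fun _ hz => hz)
      (Oscillating.Kfun_isK hs x)
  · exact Oscillating.IsOriginal.existsUnique (θ := max ((p 0).c s) ((p 1).c s)) (fun _ hz => Oscillating.F_domain hz)
      (Oscillating.Ffun_isF hs)
  · have hrx := hr.trans (min_le_left _ _)
    have hrb := hr.trans (min_le_right _ _)
    exact ⟨Oscillating.down_pos hs (sub_nonneg.2 hrb), Oscillating.timeTransform_down hdriver hs hrb hrx⟩
  · rw [h0]
    refine (p 0).tendsto_q.congr' ?_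
    filter_upwards [self_mem_nhdsWithin] with t ht using (p 0).q_eq ht
  · have hbk := (le_max_right _ _).trans hk
    refine ⟨(Oscillating.F_pos hs (sub_nonneg.2 hbk)).ne', ?_⟩
    have h1 := Oscillating.timeTransform_up μ (fun ω => Oscillating.upTime (Oscillating.xi p b e y x ω) k)
      (fun ω => Oscillating.overshoot (Oscillating.xi p b e y x ω) k) s
    rw [Oscillating.jointTransform_eq hdriver hs hbk (by simp), Oscillating.upSol_at_zero hs] at h1
    exact_mod_cast h1
  · have hbk := (le_max_right _ _).trans hk
    -- Both continuations are explicit: the numerator `C₁^{b-x}(z, s)` of the transform of `K`, and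
    -- the ladder functional of the exponential.
    refine ⟨fun z => Oscillating.C (p 0) (b - x) z s, Oscillating.Hfun p s, Oscillating.C_isContinuation hs _,
      Oscillating.Hfun_isContinuation hs, fun z hz => ?_⟩
    rw [Oscillating.jointTransform_eq hdriver hs hbk hz, Oscillating.upSol_eq]
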